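/- Let $\mathcal X_\lambda=P(x,y;\lambda)\partial_x+Q(x,y;\lambda)\partial_y$, $\lambda\in\Lambda\subset\mathbb R^d$, be a family of planar vector fields that is real analytic in $(x,y,\lambda)$ near $\{(0,0)\}\times\Lambda$, and suppose that for every $\lambda\in\Lambda$ the origin is a monodromic singularity (i.e. $P=Q=0$ there and the local orbits turn around it). Let $(p,q)$ be coprime positive weights associated with an edge of the Newton diagram of $\mathcal X_\lambda$ (for every $\lambda\in\Lambda$), and let $r=r(\lambda)\ge 0$ be the degree of the leading part of the expansion of $\mathcal X_\lambda$ into $(p,q)$-quasihomogeneous vector fields. In the weighted polar coordinates $(x,y)=(\rho^p\cos\varphi,\rho^q\sin\varphi)$ write $\dot\rho=\rho^{r}R(\varphi,\rho)$, $\dot\varphi=\rho^{r}\Theta(\varphi,\rho)$, where $R$ and $\Theta$ extend analytically to $\rho=0$ and $R(\varphi,0)=0$; let $\mathcal F=R/\Theta$ and consider the equation $$\frac{d\rho}{d\varphi}=\mathcal F(\varphi,\rho).\qquad(3)$$ Let $\Omega_{pq}=\{\varphi\in\mathbb R/2\pi\mathbb Z:\Theta(\varphi,0)=0\}$ be the set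 of characteristic directions, and let $\Lambda_{pq}\subset\Lambda$ be the set of those $\lambda$ for which $\Theta$ has zeros with $0<\rho<\varepsilon$ for every $\varepsilon>0$. For $\lambda\in\Lambda\setminus\Lambda_{pq}$ let $\Phi(\varphi;\rho_0)$ be the solution of (3) with $\Phi(0;\rho_0)=\rho_0$, for small $\rho_0>0$, and let $\Pi(\rho_0)=\Phi(2\pi;\rho_0)$ be the Poincaré map. Assume that $0\notin\Omega_{pq}$ for all $\lambda\in\Lambda$, and that there is $m\in\mathbb Z$ such that for every $\lambda\in\Lambda\setminus\Lambda_{pq}$ equation (3) has a Laurent inverse integrating factor $V$ of multiplicity $m$. This means: $V(\varphi,\rho)$ is $2\pi$-periodic in $\varphi$, of class $C^1$ and not locally null for $0<\rho\ll1$, and satisfies $$\frac{\partial V}{\partial\varphi}+\frac{\partial V}{\partial\rho}\,\mathcal F=\frac{\partial\mathcal F}{\partial\rho}\,V ;$$ for each $\varphi\notin\Omega_{pq}$ one has a convergent expansion $V(\varphi,\rho)=\sum_{i\ge m}v_i(\varphi)\rho^i$ for small $\rho>0$, with $C^1$ functions $v_i:\mathbb S^1\setminus\Omega_{pq}\to\mathbb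 R$; and the leading coefficient $v_m$ is not identically zero on the connected component of $\mathbb S^1\setminus\Omega_{pq}$ that contains the direction $\varphi=0$. Then for every $\lambda\in\Lambda\setminus\Lambda_{pq}$ the Poincaré map $\Pi$ is defined for all small $\rho>0$ and has a formal power series (asymptotic) expansion $\Pi(\rho)=\sum_{i\ge1}\eta_i\rho^i$ as $\rho\to0^+$. Moreover: (i) if $m\le 0$, then the origin is a center; (ii) if $m>1$, then $\Pi(\rho)=\rho+\eta_m\rho^m(1+O(\rho))$; in particular, if $\eta_m=0$, then the origin is a center; (iii) if $m=1$ and $\eta_1=1$, then the origin is a center. -/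

import Mathlib

open Set Filter Topology

noncomputable section

namespace Monodromic

/-! ### Newton diagram, weights and quasihomogeneous expansion -/

/-- The coefficient of `x ^ i * y ^ j` in the Taylor series of `f` at the origin. -/
def taylorCoeff (f : ℝ → ℝ → ℝ) (i j : ℕ) : ℝ :=
  iteratedDeriv i (fun x => iteratedDeriv j (fun y => f x y) 0) 0 / (i.factorial * j.factorial)

/-- The support of `P ∂x + Q ∂y`, where `P = ∑ a i j * x ^ i * y ^ (j - 1)` and
`Q = ∑ b i j * x ^ (i - 1) * y ^ j`: the pairs `(i, j)` with `(a i j, b i j) ≠ (0, 0)`. -/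
def support (P Q : ℝ → ℝ → ℝ) : Set (ℕ × ℕ) :=
  {s | (1 ≤ s.2 ∧ taylorCoeff P s.1 (s.2 - 1) ≠ 0) ∨
    (1 ≤ s.1 ∧ taylorCoeff Q (s.1 - 1) s.2 ≠ 0)}

/-- `s` is a point of the support at which `p * i + q * j` is minimal, i.e. a point of the support
on the face of the Newton polygon with inner normal `(p, q)`. -/
def OnFace (P Q : ℝ → ℝ → ℝ) (p q : ℕ) (s : ℕ × ℕ) : Prop :=
  s ∈ support P Q ∧ ∀ t ∈ support P Q, p * s.1 + q * s.2 ≤ p * t.1 + q * t.2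

/-- The set of weights of the Newton diagram: coprime positive `(p, q)` for which the face with
inner normal `(p, q)` is an edge, that is, contains two different points of the support. -/
def newtonWeights (P Q : ℝ → ℝ → ℝ) : Set (ℕ × ℕ) :=
  {w | 0 < w.1 ∧ 0 < w.2 ∧ Nat.Coprime w.1 w.2 ∧
    ∃ s t, s ≠ t ∧ OnFace P Q w.1 w.2 s ∧ OnFace P Q w.1 w.2 t}

/-- The `(p, q)`-quasihomogeneous part of degree `n` of the function `f` analytic at the origin:
the coefficient of `t ^ n` in `f (t ^ p * x) (t ^ q * y)`. -/
def quasiPart (p q : ℕ) (f : ℝ → ℝ → ℝ) (n : ℕ) (x y : ℝ) : ℝ :=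
  iteratedDeriv n (fun t : ℝ => f (t ^ p * x) (t ^ q * y)) 0 / n.factorial

/-- The expansion of `P ∂x + Q ∂y` into quasihomogeneous vector fields
`P_{p+j} ∂x + Q_{q+j} ∂y` of degree `j` starts exactly at `j = r`. -/
def IsLeadingDegree (p q r : ℕ) (P Q : ℝ → ℝ → ℝ) : Prop :=
  (∀ n < p + r, ∀ x y, quasiPart p q P n x y = 0) ∧
  (∀ n < q + r, ∀ x y, quasiPart p q Q n x y = 0) ∧
  ∃ x y, quasiPart p q P (p + r) x y ≠ 0 ∨ quasiPart p q Q (q + r) x y ≠ 0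

/-! ### The weighted polar blow-up `(x, y) = (ρ ^ p * cos φ, ρ ^ q * sin φ)` -/

/-- The value of `f` at the point with weighted polar coordinates `(φ, ρ)`. -/
def polar (p q : ℕ) (f : ℝ → ℝ → ℝ) (φ ρ : ℝ) : ℝ :=
  f (ρ ^ p * Real.cos φ) (ρ ^ q * Real.sin φ)

/-- The Jacobian of the weighted polar blow-up. -/
def jac (p q : ℕ) (φ ρ : ℝ) : ℝ :=
  ρ ^ (p + q - 1) * (p * Real.cos φ ^ 2 + q * Real.sin φ ^ 2)

/-- The angular component `Θ` of the polar vector field divided by `ρ ^ r`, together with its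
extension to `ρ = 0`, which comes from the leading part of the vector field. -/
def Theta (p q r : ℕ) (P Q : ℝ → ℝ → ℝ) (φ ρ : ℝ) : ℝ :=
  if ρ = 0 then
    (p * Real.cos φ * quasiPart p q Q (q + r) (Real.cos φ) (Real.sin φ)
      - q * Real.sin φ * quasiPart p q P (p + r) (Real.cos φ) (Real.sin φ))
      / (p * Real.cos φ ^ 2 + q * Real.sin φ ^ 2)
  else
    (p * ρ ^ (p - 1) * Real.cos φ * polar p q Q φ ρ
      - q * ρ ^ (q - 1) * Real.sin φ * polar p q P φ ρ) / (jac p q φ ρ * ρ ^ r)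

/-- The radial component `R` of the polar vector field divided by `ρ ^ r`; it is `0` at `ρ = 0`. -/
def Rad (p q r : ℕ) (P Q : ℝ → ℝ → ℝ) (φ ρ : ℝ) : ℝ :=
  (ρ ^ q * Real.cos φ * polar p q P φ ρ + ρ ^ p * Real.sin φ * polar p q Q φ ρ)
    / (jac p q φ ρ * ρ ^ r)

/-- The right-hand side of the equation `dρ/dφ = F (φ, ρ) = R (φ, ρ) / Θ (φ, ρ)`. -/
def F (p q r : ℕ) (P Q : ℝ → ℝ → ℝ) (φ ρ : ℝ) : ℝ :=
  Rad p q r P Q φ ρ / Theta p q r P Q φ ρ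

/-- The characteristic directions, as a `2π`-periodic set of angles. -/
def Omega (p q r : ℕ) (P Q : ℝ → ℝ → ℝ) : Set ℝ :=
  {φ | Theta p q r P Q φ 0 = 0}

/-- `Θ` has zeros with `ρ > 0` in every cylinder `0 ≤ ρ < ε`. -/
def HasZeroAngularSpeed (p q r : ℕ) (P Q : ℝ → ℝ → ℝ) : Prop :=
  ∀ ε > 0, ∃ φ ρ : ℝ, 0 < ρ ∧ ρ < ε ∧ Theta p q r P Q φ ρ = 0

/-- The `(p, q)`-critical parameters of a family with parameters in `Λ`
(the leading degree `r l` may depend on the parameter `l`). -/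
def criticalParams {d : ℕ} (p q : ℕ) (r : (Fin d → ℝ) → ℕ)
    (P Q : (Fin d → ℝ) → ℝ → ℝ → ℝ) (Λ : Set (Fin d → ℝ)) : Set (Fin d → ℝ) :=
  {l ∈ Λ | HasZeroAngularSpeed p q (r l) (P l) (Q l)}

/-! ### Monodromic singularities and centers -/

/-- `γ` restricted to `[0, T]` is a piece of an orbit of `x' = P, y' = Q` that makes exactly one
turn around the origin (in either sense) inside the punctured ball of radius `ε`; `θ` is a
continuous determination of the angle along it. -/
structure IsTurn (P Q : ℝ → ℝ → ℝ) (ε T : ℝ) (γ : ℝ → ℝ × ℝ) (θ : ℝ → ℝ) : Prop where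
  pos : 0 < T
  ode : ∀ t ∈ Icc 0 T,
    HasDerivWithinAt γ (P (γ t).1 (γ t).2, Q (γ t).1 (γ t).2) (Icc 0 T) t
  small : ∀ t ∈ Icc 0 T, ‖γ t‖ < ε
  cont : ContinuousOn θ (Icc 0 T)
  angle : ∀ t ∈ Icc 0 T, ∃ s > 0, γ t = (s * Real.cos (θ t), s * Real.sin (θ t))
  turn : |θ T - θ 0| = 2 * Real.pi

/-- The origin is a singularity and the local orbits turn around it. -/
def IsMonodromic (P Q : ℝ → ℝ → ℝ) : Prop :=
  P 0 0 = 0 ∧ Q 0 0 = 0 ∧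
  ∀ ε > 0, ∃ δ > 0, ∀ z : ℝ × ℝ, z ≠ 0 → ‖z‖ < δ →
    ∃ T γ θ, IsTurn P Q ε T γ θ ∧ γ 0 = z

/-- The origin is a center: it is a singularity and the orbits through all the other points near
it are closed orbits around it. -/
def IsCenter (P Q : ℝ → ℝ → ℝ) : Prop :=
  P 0 0 = 0 ∧ Q 0 0 = 0 ∧
  ∀ ε > 0, ∃ δ > 0, ∀ z : ℝ × ℝ, z ≠ 0 → ‖z‖ < δ →
    ∃ T γ θ, IsTurn P Q ε T γ θ ∧ γ 0 = z ∧ γ T = z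

/-! ### The Poincaré map -/

/-- `Π` is (a representative of the germ at `0` of) the Poincaré map: `Π ρ₀ = Φ (2π; ρ₀)`, where
`Φ (·; ρ₀)` solves `dρ/dφ = F (φ, ρ)`, `Φ (0; ρ₀) = ρ₀`, inside an arbitrarily small cylinder when
`ρ₀ > 0` is small enough. -/
def IsPoincareMap (p q r : ℕ) (P Q : ℝ → ℝ → ℝ) (Pi : ℝ → ℝ) : Prop :=
  ∀ ε > 0, ∃ δ > 0, ∀ ρ₀ : ℝ, 0 < ρ₀ → ρ₀ < δ →
    ∃ Φ : ℝ → ℝ, Φ 0 = ρ₀ ∧ Φ (2 * Real.pi) = Pi ρ₀ ∧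
      ∀ φ ∈ Icc 0 (2 * Real.pi), 0 < Φ φ ∧ Φ φ < ε ∧
        HasDerivWithinAt Φ (F p q r P Q φ (Φ φ)) (Icc 0 (2 * Real.pi)) φ

/-! ### Inverse integrating factors -/

/-- The open part `0 < ρ < ε`, `Θ ≠ 0` of the cylinder (angles are taken in `ℝ`). -/
def region (p q r : ℕ) (P Q : ℝ → ℝ → ℝ) (ε : ℝ) : Set (ℝ × ℝ) :=
  {z | 0 < z.2 ∧ z.2 < ε ∧ Theta p q r P Q z.1 z.2 ≠ 0}

/-- `V (φ, ρ)` is an inverse integrating factor of `dρ/dφ = F (φ, ρ)`: a function on the cylinder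
(`2π`-periodic in `φ`), not locally null and of class `C¹` where `0 < ρ < ε` and `Θ ≠ 0`,
that satisfies `∂V/∂φ + ∂V/∂ρ * F = ∂F/∂ρ * V`. -/
def IsInvIntFactor (p q r : ℕ) (P Q : ℝ → ℝ → ℝ) (V : ℝ → ℝ → ℝ) : Prop :=
  (∀ φ ρ, V (φ + 2 * Real.pi) ρ = V φ ρ) ∧
  ∃ ε > 0,
    ContDiffOn ℝ 1 (fun z : ℝ × ℝ => V z.1 z.2) (region p q r P Q ε) ∧
    (∀ W ⊆ region p q r P Q ε, IsOpen W → W.Nonempty → ∃ z ∈ W, V z.1 z.2 ≠ 0) ∧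
    ∀ z ∈ region p q r P Q ε,
      deriv (fun φ => V φ z.2) z.1 + deriv (fun ρ => V z.1 ρ) z.2 * F p q r P Q z.1 z.2
        = deriv (fun ρ => F p q r P Q z.1 ρ) z.2 * V z.1 z.2

/-- `V` is a Laurent inverse integrating factor of multiplicity `m`: for every non-characteristic
angle `φ` it is the sum of a convergent series `∑_{i ≥ m} v i φ * ρ ^ i` for small `ρ > 0`, the
coefficients are `C¹` functions on the complement of the characteristic directions, and the
leading coefficient `v m` does not vanish identically on the arc of non-characteristic directions
that contains the direction `φ = 0` of the transversal section. -/
def IsLaurentInvIntFactor (p q r : ℕ) (P Q : ℝ → ℝ → ℝ) (V : ℝ → ℝ → ℝ) (m : ℤ) : Prop :=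
  IsInvIntFactor p q r P Q V ∧
  ∃ v : ℤ → ℝ → ℝ,
    (∀ i φ, v i (φ + 2 * Real.pi) = v i φ) ∧
    (∀ i, m ≤ i → ContDiffOn ℝ 1 (v i) (Omega p q r P Q)ᶜ) ∧
    (∀ φ ∉ Omega p q r P Q, ∃ δ > 0, ∀ ρ : ℝ, 0 < ρ → ρ < δ →
      HasSum (fun k : ℕ => v (m + k) φ * ρ ^ (m + k : ℤ)) (V φ ρ)) ∧
    ∃ φ, (∀ ψ ∈ uIcc 0 φ, ψ ∉ Omega p q r P Q) ∧ v m φ ≠ 0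

/-- `f` has the asymptotic (formal power series) expansion `∑_{i ≥ 1} η i * ρ ^ i` as `ρ → 0⁺`. -/
def HasFormalExpansion (f : ℝ → ℝ) (η : ℕ → ℝ) : Prop :=
  ∀ N : ℕ, (fun ρ => f ρ - ∑ i ∈ Finset.Icc 1 N, η i * ρ ^ i)
    =O[𝓝[>] 0] (fun ρ : ℝ => ρ ^ (N + 1))

end Monodromic

end

/-! Fix a parameter outside the critical set. For small `ρ > 0` the angular speed has no zeros, so
the polar equation `dρ/dφ = F` is smooth on an open strip `0 < ρ < e`. It need not extend to `ρ = 0`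
across characteristic directions, so regularity of `Π` at `0` does not follow from the equation
alone. It comes from the inverse integrating factor.

Along a solution, `V` satisfies the variational equation. Hence the derivative of the flow map is a
quotient of values of `V` (`hasDerivAt_flow`), and periodicity in `φ` gives `V(0, Π) = V(0, ·) Π'`
on the section. There `V(0, ρ) = ρ ^ m * g ρ` with `g` analytic. The value `g 0 = v m 0` is nonzero:
near a compact arc of non-characteristic directions `F = O(ρ)` and `∂F/∂ρ` is bounded, so both `ρ`
and `V` change by bounded factors along solutions, and a zero of `v m` at `φ = 0` would spread over
the whole arc (`exists_F_bounds`, `leading_eq_zero_of_arc`, `leading_coeff_ne_zero`).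

Now let `W` be a primitive of `1 / V(0, ·)`. The relation above says that `W ∘ Π - W` is a constant
`c`. Since `W` is injective, `c = 0` means `Π = id`. If `m ≤ 0`, then `W` extends continuously to
`0` and `c = 0` is forced. If `m = n + 1`, then `W = A / x ^ n + κ log x` with `A` smooth, and the
substitution `Π = x ψ` turns the relation into an equation that the implicit function theorem solves
for a smooth `ψ`; this yields the formal expansion. When `c ≠ 0`, the mean value theorem gives `Π -
x ~ c g(0) x ^ m` for `m > 1`, and `ψ 0 = exp (c g(0)) ≠ 1` for `m = 1`. So the conditions on the
coefficients in (ii) and (iii) exclude `c ≠ 0` (`eq_id_or_exists_smooth_quotient`,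
`exists_leading_form`).

The rest is geometry. A turn of an orbit is, in weighted polar coordinates, the graph of a solution;
turns starting on the positive half-axis cover exactly one period and provide `Π`
(`exists_isPoincareMap`). Conversely, if `Π = id`, the solutions are periodic and, reparametrized by
time, are closed orbits through all nearby points (`isCenter_of_poincareMap_eq_id`). -/

namespace Monodromic

/-! ### Scalar equations `ρ' = f φ ρ` on a strip -/

/-- The open strip `0 < ρ < e` in the `(φ, ρ)` plane. -/
def strip (e : ℝ) : Set (ℝ × ℝ) := {z | 0 < z.2 ∧ z.2 < e}

/-- `Φ` solves `ρ' = f φ ρ` on `[a, b]` with values in `(0, e)`. -/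
def IsSolOn (f : ℝ → ℝ → ℝ) (e a b : ℝ) (Φ : ℝ → ℝ) : Prop :=
  ∀ φ ∈ Icc a b, 0 < Φ φ ∧ Φ φ < e ∧ HasDerivWithinAt Φ (f φ (Φ φ)) (Icc a b) φ

/-- The derivative of `f φ ρ` with respect to `ρ`. -/
noncomputable def dRho (f : ℝ → ℝ → ℝ) (φ ρ : ℝ) : ℝ := deriv (fun x => f φ x) ρ

theorem isOpen_strip (e : ℝ) : IsOpen (strip e) :=
  (isOpen_lt continuous_const continuous_snd).inter (isOpen_lt continuous_snd continuous_const)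

/-- Two-sided Grönwall inequality. -/
theorem abs_le_mul_exp_of_abs_deriv_le {u u' : ℝ → ℝ} {a b L : ℝ} (hL : 0 ≤ L)
    (hu : ∀ x ∈ Icc a b, HasDerivWithinAt u (u' x) (Icc a b) x)
    (hb : ∀ x ∈ Icc a b, |u' x| ≤ L * |u x|) {s t : ℝ} (hs : s ∈ Icc a b) (ht : t ∈ Icc a b) :
    |u t| ≤ |u s| * Real.exp (L * (b - a)) := by
  -- Multiplying `u ^ 2` by `exp (2 * L * x)` makes it increasing, and by `exp (-2 * L * x)`
  -- decreasing; the two signs of `K` give the estimate in both directions of the variable.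
  have key : ∀ K : ℝ, |K| = L → ∀ x ∈ Icc a b,
      HasDerivWithinAt (fun x => u x ^ 2 * Real.exp (2 * K * x))
        (2 * (u x * u' x + K * u x ^ 2) * Real.exp (2 * K * x)) (Icc a b) x := by
    intro K _ x hx
    have h1 := (hu x hx).pow 2
    have h2 : HasDerivWithinAt (fun x => Real.exp (2 * K * x))
        (Real.exp (2 * K * x) * (2 * K)) (Icc a b) x := by
      simpa using (((hasDerivAt_id x).const_mul (2 * K)).exp).hasDerivWithinAt
    convert! h1.mul h2 using 1
    simp only [Nat.cast_ofNat, Nat.add_one_sub_one, pow_one, Pi.pow_apply]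
    ring
  have hprod : ∀ x ∈ Icc a b, |u x * u' x| ≤ L * u x ^ 2 := by
    intro x hx
    rw [abs_mul, ← sq_abs (u x)]
    nlinarith [hb x hx, abs_nonneg (u x)]
  have hmono : MonotoneOn (fun x => u x ^ 2 * Real.exp (2 * L * x)) (Icc a b) := by
    refine monotoneOn_of_hasDerivWithinAt_nonneg (convex_Icc a b)
      (fun x hx => (key L (abs_of_nonneg hL) x hx).continuousWithinAt)
      (fun x hx => (key L (abs_of_nonneg hL) x (interior_subset hx)).mono interior_subset) ?_
    intro x hx
    have := (abs_le.1 (hprod x (interior_subset hx))).1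
    have h3 : 0 ≤ u x * u' x + L * u x ^ 2 := by linarith
    positivity
  have hanti : AntitoneOn (fun x => u x ^ 2 * Real.exp (2 * (-L) * x)) (Icc a b) := by
    refine antitoneOn_of_hasDerivWithinAt_nonpos (convex_Icc a b)
      (fun x hx => (key (-L) (by rw [abs_neg, abs_of_nonneg hL]) x hx).continuousWithinAt)
      (fun x hx => (key (-L) (by rw [abs_neg, abs_of_nonneg hL]) x
        (interior_subset hx)).mono interior_subset) ?_
    intro x hx
    have := (abs_le.1 (hprod x (interior_subset hx))).2
    have h3 : u x * u' x + -L * u x ^ 2 ≤ 0 := by linarith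
    exact mul_nonpos_of_nonpos_of_nonneg (by linarith) (Real.exp_pos _).le
  have hsq : u t ^ 2 ≤ u s ^ 2 * Real.exp (2 * (L * (b - a))) := by
    rcases le_total s t with hst | hst
    · have h := hanti hs ht hst
      simp only at h
      have h1 : u t ^ 2 = u t ^ 2 * Real.exp (2 * -L * t) * Real.exp (2 * L * t) := by
        rw [mul_assoc, ← Real.exp_add]; simp
      rw [h1]
      calc _ ≤ u s ^ 2 * Real.exp (2 * -L * s) * Real.exp (2 * L * t) := by gcongr
        _ = u s ^ 2 * Real.exp (2 * (L * (t - s))) := by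
          rw [mul_assoc, ← Real.exp_add]; ring_nf
        _ ≤ _ := by gcongr; exacts [ht.2, hs.1]
    · have h := hmono ht hs hst
      simp only at h
      have h1 : u t ^ 2 = u t ^ 2 * Real.exp (2 * L * t) * Real.exp (2 * -L * t) := by
        rw [mul_assoc, ← Real.exp_add]; simp
      rw [h1]
      calc _ ≤ u s ^ 2 * Real.exp (2 * L * s) * Real.exp (2 * -L * t) := by gcongr
        _ = u s ^ 2 * Real.exp (2 * (L * (s - t))) := by
          rw [mul_assoc, ← Real.exp_add]; ring_nf
        _ ≤ _ := by gcongr; exacts [hs.2, ht.1]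
  refine abs_le_of_sq_le_sq' ?_ (by positivity) |> abs_le.2
  rw [mul_pow, sq_abs, ← Real.exp_nat_mul]
  exact_mod_cast hsq

variable {f : ℝ → ℝ → ℝ} {e a b : ℝ}

theorem hasDerivAt_dRho (hf : ContDiffOn ℝ 1 (fun z : ℝ × ℝ => f z.1 z.2) (strip e)) {z : ℝ × ℝ}
    (hz : z ∈ strip e) :
    HasDerivAt (fun x => f z.1 x) (fderiv ℝ (fun z : ℝ × ℝ => f z.1 z.2) z (0, 1)) z.2 := by
  have h1 : HasFDerivAt (fun z : ℝ × ℝ => f z.1 z.2) _ z :=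
    ((hf.contDiffAt ((isOpen_strip e).mem_nhds hz)).differentiableAt one_ne_zero).hasFDerivAt
  have h2 : HasDerivAt (fun x : ℝ => (z.1, x)) ((0 : ℝ), (1 : ℝ)) z.2 :=
    (hasDerivAt_const _ _).prodMk (hasDerivAt_id _)
  exact HasFDerivAt.comp_hasDerivAt z.2 (f := fun x : ℝ => (z.1, x)) h1 h2

theorem dRho_eq (hf : ContDiffOn ℝ 1 (fun z : ℝ × ℝ => f z.1 z.2) (strip e)) {z : ℝ × ℝ}
    (hz : z ∈ strip e) :
    dRho f z.1 z.2 = fderiv ℝ (fun z : ℝ × ℝ => f z.1 z.2) z (0, 1) :=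
  (hasDerivAt_dRho hf hz).deriv

theorem hasDerivAt_snd (hf : ContDiffOn ℝ 1 (fun z : ℝ × ℝ => f z.1 z.2) (strip e)) {φ ρ : ℝ}
    (h0 : 0 < ρ) (h1 : ρ < e) : HasDerivAt (fun x => f φ x) (dRho f φ ρ) ρ := by
  have hz : ((φ, ρ) : ℝ × ℝ) ∈ strip e := ⟨h0, h1⟩
  have := hasDerivAt_dRho hf hz
  rwa [← dRho_eq hf hz] at this

theorem continuousOn_dRho (hf : ContDiffOn ℝ 1 (fun z : ℝ × ℝ => f z.1 z.2) (strip e)) :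
    ContinuousOn (fun z : ℝ × ℝ => dRho f z.1 z.2) (strip e) := by
  have h1 := hf.continuousOn_fderiv_of_isOpen (isOpen_strip e) le_rfl
  exact (h1.clm_apply continuousOn_const).congr fun z hz => dRho_eq hf hz

/-- A solution on a compact interval has values in a compact subinterval of `(0, e)`. -/
theorem IsSolOn.exists_bounds {Φ : ℝ → ℝ} (h : IsSolOn f e a b Φ) (hab : a ≤ b) :
    ∃ k K, 0 < k ∧ K < e ∧ ∀ φ ∈ Icc a b, Φ φ ∈ Icc k K := by
  have hc : ContinuousOn Φ (Icc a b) := fun φ hφ => (h φ hφ).2.2.continuousWithinAt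
  obtain ⟨x, hx, hmin⟩ := isCompact_Icc.exists_isMinOn (nonempty_Icc.2 hab) hc
  obtain ⟨y, hy, hmax⟩ := isCompact_Icc.exists_isMaxOn (nonempty_Icc.2 hab) hc
  exact ⟨Φ x, Φ y, (h x hx).1, (h y hy).2.1, fun φ hφ => ⟨hmin hφ, hmax hφ⟩⟩

theorem exists_abs_dRho_le (hf : ContDiffOn ℝ 1 (fun z : ℝ × ℝ => f z.1 z.2) (strip e))
    {k K : ℝ} (hk : 0 < k) (hK : K < e) :
    ∃ L, 0 ≤ L ∧ ∀ φ ∈ Icc a b, ∀ ρ ∈ Icc k K, |dRho f φ ρ| ≤ L := by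
  have hsub : Icc a b ×ˢ Icc k K ⊆ strip e := fun z hz =>
    ⟨hk.trans_le hz.2.1, hz.2.2.trans_lt hK⟩
  obtain ⟨L, hL⟩ := (isCompact_Icc.prod isCompact_Icc).exists_bound_of_continuousOn
    ((continuousOn_dRho hf).mono hsub)
  exact ⟨max L 0, le_max_right _ _, fun φ hφ ρ hρ => (hL (φ, ρ) ⟨hφ, hρ⟩).trans (le_max_left _ _)⟩

theorem abs_sub_le_of_dRho_le (hf : ContDiffOn ℝ 1 (fun z : ℝ × ℝ => f z.1 z.2) (strip e))
    {k K L φ : ℝ} (hk : 0 < k) (hK : K < e) (hL : ∀ ρ ∈ Icc k K, |dRho f φ ρ| ≤ L)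
    {x y : ℝ} (hx : x ∈ Icc k K) (hy : y ∈ Icc k K) : |f φ y - f φ x| ≤ L * |y - x| :=
  (convex_Icc k K).norm_image_sub_le_of_norm_hasDerivWithin_le
    (fun _ hρ => (hasDerivAt_snd hf (hk.trans_le hρ.1) (hρ.2.trans_lt hK)).hasDerivWithinAt)
    hL hx hy

/-- Two solutions with values in a compact interval separate at most exponentially. -/
theorem IsSolOn.abs_sub_le (hf : ContDiffOn ℝ 1 (fun z : ℝ × ℝ => f z.1 z.2) (strip e))
    {Φ Ψ : ℝ → ℝ} (hΦ : IsSolOn f e a b Φ) (hΨ : IsSolOn f e a b Ψ) {k K L : ℝ} (hk : 0 < k)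
    (hK : K < e) (hL0 : 0 ≤ L) (hL : ∀ φ ∈ Icc a b, ∀ ρ ∈ Icc k K, |dRho f φ ρ| ≤ L)
    (hΦk : ∀ φ ∈ Icc a b, Φ φ ∈ Icc k K) (hΨk : ∀ φ ∈ Icc a b, Ψ φ ∈ Icc k K)
    {s t : ℝ} (hs : s ∈ Icc a b) (ht : t ∈ Icc a b) :
    |Φ t - Ψ t| ≤ |Φ s - Ψ s| * Real.exp (L * (b - a)) :=
  abs_le_mul_exp_of_abs_deriv_le (u := fun φ => Φ φ - Ψ φ) hL0
    (fun φ hφ => (hΦ φ hφ).2.2.sub (hΨ φ hφ).2.2)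
    (fun φ hφ => abs_sub_le_of_dRho_le hf hk hK (hL φ hφ) (hΨk φ hφ) (hΦk φ hφ)) hs ht

/-- Both solutions stay in one compact part of the strip, where the equation is uniformly Lipschitz,
so their distance satisfies a Grönwall bound with zero initial value. -/
theorem IsSolOn.eqOn (hf : ContDiffOn ℝ 1 (fun z : ℝ × ℝ => f z.1 z.2) (strip e))
    {Φ Ψ : ℝ → ℝ} (hΦ : IsSolOn f e a b Φ) (hΨ : IsSolOn f e a b Ψ)
    {s : ℝ} (hs : s ∈ Icc a b) (h : Φ s = Ψ s) : EqOn Φ Ψ (Icc a b) := by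
  have hab : a ≤ b := hs.1.trans hs.2
  obtain ⟨k, K, hk, hK, h1⟩ := hΦ.exists_bounds hab
  obtain ⟨k', K', hk', hK', h2⟩ := hΨ.exists_bounds hab
  obtain ⟨L, hL0, hL⟩ := exists_abs_dRho_le (a := a) (b := b) hf (lt_min hk hk') (max_lt hK hK')
  intro t ht
  have := hΦ.abs_sub_le hf hΨ (lt_min hk hk') (max_lt hK hK') hL0 hL
    (fun φ hφ => Icc_subset_Icc (min_le_left _ _) (le_max_left _ _) (h1 φ hφ))
    (fun φ hφ => Icc_subset_Icc (min_le_right _ _) (le_max_right _ _) (h2 φ hφ)) hs ht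
  rw [h, sub_self, abs_zero, zero_mul] at this
  exact sub_eq_zero.1 (abs_nonpos_iff.1 this)

theorem IsSolOn.continuousOn {Φ : ℝ → ℝ} (h : IsSolOn f e a b Φ) : ContinuousOn Φ (Icc a b) :=
  fun φ hφ => (h φ hφ).2.2.continuousWithinAt

theorem IsSolOn.mono {Φ : ℝ → ℝ} (h : IsSolOn f e a b Φ) {a' b' : ℝ} (ha : a ≤ a') (hb : b' ≤ b) :
    IsSolOn f e a' b' Φ := fun φ hφ =>
  have hφ' : φ ∈ Icc a b := Icc_subset_Icc ha hb hφ
  ⟨(h φ hφ').1, (h φ hφ').2.1, (h φ hφ').2.2.mono (Icc_subset_Icc ha hb)⟩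

theorem IsSolOn.mono_strip {Φ : ℝ → ℝ} {e' : ℝ} (h : IsSolOn f e a b Φ) (he : e ≤ e') :
    IsSolOn f e' a b Φ := fun φ hφ =>
  ⟨(h φ hφ).1, (h φ hφ).2.1.trans_le he, (h φ hφ).2.2⟩

theorem IsSolOn.congr {Φ Ψ : ℝ → ℝ} (h : IsSolOn f e a b Φ) (hΨ : EqOn Ψ Φ (Icc a b)) :
    IsSolOn f e a b Ψ := fun φ hφ => by
  rw [hΨ hφ]
  exact ⟨(h φ hφ).1, (h φ hφ).2.1, (h φ hφ).2.2.congr hΨ (hΨ hφ)⟩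

/-- Solutions of a `c`-periodic equation may be shifted by `c`. -/
theorem IsSolOn.shift {Φ : ℝ → ℝ} (h : IsSolOn f e a b Φ) {c : ℝ}
    (hper : ∀ φ ρ, f (φ + c) ρ = f φ ρ) :
    IsSolOn f e (a - c) (b - c) (fun φ => Φ (φ + c)) := by
  intro φ hφ
  have hφ' : φ + c ∈ Icc a b := ⟨by linarith [hφ.1], by linarith [hφ.2]⟩
  refine ⟨(h _ hφ').1, (h _ hφ').2.1, ?_⟩
  have h1 : HasDerivWithinAt (fun φ : ℝ => φ + c) 1 (Icc (a - c) (b - c)) φ :=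
    ((hasDerivAt_id φ).add_const c).hasDerivWithinAt
  have := (h _ hφ').2.2.scomp φ h1
    (fun x (hx : x ∈ Icc (a - c) (b - c)) =>
      (⟨by linarith [hx.1], by linarith [hx.2]⟩ : x + c ∈ Icc a b))
  simpa [hper, Function.comp_def] using this

/-- Solutions are ordered as their values at one point. -/
theorem IsSolOn.lt_of_lt (hf : ContDiffOn ℝ 1 (fun z : ℝ × ℝ => f z.1 z.2) (strip e))
    {Φ Ψ : ℝ → ℝ} (hΦ : IsSolOn f e a b Φ) (hΨ : IsSolOn f e a b Ψ)
    {s t : ℝ} (hs : s ∈ Icc a b) (ht : t ∈ Icc a b) (h : Φ s < Ψ s) : Φ t < Ψ t := by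
  by_contra! hcon
  have hc : ContinuousOn (fun φ => Ψ φ - Φ φ) (Icc a b) := hΨ.continuousOn.sub hΦ.continuousOn
  have h0 : (0 : ℝ) ∈ (fun φ => Ψ φ - Φ φ) '' Icc a b :=
    isPreconnected_Icc.intermediate_value ht hs hc ⟨by simpa using hcon, by simpa using h.le⟩
  obtain ⟨x, hx, hx0⟩ := h0
  exact h.ne (hΦ.eqOn hf hΨ hx (sub_eq_zero.1 hx0).symm hs)

theorem IsSolOn.le_of_le (hf : ContDiffOn ℝ 1 (fun z : ℝ × ℝ => f z.1 z.2) (strip e))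
    {Φ Ψ : ℝ → ℝ} (hΦ : IsSolOn f e a b Φ) (hΨ : IsSolOn f e a b Ψ)
    {s t : ℝ} (hs : s ∈ Icc a b) (ht : t ∈ Icc a b) (h : Φ s ≤ Ψ s) : Φ t ≤ Ψ t := by
  by_contra! hcon
  exact absurd (hΨ.lt_of_lt hf hΦ ht hs hcon) h.not_gt

/-- Solutions whose values at `s` lie in a compact interval spanned by two solutions depend
Lipschitz continuously on the value at `s`. -/
theorem exists_lipschitz_of_between (hf : ContDiffOn ℝ 1 (fun z : ℝ × ℝ => f z.1 z.2) (strip e))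
    {Φ₁ Φ₂ : ℝ → ℝ} (h₁ : IsSolOn f e a b Φ₁) (h₂ : IsSolOn f e a b Φ₂) {s : ℝ}
    (hs : s ∈ Icc a b) :
    ∃ C, 0 ≤ C ∧ ∃ k K, 0 < k ∧ K < e ∧
      (∀ Φ, IsSolOn f e a b Φ → Φ s ∈ Icc (Φ₁ s) (Φ₂ s) → ∀ t ∈ Icc a b, Φ t ∈ Icc k K) ∧
      ∀ Φ Ψ, IsSolOn f e a b Φ → IsSolOn f e a b Ψ → Φ s ∈ Icc (Φ₁ s) (Φ₂ s) →
        Ψ s ∈ Icc (Φ₁ s) (Φ₂ s) → ∀ t ∈ Icc a b, |Φ t - Ψ t| ≤ C * |Φ s - Ψ s| := by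
  have hab : a ≤ b := hs.1.trans hs.2
  obtain ⟨k, K, hk, hK, hb1⟩ := h₁.exists_bounds hab
  obtain ⟨k', K', hk', hK', hb2⟩ := h₂.exists_bounds hab
  -- `Φ₁` and `Φ₂` are barriers: the minimum of one and the maximum of the other confine every
  -- solution in between, so a single constant `L` serves them all.
  obtain ⟨L, hL0, hL⟩ := exists_abs_dRho_le (a := a) (b := b) hf hk hK'
  have hmem : ∀ Φ, IsSolOn f e a b Φ → Φ s ∈ Icc (Φ₁ s) (Φ₂ s) → ∀ t ∈ Icc a b, Φ t ∈ Icc k K' :=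
    fun Φ hΦ hΦs t ht => ⟨(hb1 t ht).1.trans (h₁.le_of_le hf hΦ hs ht hΦs.1),
      (hΦ.le_of_le hf h₂ hs ht hΦs.2).trans (hb2 t ht).2⟩
  refine ⟨Real.exp (L * (b - a)), (Real.exp_pos _).le, k, K', hk, hK', hmem, ?_⟩
  intro Φ Ψ hΦ hΨ hΦs hΨs t ht
  rw [mul_comm]
  exact hΦ.abs_sub_le hf hΨ hk hK' hL0 hL (hmem Φ hΦ hΦs) (hmem Ψ hΨ hΨs) hs ht

end Monodromic

namespace Monodromic

/-! ### Inverse integrating factors along solutions -/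

variable {f V : ℝ → ℝ → ℝ} {e a b : ℝ}

/-- Along a solution, an inverse integrating factor satisfies the variational equation. -/
theorem IsSolOn.hasDerivWithinAt_invIntFactor
    (hV : ContDiffOn ℝ 1 (fun z : ℝ × ℝ => V z.1 z.2) (strip e))
    (hpde : ∀ z ∈ strip e, deriv (fun φ => V φ z.2) z.1 + dRho V z.1 z.2 * f z.1 z.2
      = dRho f z.1 z.2 * V z.1 z.2)
    {Φ : ℝ → ℝ} (hΦ : IsSolOn f e a b Φ) {φ : ℝ} (hφ : φ ∈ Icc a b) :
    HasDerivWithinAt (fun φ => V φ (Φ φ)) (dRho f φ (Φ φ) * V φ (Φ φ)) (Icc a b) φ := by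
  have hz : ((φ, Φ φ) : ℝ × ℝ) ∈ strip e := ⟨(hΦ φ hφ).1, (hΦ φ hφ).2.1⟩
  have h1 : HasFDerivAt (fun z : ℝ × ℝ => V z.1 z.2) _ (φ, Φ φ) :=
    ((hV.contDiffAt ((isOpen_strip e).mem_nhds hz)).differentiableAt one_ne_zero).hasFDerivAt
  have h2 : HasDerivWithinAt (fun x : ℝ => (x, Φ x)) ((1 : ℝ), f φ (Φ φ)) (Icc a b) φ :=
    (hasDerivWithinAt_id _ _).prodMk (hΦ φ hφ).2.2
  have h3 := HasFDerivAt.comp_hasDerivWithinAt φ (f := fun x : ℝ => (x, Φ x)) h1 h2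
  have h4 : HasDerivAt (fun x => V x (Φ φ))
      (fderiv ℝ (fun z : ℝ × ℝ => V z.1 z.2) (φ, Φ φ) (1, 0)) φ :=
    HasFDerivAt.comp_hasDerivAt φ (f := fun x : ℝ => (x, Φ φ)) h1
      ((hasDerivAt_id _).prodMk (hasDerivAt_const _ _))
  have h5 := hpde _ hz
  rw [dRho_eq hV hz, h4.deriv] at h5
  simp only at h5
  rw [← h5]
  convert! h3 using 1
  have : ((1 : ℝ), f φ (Φ φ)) = (1, 0) + f φ (Φ φ) • ((0 : ℝ), (1 : ℝ)) := by simp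
  rw [this, map_add, map_smul, smul_eq_mul, mul_comm]

/-- Along a solution `V` obeys a linear equation with coefficient `∂f/∂ρ`, so Grönwall applies in
both directions of `φ`. -/
theorem IsSolOn.abs_invIntFactor_le
    (hV : ContDiffOn ℝ 1 (fun z : ℝ × ℝ => V z.1 z.2) (strip e))
    (hpde : ∀ z ∈ strip e, deriv (fun φ => V φ z.2) z.1 + dRho V z.1 z.2 * f z.1 z.2
      = dRho f z.1 z.2 * V z.1 z.2)
    {Φ : ℝ → ℝ} (hΦ : IsSolOn f e a b Φ) {L : ℝ} (hL0 : 0 ≤ L)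
    (hL : ∀ φ ∈ Icc a b, |dRho f φ (Φ φ)| ≤ L) {s t : ℝ} (hs : s ∈ Icc a b) (ht : t ∈ Icc a b) :
    |V t (Φ t)| ≤ |V s (Φ s)| * Real.exp (L * (b - a)) :=
  abs_le_mul_exp_of_abs_deriv_le (u := fun φ => V φ (Φ φ)) hL0
    (fun φ hφ => hΦ.hasDerivWithinAt_invIntFactor hV hpde hφ)
    (fun φ hφ => by rw [abs_mul]; gcongr; exact hL φ hφ) hs ht

theorem IsSolOn.invIntFactor_ne_zero
    (hf : ContDiffOn ℝ 1 (fun z : ℝ × ℝ => f z.1 z.2) (strip e))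
    (hV : ContDiffOn ℝ 1 (fun z : ℝ × ℝ => V z.1 z.2) (strip e))
    (hpde : ∀ z ∈ strip e, deriv (fun φ => V φ z.2) z.1 + dRho V z.1 z.2 * f z.1 z.2
      = dRho f z.1 z.2 * V z.1 z.2)
    {Φ : ℝ → ℝ} (hΦ : IsSolOn f e a b Φ) {s t : ℝ} (hs : s ∈ Icc a b) (ht : t ∈ Icc a b)
    (h : V s (Φ s) ≠ 0) : V t (Φ t) ≠ 0 := by
  obtain ⟨k, K, hk, hK, hb⟩ := hΦ.exists_bounds (hs.1.trans hs.2)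
  obtain ⟨L, hL0, hL⟩ := exists_abs_dRho_le (a := a) (b := b) hf hk hK
  intro h0
  have := hΦ.abs_invIntFactor_le hV hpde hL0 (fun φ hφ => hL φ hφ _ (hb φ hφ)) ht hs
  rw [h0, abs_zero, zero_mul] at this
  exact h (abs_nonpos_iff.1 this)

/-- The difference quotients of the flow map are controlled by the inverse integrating factor. -/
theorem IsSolOn.abs_log_sub_le
    (hf : ContDiffOn ℝ 1 (fun z : ℝ × ℝ => f z.1 z.2) (strip e))
    (hV : ContDiffOn ℝ 1 (fun z : ℝ × ℝ => V z.1 z.2) (strip e))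
    (hpde : ∀ z ∈ strip e, deriv (fun φ => V φ z.2) z.1 + dRho V z.1 z.2 * f z.1 z.2
      = dRho f z.1 z.2 * V z.1 z.2)
    {Φ Ψ : ℝ → ℝ} (hΦ : IsSolOn f e a b Φ) (hΨ : IsSolOn f e a b Ψ)
    (hne : ∀ φ ∈ Icc a b, Ψ φ ≠ Φ φ) (hV0 : ∀ φ ∈ Icc a b, V φ (Φ φ) ≠ 0) {η : ℝ}
    (hη : ∀ φ ∈ Icc a b, ∀ ξ ∈ uIcc (Φ φ) (Ψ φ), |dRho f φ ξ - dRho f φ (Φ φ)| ≤ η)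
    (hab : a ≤ b) :
    |Real.log ((Ψ b - Φ b) / V b (Φ b)) - Real.log ((Ψ a - Φ a) / V a (Φ a))| ≤ η * (b - a) := by
  -- The logarithmic derivative of `Ψ - Φ` is a difference quotient of `f`, that of `V` is `∂f/∂ρ`.
  -- They nearly cancel when the solutions are close.
  have hder : ∀ φ ∈ Icc a b, HasDerivWithinAt
      (fun φ => Real.log ((Ψ φ - Φ φ) / V φ (Φ φ)))
      ((f φ (Ψ φ) - f φ (Φ φ)) / (Ψ φ - Φ φ) - dRho f φ (Φ φ)) (Icc a b) φ := by
    intro φ hφ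
    have h1 := (((hΨ φ hφ).2.2.sub (hΦ φ hφ).2.2).div
      (hΦ.hasDerivWithinAt_invIntFactor hV hpde hφ) (hV0 φ hφ)).log
      (div_ne_zero (sub_ne_zero.2 (hne φ hφ)) (hV0 φ hφ))
    have h2 := sub_ne_zero.2 (hne φ hφ)
    have h3 := hV0 φ hφ
    convert! h1 using 1
    simp only [Pi.sub_apply, Pi.div_apply]
    field_simp
  have hbound : ∀ φ ∈ Icc a b,
      ‖(f φ (Ψ φ) - f φ (Φ φ)) / (Ψ φ - Φ φ) - dRho f φ (Φ φ)‖ ≤ η := by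
    intro φ hφ
    have hpos : ∀ ξ ∈ uIcc (Φ φ) (Ψ φ), 0 < ξ ∧ ξ < e := fun ξ hξ =>
      ⟨(lt_min (hΦ φ hφ).1 (hΨ φ hφ).1).trans_le hξ.1,
        hξ.2.trans_lt (max_lt (hΦ φ hφ).2.1 (hΨ φ hφ).2.1)⟩
    -- Subtracting the linear part of `f` at `Φ φ` makes the mean value inequality measure the
    -- deviation of the difference quotient from the derivative.
    have hd : ∀ ξ ∈ uIcc (Φ φ) (Ψ φ), HasDerivWithinAt
        (fun ξ => f φ ξ - dRho f φ (Φ φ) * ξ) (dRho f φ ξ - dRho f φ (Φ φ))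
        (uIcc (Φ φ) (Ψ φ)) ξ := by
      intro ξ hξ
      have h1 := (hasDerivAt_snd (φ := φ) hf (hpos ξ hξ).1 (hpos ξ hξ).2).fun_sub
        ((hasDerivAt_id ξ).const_mul (dRho f φ (Φ φ)))
      simpa using h1.hasDerivWithinAt
    have h4 := (convex_uIcc (Φ φ) (Ψ φ)).norm_image_sub_le_of_norm_hasDerivWithin_le hd
      (hη φ hφ) left_mem_uIcc right_mem_uIcc
    have h2 := sub_ne_zero.2 (hne φ hφ)
    have h5 : (f φ (Ψ φ) - f φ (Φ φ)) / (Ψ φ - Φ φ) - dRho f φ (Φ φ)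
        = (f φ (Ψ φ) - dRho f φ (Φ φ) * Ψ φ - (f φ (Φ φ) - dRho f φ (Φ φ) * Φ φ))
          / (Ψ φ - Φ φ) := by
      field_simp; ring
    rw [h5, norm_div, div_le_iff₀ (norm_pos_iff.2 h2)]
    exact h4
  have := (convex_Icc a b).norm_image_sub_le_of_norm_hasDerivWithin_le hder hbound
    (left_mem_Icc.2 hab) (right_mem_Icc.2 hab)
  rwa [Real.norm_eq_abs, Real.norm_eq_abs, abs_of_nonneg (sub_nonneg.2 hab)] at this

/-- The flow map from `a` to `b` is differentiable, with derivative given by the quotient of the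
values of an inverse integrating factor. -/
theorem hasDerivAt_flow
    (hf : ContDiffOn ℝ 1 (fun z : ℝ × ℝ => f z.1 z.2) (strip e))
    (hV : ContDiffOn ℝ 1 (fun z : ℝ × ℝ => V z.1 z.2) (strip e))
    (hpde : ∀ z ∈ strip e, deriv (fun φ => V φ z.2) z.1 + dRho V z.1 z.2 * f z.1 z.2
      = dRho f z.1 z.2 * V z.1 z.2)
    (hab : a ≤ b) {d : ℝ} {Φ : ℝ → ℝ → ℝ}
    (hΦ : ∀ x, 0 < x → x < d → IsSolOn f e a b (Φ x) ∧ Φ x a = x)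
    {x₀ : ℝ} (h0 : 0 < x₀) (hd : x₀ < d) (hV0 : V a x₀ ≠ 0) :
    HasDerivAt (fun x => Φ x b) |V b (Φ x₀ b) / V a x₀| x₀ := by
  have haI : a ∈ Icc a b := left_mem_Icc.2 hab
  have hbI : b ∈ Icc a b := right_mem_Icc.2 hab
  have hS := (hΦ x₀ h0 hd).1
  have hSa := (hΦ x₀ h0 hd).2
  have hVne : ∀ φ ∈ Icc a b, V φ (Φ x₀ φ) ≠ 0 := fun φ hφ =>
    hS.invIntFactor_ne_zero hf hV hpde haI hφ (by rwa [hSa])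
  -- The solutions starting at `x₀ / 2` and `(x₀ + d) / 2` enclose all those starting near `x₀` in a
  -- compact band.
  have hx1 : 0 < x₀ / 2 ∧ x₀ / 2 < d := ⟨by linarith, by linarith⟩
  have hx2 : 0 < (x₀ + d) / 2 ∧ (x₀ + d) / 2 < d := ⟨by linarith, by linarith⟩
  obtain ⟨C, hC0, k, K, hk, hK, hmem, hlip⟩ := exists_lipschitz_of_between hf
    (hΦ _ hx1.1 hx1.2).1 (hΦ _ hx2.1 hx2.2).1 haI
  rw [(hΦ _ hx1.1 hx1.2).2, (hΦ _ hx2.1 hx2.2).2] at hmem hlip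
  have hsub : Icc a b ×ˢ Icc k K ⊆ strip e := fun z hz =>
    ⟨hk.trans_le hz.2.1, hz.2.2.trans_lt hK⟩
  have huc := (isCompact_Icc.prod isCompact_Icc).uniformContinuousOn_of_continuous
    ((continuousOn_dRho hf).mono hsub)
  rw [Metric.uniformContinuousOn_iff] at huc
  have hmem₀ : x₀ ∈ Icc (x₀ / 2) ((x₀ + d) / 2) := ⟨by linarith, by linarith⟩
  have hlog : Tendsto (fun x => Real.log ((Φ x b - Φ x₀ b) / V b (Φ x₀ b))
      - Real.log ((x - x₀) / V a x₀)) (𝓝[≠] x₀) (𝓝 0) := by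
    rw [Metric.tendsto_nhds]
    intro η hη
    -- The summand `1` covers the case `a = b`.
    have hη' : 0 < η / (b - a + 1) := div_pos hη (by linarith)
    obtain ⟨δ, hδ, hδ'⟩ := huc _ hη'
    have h1 : ∀ᶠ x in 𝓝 x₀, x ∈ Ioo (x₀ / 2) ((x₀ + d) / 2) :=
      Ioo_mem_nhds (by linarith) (by linarith)
    have h2 : ∀ᶠ x in 𝓝 x₀, C * |x - x₀| < δ := by
      have : Tendsto (fun x => C * |x - x₀|) (𝓝 x₀) (𝓝 (C * |x₀ - x₀|)) :=
        Continuous.tendsto (by fun_prop) _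
      exact this.eventually_lt_const (by simpa using hδ)
    filter_upwards [h1.filter_mono nhdsWithin_le_nhds, h2.filter_mono nhdsWithin_le_nhds,
      self_mem_nhdsWithin] with x hx1' hx2' hx3
    have hxΦ := hΦ x (hx1.1.trans hx1'.1) (hx1'.2.trans hx2.2)
    have hxmem : x ∈ Icc (x₀ / 2) ((x₀ + d) / 2) := Ioo_subset_Icc_self hx1'
    have hk1 := hmem _ hS (by rwa [hSa])
    have hk2 := hmem _ hxΦ.1 (by rwa [hxΦ.2])
    have h5 := hS.abs_log_sub_le hf hV hpde hxΦ.1 (η := η / (b - a + 1)) ?_ hVne ?_ hab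
    · rw [hxΦ.2, hSa] at h5
      rw [Real.dist_eq, sub_zero]
      refine h5.trans_lt ?_
      rw [div_mul_eq_mul_div, div_lt_iff₀ (by linarith)]
      exact mul_lt_mul_of_pos_left (by linarith) hη
    · intro φ hφ heq
      have := hxΦ.1.eqOn hf hS hφ heq haI
      rw [hxΦ.2, hSa] at this
      exact hx3 this
    · intro φ hφ ξ hξ
      have hξK : ξ ∈ Icc k K := (uIcc_subset_Icc (hk1 φ hφ) (hk2 φ hφ)) hξ
      have h6 := hδ' (φ, ξ) ⟨hφ, hξK⟩ (φ, Φ x₀ φ) ⟨hφ, hk1 φ hφ⟩ ?_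
      · rw [Real.dist_eq] at h6
        exact h6.le
      · rw [Prod.dist_eq, dist_self, max_eq_right dist_nonneg, Real.dist_eq]
        refine lt_of_le_of_lt ?_ hx2'
        have h7 := hlip _ _ hxΦ.1 hS (by rwa [hxΦ.2]) (by rwa [hSa]) φ hφ
        rw [hxΦ.2, hSa] at h7
        exact (abs_sub_left_of_mem_uIcc hξ).trans h7
  rw [hasDerivAt_iff_tendsto_slope]
  have hexp := (Real.continuous_exp.tendsto 0).comp hlog
  rw [Real.exp_zero] at hexp
  -- The real logarithm only sees absolute values, hence the modulus in the limit. The slope itself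
  -- is positive because solutions keep their order.
  have hfin := hexp.mul_const |V b (Φ x₀ b) / V a x₀|
  rw [one_mul] at hfin
  refine hfin.congr' ?_
  have h1 : ∀ᶠ x in 𝓝 x₀, x ∈ Ioo (x₀ / 2) ((x₀ + d) / 2) :=
    Ioo_mem_nhds (by linarith) (by linarith)
  filter_upwards [h1.filter_mono nhdsWithin_le_nhds, self_mem_nhdsWithin] with x hx1' hx3
  have hx3 : x ≠ x₀ := hx3
  have hxΦ := hΦ x (hx1.1.trans hx1'.1) (hx1'.2.trans hx2.2)
  have hslope : 0 < (Φ x b - Φ x₀ b) / (x - x₀) := by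
    rcases lt_or_gt_of_ne hx3 with h | h
    · have := hxΦ.1.lt_of_lt hf hS haI hbI (by rwa [hxΦ.2, hSa])
      exact div_pos_of_neg_of_neg (by linarith) (by linarith)
    · have := hS.lt_of_lt hf hxΦ.1 haI hbI (by rwa [hxΦ.2, hSa])
      exact div_pos (by linarith) (by linarith)
  have hne1 : x - x₀ ≠ 0 := sub_ne_zero.2 hx3
  have hne2 : Φ x b - Φ x₀ b ≠ 0 := fun h => by simp [h] at hslope
  have hne3 := hVne b hbI
  rw [slope_def_field, Function.comp_apply, ← Real.log_div (by positivity) (by positivity),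
    Real.exp_log_eq_abs (by positivity), ← abs_mul, ← abs_of_pos hslope]
  congr 1
  field_simp

end Monodromic

namespace Monodromic

/-! ### Inverse of a function with positive derivative on a compact interval -/

/-- This serves to exchange time and angle as parameters of an orbit. Derivatives are taken within
the closed intervals so that the end points of a turn are included. -/
theorem exists_inverse_of_deriv_pos {g g' : ℝ → ℝ} {a b : ℝ} (hab : a ≤ b)
    (hg : ∀ x ∈ Icc a b, HasDerivWithinAt g (g' x) (Icc a b) x) (hpos : ∀ x ∈ Icc a b, 0 < g' x) :
    ∃ τ : ℝ → ℝ, (∀ y ∈ Icc (g a) (g b), τ y ∈ Icc a b ∧ g (τ y) = y ∧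
      HasDerivWithinAt τ (g' (τ y))⁻¹ (Icc (g a) (g b)) y) ∧
      ∀ x ∈ Icc a b, g x ∈ Icc (g a) (g b) ∧ τ (g x) = x := by
  have hc : ContinuousOn g (Icc a b) := fun x hx => (hg x hx).continuousWithinAt
  have hm : StrictMonoOn g (Icc a b) := strictMonoOn_of_hasDerivWithinAt_pos (convex_Icc a b) hc
    (fun x hx => (hg x (interior_subset hx)).mono interior_subset)
    (fun x hx => hpos x (interior_subset hx))
  have hsurj : ∀ y, y ∈ Icc (g a) (g b) → ∃ x, x ∈ Icc a b ∧ g x = y :=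
    fun y hy => intermediate_value_Icc hab hc hy
  have hmaps : ∀ x ∈ Icc a b, g x ∈ Icc (g a) (g b) := fun x hx =>
    ⟨hm.monotoneOn (left_mem_Icc.2 hab) hx hx.1, hm.monotoneOn hx (right_mem_Icc.2 hab) hx.2⟩
  choose! τ hτ' using hsurj
  have hτ : ∀ {y}, y ∈ Icc (g a) (g b) → τ y ∈ Icc a b ∧ g (τ y) = y := fun h => hτ' _ h
  have hleft : ∀ x ∈ Icc a b, τ (g x) = x := fun x hx =>
    hm.injOn (hτ (hmaps x hx)).1 hx (hτ (hmaps x hx)).2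
  refine ⟨τ, fun y hy => ⟨(hτ hy).1, (hτ hy).2, ?_⟩, fun x hx => ⟨hmaps x hx, hleft x hx⟩⟩
  have hx := (hτ hy).1
  -- Continuity follows from order alone: a bound `l` or `u` inside `[a, b]` is transported by `g`,
  -- and a bound outside is never attained.
  have hcont : ContinuousWithinAt τ (Icc (g a) (g b)) y := by
    refine tendsto_order.2 ⟨fun l hl => ?_, fun u hu => ?_⟩
    · rcases lt_or_ge l a with hla | hla
      · filter_upwards [self_mem_nhdsWithin] with y' hy' using hla.trans_le (hτ hy').1.1
      · have hlm : l ∈ Icc a b := ⟨hla, hl.le.trans hx.2⟩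
        have h1 : g l < y := by have := hm hlm hx hl; rwa [(hτ hy).2] at this
        filter_upwards [self_mem_nhdsWithin, nhdsWithin_le_nhds (lt_mem_nhds h1)] with y' hy' hy''
        by_contra! hcon
        have := hm.monotoneOn (hτ hy').1 hlm hcon
        rw [(hτ hy').2] at this
        exact absurd hy'' this.not_gt
    · rcases lt_or_ge b u with hub | hub
      · filter_upwards [self_mem_nhdsWithin] with y' hy' using (hτ hy').1.2.trans_lt hub
      · have hum : u ∈ Icc a b := ⟨hx.1.trans hu.le, hub⟩
        have h1 : y < g u := by have := hm hx hum hu; rwa [(hτ hy).2] at this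
        filter_upwards [self_mem_nhdsWithin, nhdsWithin_le_nhds (gt_mem_nhds h1)] with y' hy' hy''
        by_contra! hcon
        have := hm.monotoneOn hum (hτ hy').1 hcon
        rw [(hτ hy').2] at this
        exact absurd hy'' this.not_gt
  have hne : g' (τ y) ≠ 0 := (hpos _ hx).ne'
  have h1 : HasFDerivWithinAt g
      (ContinuousLinearEquiv.unitsEquivAut ℝ (Units.mk0 _ hne) : ℝ →L[ℝ] ℝ) (Icc a b) (τ y) :=
    hg _ hx
  have h2 := HasFDerivWithinAt.of_local_left_inverse (g := τ) (s := Icc (g a) (g b)) (a := y)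
    (tendsto_nhdsWithin_iff.2 ⟨hcont, by
      filter_upwards [self_mem_nhdsWithin] with y' hy' using (hτ hy').1⟩) h1 hy
    (by filter_upwards [self_mem_nhdsWithin] with y' hy' using (hτ hy').2)
  have h3 := h2.hasDerivWithinAt
  simpa using h3

/-! ### Weighted polar coordinates -/

/-- The weighted polar blow-up `(φ, ρ) ↦ (ρ ^ p * cos φ, ρ ^ q * sin φ)`. -/
noncomputable def blow (p q : ℕ) (z : ℝ × ℝ) : ℝ × ℝ :=
  (z.2 ^ p * Real.cos z.1, z.2 ^ q * Real.sin z.1)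

/-- The function whose level `1` defines the weighted radius of `z`. -/
noncomputable def gauge (p q : ℕ) (z : ℝ × ℝ) (ρ : ℝ) : ℝ := (z.1 / ρ ^ p) ^ 2 + (z.2 / ρ ^ q) ^ 2

theorem gauge_strictAnti {p q : ℕ} (hp : 0 < p) (hq : 0 < q) {z : ℝ × ℝ} (hz : z ≠ 0) {ρ σ : ℝ}
    (hρ : 0 < ρ) (h : ρ < σ) : gauge p q z σ < gauge p q z ρ := by
  have hσ : 0 < σ := hρ.trans h
  have hP : ρ ^ p < σ ^ p := pow_lt_pow_left₀ h hρ.le hp.ne'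
  have hQ : ρ ^ q < σ ^ q := pow_lt_pow_left₀ h hρ.le hq.ne'
  have aux : ∀ {x u v : ℝ}, 0 < u → u < v → (x / v) ^ 2 ≤ (x / u) ^ 2 ∧
      (x ≠ 0 → (x / v) ^ 2 < (x / u) ^ 2) := by
    intro x u v hu huv
    rw [div_pow, div_pow]
    have huv2 : u ^ 2 < v ^ 2 := pow_lt_pow_left₀ huv hu.le two_ne_zero
    have hu2 : 0 < u ^ 2 := by positivity
    exact ⟨div_le_div_of_nonneg_left (sq_nonneg x) hu2 huv2.le,
      fun hx => div_lt_div_of_pos_left (by positivity) hu2 huv2⟩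
  have h1 := aux (x := z.1) (pow_pos hρ p) hP
  have h2 := aux (x := z.2) (pow_pos hρ q) hQ
  unfold gauge
  rcases not_and_or.1 (fun h : z.1 = 0 ∧ z.2 = 0 => hz (Prod.ext h.1 h.2)) with hx | hy
  · linarith [h1.2 hx, h2.1]
  · linarith [h1.1, h2.2 hy]

theorem exists_gauge_eq_one {p q : ℕ} (hp : 0 < p) (hq : 0 < q) {z : ℝ × ℝ} (hz : z ≠ 0) :
    ∃ ρ, 0 < ρ ∧ gauge p q z ρ = 1 := by
  set M := ‖z‖ with hM
  have hM0 : 0 < M := norm_pos_iff.2 hz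
  have hx : |z.1| ≤ M := norm_fst_le z
  have hy : |z.2| ≤ M := norm_snd_le z
  -- `lo ^ n ≤ M`, so the coordinate that realizes the sup norm already contributes at least `1`;
  -- `hi ^ n ≥ 2 * M`, so each coordinate contributes at most `1 / 4`.
  set lo := min 1 M
  set hi := max 1 (2 * M)
  have hlo : 0 < lo := lt_min one_pos hM0
  have hhi : 1 ≤ hi := le_max_left _ _
  have hhi0 : 0 < hi := one_pos.trans_le hhi
  have hlohi : lo ≤ hi := (min_le_left _ _).trans hhi
  have hc : ContinuousOn (gauge p q z) (Icc lo hi) := by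
    unfold gauge
    have hne : ∀ x ∈ Icc lo hi, x ≠ 0 := fun x hx => (hlo.trans_le hx.1).ne'
    refine ContinuousOn.add ?_ ?_
    · exact (continuousOn_const.div (by fun_prop) fun x hx => pow_ne_zero _ (hne x hx)).pow 2
    · exact (continuousOn_const.div (by fun_prop) fun x hx => pow_ne_zero _ (hne x hx)).pow 2
  have h1 : 1 ≤ gauge p q z lo := by
    have hlP : ∀ {n : ℕ}, 0 < n → lo ^ n ≤ M := fun hn =>
      (pow_le_of_le_one hlo.le (min_le_left _ _) hn.ne').trans (min_le_right _ _)
    have aux : ∀ {x : ℝ} {n : ℕ}, 0 < n → |x| = M → 1 ≤ (x / lo ^ n) ^ 2 := by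
      intro x n hn hx
      rw [← sq_abs, abs_div, hx, abs_of_pos (pow_pos hlo n)]
      exact one_le_pow₀ ((one_le_div (pow_pos hlo n)).2 (hlP hn))
    rcases max_choice ‖z.1‖ ‖z.2‖ with h | h
    · have := aux (x := z.1) hp (by rw [hM, Prod.norm_def, h, Real.norm_eq_abs])
      unfold gauge; nlinarith [sq_nonneg (z.2 / lo ^ q)]
    · have := aux (x := z.2) hq (by rw [hM, Prod.norm_def, h, Real.norm_eq_abs])
      unfold gauge; nlinarith [sq_nonneg (z.1 / lo ^ p)]
  have h2 : gauge p q z hi ≤ 1 := by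
    have aux : ∀ {x : ℝ} {n : ℕ}, 0 < n → |x| ≤ M → (x / hi ^ n) ^ 2 ≤ (1 / 2) ^ 2 := by
      intro x n hn hx
      rw [← sq_abs]
      have hn' : hi ≤ hi ^ n := le_self_pow₀ hhi hn.ne'
      refine pow_le_pow_left₀ (abs_nonneg _) ?_ 2
      rw [abs_div, abs_of_pos (pow_pos hhi0 n), div_le_iff₀ (pow_pos hhi0 n)]
      have : 2 * M ≤ hi := le_max_right _ _
      linarith
    have := aux hp hx
    have := aux hq hy
    unfold gauge; linarith
  obtain ⟨ρ, hρ, h⟩ := intermediate_value_Icc' hlohi hc ⟨h2, h1⟩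
  exact ⟨ρ, hlo.trans_le hρ.1, h⟩

/-- The weighted radius of a point of the plane. -/
noncomputable def radius (p q : ℕ) (z : ℝ × ℝ) : ℝ :=
  Classical.epsilon fun ρ => 0 < ρ ∧ gauge p q z ρ = 1

theorem radius_spec {p q : ℕ} (hp : 0 < p) (hq : 0 < q) {z : ℝ × ℝ} (hz : z ≠ 0) :
    0 < radius p q z ∧ gauge p q z (radius p q z) = 1 :=
  Classical.epsilon_spec (exists_gauge_eq_one hp hq hz)

/-- The gauge is strictly decreasing in `ρ`, so comparing with the radius is an open condition on
`z` for fixed `ρ`. Continuity of the radius follows from this and its mirror image. -/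
theorem lt_radius_iff {p q : ℕ} (hp : 0 < p) (hq : 0 < q) {z : ℝ × ℝ} (hz : z ≠ 0) {ρ : ℝ}
    (hρ : 0 < ρ) : ρ < radius p q z ↔ 1 < gauge p q z ρ := by
  obtain ⟨h0, h1⟩ := radius_spec hp hq hz
  constructor
  · intro h
    have := gauge_strictAnti hp hq hz hρ h
    rwa [h1] at this
  · intro h
    by_contra! hcon
    rcases hcon.eq_or_lt with heq | hlt
    · rw [heq] at h1; linarith
    · have := gauge_strictAnti hp hq hz h0 hlt
      linarith

theorem radius_lt_iff {p q : ℕ} (hp : 0 < p) (hq : 0 < q) {z : ℝ × ℝ} (hz : z ≠ 0) {ρ : ℝ}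
    (hρ : 0 < ρ) : radius p q z < ρ ↔ gauge p q z ρ < 1 := by
  obtain ⟨h0, h1⟩ := radius_spec hp hq hz
  constructor
  · intro h
    have := gauge_strictAnti hp hq hz h0 h
    rwa [h1] at this
  · intro h
    by_contra! hcon
    rcases hcon.eq_or_lt with heq | hlt
    · rw [← heq] at h1; linarith
    · have := gauge_strictAnti hp hq hz hρ hlt
      linarith

theorem continuous_gauge (p q : ℕ) (ρ : ℝ) : Continuous fun z => gauge p q z ρ := by
  unfold gauge; fun_prop

theorem continuousAt_radius {p q : ℕ} (hp : 0 < p) (hq : 0 < q) {z : ℝ × ℝ} (hz : z ≠ 0) :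
    ContinuousAt (radius p q) z := by
  obtain ⟨h0, h1⟩ := radius_spec hp hq hz
  have hne : ∀ᶠ w in 𝓝 z, w ≠ 0 := eventually_ne_nhds hz
  refine tendsto_order.2 ⟨fun l hl => ?_, fun u hu => ?_⟩
  · rcases le_or_gt l 0 with hl0 | hl0
    · filter_upwards [hne] with w hw using hl0.trans_lt (radius_spec hp hq hw).1
    · have := (lt_radius_iff hp hq hz hl0).1 hl
      filter_upwards [hne, (continuous_gauge p q l).continuousAt.eventually_const_lt this]
        with w hw hw' using (lt_radius_iff hp hq hw hl0).2 hw'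
  · have hu0 := h0.trans hu
    have := (radius_lt_iff hp hq hz hu0).1 hu
    filter_upwards [hne, (continuous_gauge p q u).continuousAt.eventually_lt_const this]
      with w hw hw' using (radius_lt_iff hp hq hw hu0).2 hw'

theorem gauge_blow {p q : ℕ} {φ ρ : ℝ} (hρ : 0 < ρ) : gauge p q (blow p q (φ, ρ)) ρ = 1 := by
  unfold gauge blow
  simp only
  rw [mul_div_cancel_left₀ _ (pow_pos hρ p).ne', mul_div_cancel_left₀ _ (pow_pos hρ q).ne']
  exact Real.cos_sq_add_sin_sq φ

theorem blow_ne_zero {p q : ℕ} {φ ρ : ℝ} (hρ : 0 < ρ) : blow p q (φ, ρ) ≠ 0 := by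
  intro h
  have := gauge_blow (p := p) (q := q) (φ := φ) hρ
  rw [h] at this
  simp [gauge] at this

theorem radius_blow {p q : ℕ} (hp : 0 < p) (hq : 0 < q) {φ ρ : ℝ} (hρ : 0 < ρ) :
    radius p q (blow p q (φ, ρ)) = ρ := by
  have hz := blow_ne_zero (p := p) (q := q) (φ := φ) hρ
  have hg := gauge_blow (p := p) (q := q) (φ := φ) hρ
  refine le_antisymm ?_ ?_
  · by_contra! h
    exact absurd ((lt_radius_iff hp hq hz hρ).1 h) (by rw [hg]; exact lt_irrefl _)
  · by_contra! h
    exact absurd ((radius_lt_iff hp hq hz hρ).1 h) (by rw [hg]; exact lt_irrefl _)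

/-- Points close to the origin have small weighted radius. -/
theorem exists_radius_lt {p q : ℕ} (hp : 0 < p) (hq : 0 < q) {e : ℝ} (he : 0 < e) :
    ∃ δ > 0, ∀ z : ℝ × ℝ, z ≠ 0 → ‖z‖ < δ → radius p q z < e := by
  have h : ∀ᶠ z in 𝓝 (0 : ℝ × ℝ), gauge p q z e < 1 :=
    (continuous_gauge p q e).continuousAt.eventually_lt_const (by simp [gauge])
  obtain ⟨δ, hδ, h⟩ := Metric.eventually_nhds_iff.1 h
  exact ⟨δ, hδ, fun z hz hzδ => (radius_lt_iff hp hq hz he).2 (h (by simpa using hzδ))⟩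

theorem norm_blow_le {p q : ℕ} (hp : 0 < p) (hq : 0 < q) {φ ρ : ℝ} (h0 : |ρ| ≤ 1) :
    ‖blow p q (φ, ρ)‖ ≤ |ρ| := by
  have aux : ∀ {n : ℕ} {x : ℝ}, 0 < n → |x| ≤ 1 → |ρ ^ n * x| ≤ |ρ| := by
    intro n x hn hx
    rw [abs_mul, abs_pow]
    calc |ρ| ^ n * |x| ≤ |ρ| * 1 := by
          gcongr
          exact pow_le_of_le_one (abs_nonneg _) h0 hn.ne'
      _ = |ρ| := mul_one _
  exact max_le (aux hp (Real.abs_cos_le_one φ)) (aux hq (Real.abs_sin_le_one φ))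

/-! ### Passing between ordinary and weighted angles -/

/-- The angle of `(α * cos θ, β * sin θ)`, as a continuous function of `θ` that agrees with `θ` on
the axes. -/
noncomputable def twist (α β θ : ℝ) : ℝ :=
  θ + Real.arctan ((β - α) * Real.sin θ * Real.cos θ
    / (α * Real.cos θ ^ 2 + β * Real.sin θ ^ 2))

theorem twist_den_pos {α β : ℝ} (hα : 0 < α) (hβ : 0 < β) (θ : ℝ) :
    0 < α * Real.cos θ ^ 2 + β * Real.sin θ ^ 2 := by
  have h := Real.cos_sq_add_sin_sq θ
  have hm : 0 < min α β := lt_min hα hβ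
  nlinarith [min_le_left α β, min_le_right α β, sq_nonneg (Real.cos θ), sq_nonneg (Real.sin θ)]

/-- The vectors `(α cos θ, β sin θ)` and `(cos θ, sin θ)` have positive inner product, so the angle
between them is an arctangent and no choice of branch is needed. -/
theorem exists_eq_twist {α β : ℝ} (hα : 0 < α) (hβ : 0 < β) (θ : ℝ) :
    ∃ n > 0, α * Real.cos θ = n * Real.cos (twist α β θ) ∧
      β * Real.sin θ = n * Real.sin (twist α β θ) := by
  have hd := twist_den_pos hα hβ θ
  set d := α * Real.cos θ ^ 2 + β * Real.sin θ ^ 2 with hd_def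
  set c := (β - α) * Real.sin θ * Real.cos θ with hc
  set κ := Real.cos (Real.arctan (c / d)) with hκ
  have hκ0 : 0 < κ := Real.cos_arctan_pos _
  have hs : Real.sin (Real.arctan (c / d)) = c / d * κ := by
    rw [← Real.tan_mul_cos hκ0.ne', Real.tan_arctan]
  have h1 : Real.cos (twist α β θ) = Real.cos θ * κ - Real.sin θ * (c / d * κ) := by
    rw [← hs, hκ, ← Real.cos_add]; rfl
  have h2 : Real.sin (twist α β θ) = Real.sin θ * κ + Real.cos θ * (c / d * κ) := by
    rw [← hs, hκ, ← Real.sin_add]; rfl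
  have hcs := Real.cos_sq_add_sin_sq θ
  -- `d` and `c` are the components of the vector along and across `(cos θ, sin θ)`; its length is
  -- therefore `d` divided by the cosine of `arctan (c / d)`.
  refine ⟨d / κ, div_pos hd hκ0, ?_, ?_⟩
  · rw [h1]
    have : d / κ * (Real.cos θ * κ - Real.sin θ * (c / d * κ))
        = d * Real.cos θ - c * Real.sin θ := by field_simp
    rw [this, hc, hd_def]
    linear_combination (-α * Real.cos θ) * hcs
  · rw [h2]
    have : d / κ * (Real.sin θ * κ + Real.cos θ * (c / d * κ))
        = d * Real.sin θ + c * Real.cos θ := by field_simp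
    rw [this, hc, hd_def]
    linear_combination (-β * Real.sin θ) * hcs

theorem twist_of_sin_eq_zero {α β θ : ℝ} (h : Real.sin θ = 0) : twist α β θ = θ := by
  simp [twist, h]

theorem twist_add_two_pi (α β θ : ℝ) :
    twist α β (θ + 2 * Real.pi) = twist α β θ + 2 * Real.pi := by
  simp only [twist, Real.sin_add_two_pi, Real.cos_add_two_pi]; ring

theorem ContinuousOn.twist {X : Type*} [TopologicalSpace X] {s : Set X} {α β θ : X → ℝ}
    (hα : ContinuousOn α s) (hβ : ContinuousOn β s) (hθ : ContinuousOn θ s)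
    (hα0 : ∀ x ∈ s, 0 < α x) (hβ0 : ∀ x ∈ s, 0 < β x) :
    ContinuousOn (fun x => twist (α x) (β x) (θ x)) s := by
  have hsin : ContinuousOn (fun x => Real.sin (θ x)) s := Real.continuous_sin.comp_continuousOn hθ
  have hcos : ContinuousOn (fun x => Real.cos (θ x)) s := Real.continuous_cos.comp_continuousOn hθ
  exact hθ.add (Real.continuous_arctan.comp_continuousOn
    ((((hβ.sub hα).mul hsin).mul hcos).div ((hα.mul (hcos.pow 2)).add (hβ.mul (hsin.pow 2)))
      fun x hx => (twist_den_pos (hα0 x hx) (hβ0 x hx) _).ne'))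

/-- The weighted angle corresponding to an angle. -/
theorem blow_twist {p q : ℕ} (hp : 0 < p) (hq : 0 < q) {s θ : ℝ} (hs : 0 < s) {z : ℝ × ℝ}
    (hz : z = (s * Real.cos θ, s * Real.sin θ)) :
    z ≠ 0 ∧ blow p q (twist (radius p q z ^ q) (radius p q z ^ p) θ, radius p q z) = z := by
  have hz0 : z ≠ 0 := by
    intro h
    rw [h, eq_comm, Prod.mk_eq_zero] at hz
    have h1 : Real.cos θ = 0 := by simpa [hs.ne'] using hz.1
    have h2 : Real.sin θ = 0 := by simpa [hs.ne'] using hz.2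
    have := Real.cos_sq_add_sin_sq θ
    simp [h1, h2] at this
  refine ⟨hz0, ?_⟩
  obtain ⟨h0, h1⟩ := radius_spec hp hq hz0
  set ρ := radius p q z
  -- The exponents are interchanged because `(cos θ / ρ ^ p, sin θ / ρ ^ q)` is proportional to `(ρ
  -- ^ q cos θ, ρ ^ p sin θ)`.
  obtain ⟨n, hn, hc, hs'⟩ := exists_eq_twist (pow_pos h0 q) (pow_pos h0 p) θ
  set φ := twist (ρ ^ q) (ρ ^ p) θ
  have hρp := pow_pos h0 p
  have hρq := pow_pos h0 q
  have hx : z.1 / ρ ^ p = s * n / (ρ ^ p * ρ ^ q) * Real.cos φ := by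
    rw [hz]
    field_simp
    linear_combination hc
  have hy : z.2 / ρ ^ q = s * n / (ρ ^ p * ρ ^ q) * Real.sin φ := by
    rw [hz]
    field_simp
    linear_combination hs'
  -- The rescaled point lies on the unit circle by the definition of the radius.
  have hN : s * n / (ρ ^ p * ρ ^ q) = 1 := by
    unfold gauge at h1
    rw [hx, hy, mul_pow, mul_pow, ← mul_add, Real.cos_sq_add_sin_sq, mul_one] at h1
    have hpos : 0 < s * n / (ρ ^ p * ρ ^ q) := by positivity
    nlinarith
  rw [hN, one_mul] at hx hy
  ext
  · change ρ ^ p * Real.cos φ = z.1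
    rw [← hx]; field_simp
  · change ρ ^ q * Real.sin φ = z.2
    rw [← hy]; field_simp

end Monodromic

namespace Monodromic

/-! ### The polar equation on a strip -/

/-- `e` is so small that `P`, `Q` are analytic at the points of norm less than `e` and the angular
component of the polar vector field does not vanish for `0 < ρ < e`. -/
structure GoodStrip (p q r : ℕ) (P Q : ℝ → ℝ → ℝ) (e : ℝ) : Prop where
  p_pos : 0 < p
  q_pos : 0 < q
  e_pos : 0 < e
  e_le : e ≤ 1
  anP : ∀ z : ℝ × ℝ, ‖z‖ < e → AnalyticAt ℝ (fun z : ℝ × ℝ => P z.1 z.2) z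
  anQ : ∀ z : ℝ × ℝ, ‖z‖ < e → AnalyticAt ℝ (fun z : ℝ × ℝ => Q z.1 z.2) z
  theta_ne : ∀ φ ρ, 0 < ρ → ρ < e → Theta p q r P Q φ ρ ≠ 0

theorem GoodStrip.mono {p q r : ℕ} {P Q : ℝ → ℝ → ℝ} {e e' : ℝ} (h : GoodStrip p q r P Q e)
    (h0 : 0 < e') (he : e' ≤ e) : GoodStrip p q r P Q e' :=
  ⟨h.p_pos, h.q_pos, h0, he.trans h.e_le, fun z hz => h.anP z (hz.trans_le he),
    fun z hz => h.anQ z (hz.trans_le he), fun φ ρ h1 h2 => h.theta_ne φ ρ h1 (h2.trans_le he)⟩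

theorem blow_contDiff (p q : ℕ) {n : WithTop ℕ∞} : ContDiff ℝ n (blow p q) := by
  unfold blow; fun_prop

theorem contDiffAt_polar {p q : ℕ} (hp : 0 < p) (hq : 0 < q) {e : ℝ} (he : e ≤ 1)
    {f : ℝ → ℝ → ℝ} (hf : ∀ z : ℝ × ℝ, ‖z‖ < e → AnalyticAt ℝ (fun z : ℝ × ℝ => f z.1 z.2) z)
    {n : WithTop ℕ∞} {z : ℝ × ℝ} (hz : |z.2| < e) :
    ContDiffAt ℝ n (fun z : ℝ × ℝ => polar p q f z.1 z.2) z := by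
  have h1 : ‖blow p q z‖ < e := (norm_blow_le hp hq (hz.le.trans he)).trans_lt hz
  exact ((hf _ h1).contDiffAt).comp z (blow_contDiff p q).contDiffAt

theorem weight_pos {p q : ℕ} (hp : 0 < p) (hq : 0 < q) (φ : ℝ) :
    0 < p * Real.cos φ ^ 2 + q * Real.sin φ ^ 2 :=
  twist_den_pos (Nat.cast_pos.2 hp) (Nat.cast_pos.2 hq) φ

theorem jac_pos {p q : ℕ} (hp : 0 < p) (hq : 0 < q) {φ ρ : ℝ} (hρ : 0 < ρ) : 0 < jac p q φ ρ :=
  mul_pos (pow_pos hρ _) (weight_pos hp hq φ)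

variable {p q r : ℕ} {P Q : ℝ → ℝ → ℝ} {e : ℝ}

theorem contDiffOn_Theta (h : GoodStrip p q r P Q e) {n : WithTop ℕ∞} :
    ContDiffOn ℝ n (fun z : ℝ × ℝ => Theta p q r P Q z.1 z.2) (strip e) := by
  have heq : EqOn (fun z : ℝ × ℝ => Theta p q r P Q z.1 z.2) (fun z : ℝ × ℝ =>
      (p * z.2 ^ (p - 1) * Real.cos z.1 * polar p q Q z.1 z.2
      - q * z.2 ^ (q - 1) * Real.sin z.1 * polar p q P z.1 z.2) / (jac p q z.1 z.2 * z.2 ^ r))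
      (strip e) := fun z hz => by simp [Theta, hz.1.ne']
  refine ContDiffOn.congr (fun z hz => ContDiffAt.contDiffWithinAt ?_) heq
  have hz' : |z.2| < e := by rw [abs_of_pos hz.1]; exact hz.2
  have hP := contDiffAt_polar h.p_pos h.q_pos h.e_le h.anP (n := n) hz'
  have hQ := contDiffAt_polar h.p_pos h.q_pos h.e_le h.anQ (n := n) hz'
  refine ContDiffAt.div (by fun_prop) (by unfold jac; fun_prop) ?_
  exact mul_ne_zero (jac_pos h.p_pos h.q_pos hz.1).ne' (pow_pos hz.1 r).ne'

theorem contDiffOn_Rad (h : GoodStrip p q r P Q e) {n : WithTop ℕ∞} :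
    ContDiffOn ℝ n (fun z : ℝ × ℝ => Rad p q r P Q z.1 z.2) (strip e) := by
  intro z hz
  refine ContDiffAt.contDiffWithinAt ?_
  have hz' : |z.2| < e := by rw [abs_of_pos hz.1]; exact hz.2
  have hP := contDiffAt_polar h.p_pos h.q_pos h.e_le h.anP (n := n) hz'
  have hQ := contDiffAt_polar h.p_pos h.q_pos h.e_le h.anQ (n := n) hz'
  unfold Rad
  refine ContDiffAt.div (by fun_prop) (by unfold jac; fun_prop) ?_
  exact mul_ne_zero (jac_pos h.p_pos h.q_pos hz.1).ne' (pow_pos hz.1 r).ne'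

theorem contDiffOn_F (h : GoodStrip p q r P Q e) {n : WithTop ℕ∞} :
    ContDiffOn ℝ n (fun z : ℝ × ℝ => F p q r P Q z.1 z.2) (strip e) :=
  (contDiffOn_Rad h).div (contDiffOn_Theta h) fun z hz => h.theta_ne z.1 z.2 hz.1 hz.2

theorem polar_add_two_pi (f : ℝ → ℝ → ℝ) (φ ρ : ℝ) :
    polar p q f (φ + 2 * Real.pi) ρ = polar p q f φ ρ := by
  simp [polar]

theorem Theta_add_two_pi (φ ρ : ℝ) :
    Theta p q r P Q (φ + 2 * Real.pi) ρ = Theta p q r P Q φ ρ := by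
  simp [Theta, jac, polar_add_two_pi]

theorem F_add_two_pi (φ ρ : ℝ) : F p q r P Q (φ + 2 * Real.pi) ρ = F p q r P Q φ ρ := by
  simp [F, Rad, jac, Theta_add_two_pi, polar_add_two_pi]

theorem F_add_int_mul_two_pi (k : ℤ) (φ ρ : ℝ) :
    F p q r P Q (φ + k * (2 * Real.pi)) ρ = F p q r P Q φ ρ :=
  Function.Periodic.int_mul (f := fun φ => F p q r P Q φ ρ) (fun φ => F_add_two_pi φ ρ) k φ

/-! ### Orbits as graphs over the weighted angle -/

/-- A curve that is given in weighted polar coordinates and solves `x' = P, y' = Q` solves the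
polar equations. -/
theorem hasDerivWithinAt_polar (hp : 0 < p) (hq : 0 < q) {I : Set ℝ} {t : ℝ} (ht : t ∈ I)
    {φ ρ : ℝ → ℝ} {γ : ℝ → ℝ × ℝ} (hφ : ContinuousWithinAt φ I t) (hρ : ContinuousWithinAt ρ I t)
    (hρ0 : 0 < ρ t) (hγ : ∀ s ∈ I, blow p q (φ s, ρ s) = γ s)
    (hode : HasDerivWithinAt γ (P (γ t).1 (γ t).2, Q (γ t).1 (γ t).2) I t) :
    HasDerivWithinAt φ (ρ t ^ r * Theta p q r P Q (φ t) (ρ t)) I t ∧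
    HasDerivWithinAt ρ (ρ t ^ r * Rad p q r P Q (φ t) (ρ t)) I t := by
  set c := φ t
  set s := ρ t with hs
  let fst := ContinuousLinearMap.fst ℝ ℝ ℝ
  let snd := ContinuousLinearMap.snd ℝ ℝ ℝ
  -- `A` is the derivative of the blow-up and `B` its inverse. Continuity of `(φ, ρ)` together with
  -- this left inverse yields differentiability of the lifted curve, without a local inverse of the
  -- blow-up.
  let A : ℝ × ℝ →L[ℝ] ℝ × ℝ :=
    ((-(s ^ p * Real.sin c)) • fst + (p * s ^ (p - 1) * Real.cos c) • snd).prod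
      ((s ^ q * Real.cos c) • fst + (q * s ^ (q - 1) * Real.sin c) • snd)
  let B : ℝ × ℝ →L[ℝ] ℝ × ℝ :=
    ((p * s ^ (p - 1) * Real.cos c / jac p q c s) • snd
        - (q * s ^ (q - 1) * Real.sin c / jac p q c s) • fst).prod
      ((s ^ q * Real.cos c / jac p q c s) • fst + (s ^ p * Real.sin c / jac p q c s) • snd)
  have hA : HasFDerivAt (blow p q) A (c, s) := by
    have h1 : HasFDerivAt (fun z : ℝ × ℝ => z.1) fst (c, s) := hasFDerivAt_fst
    have h2 : HasFDerivAt (fun z : ℝ × ℝ => z.2) snd (c, s) := hasFDerivAt_snd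
    have := ((h2.pow p).mul h1.cos).prodMk ((h2.pow q).mul h1.sin)
    convert! this using 1
    ext <;> simp [A, fst, snd] <;> ring
  have hjac := (jac_pos hp hq (φ := c) hρ0).ne'
  obtain ⟨p', rfl⟩ := Nat.exists_eq_succ_of_ne_zero hp.ne'
  obtain ⟨q', rfl⟩ := Nat.exists_eq_succ_of_ne_zero hq.ne'
  have hjac' : jac (p' + 1) (q' + 1) c s = s ^ (p' + q' + 1)
      * ((p' + 1) * Real.cos c ^ 2 + (q' + 1) * Real.sin c ^ 2) := by
    unfold jac
    rw [show p' + 1 + (q' + 1) - 1 = p' + q' + 1 by omega]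
    push_cast; ring
  have hBA : Function.LeftInverse B A := by
    rintro ⟨u, v⟩
    simp only [A, B, fst, snd, Nat.succ_eq_add_one, Nat.add_one_sub_one]
    ext
    · simp
      field_simp
      rw [hjac']
      ring
    · simp
      field_simp
      rw [hjac']
      ring
  have hcont : Tendsto (fun x => (φ x, ρ x)) (𝓝[I] t) (𝓝[univ] (φ t, ρ t)) := by
    rw [nhdsWithin_univ]
    exact hφ.prodMk_nhds hρ
  have hmain := HasFDerivWithinAt.of_comp_of_leftInverse (g := fun x => (φ x, ρ x)) hcont
    hA.hasFDerivWithinAt hode.hasFDerivWithinAt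
    (by filter_upwards [self_mem_nhdsWithin] with x hx using hγ x hx) hBA ht
  have hd := hmain.hasDerivWithinAt
  have hpol : (polar (p' + 1) (q' + 1) P c s, polar (p' + 1) (q' + 1) Q c s)
      = (P (γ t).1 (γ t).2, Q (γ t).1 (γ t).2) := by
    rw [← hγ t ht]; rfl
  simp only [ContinuousLinearMap.comp_apply, ContinuousLinearMap.toSpanSingleton_apply,
    one_smul] at hd
  rw [← hpol] at hd
  have hsr := (pow_pos hρ0 r).ne'
  have hΘ : s ^ r * Theta (p' + 1) (q' + 1) r P Q c s
      = (B (polar (p' + 1) (q' + 1) P c s, polar (p' + 1) (q' + 1) Q c s)).1 := by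
    rw [Theta, if_neg hρ0.ne']
    simp [B, fst, snd]
    field_simp
  have hR : s ^ r * Rad (p' + 1) (q' + 1) r P Q c s
      = (B (polar (p' + 1) (q' + 1) P c s, polar (p' + 1) (q' + 1) Q c s)).2 := by
    rw [Rad]
    simp [B, fst, snd]
    field_simp
  rw [hΘ, hR]
  exact ⟨hd.fst, hd.snd⟩

/-- A curve with increasing first coordinate is a graph. -/
theorem exists_graph_of_deriv_pos {x y x' y' : ℝ → ℝ} {a b : ℝ} (hab : a ≤ b)
    (hx : ∀ t ∈ Icc a b, HasDerivWithinAt x (x' t) (Icc a b) t)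
    (hy : ∀ t ∈ Icc a b, HasDerivWithinAt y (y' t) (Icc a b) t) (hpos : ∀ t ∈ Icc a b, 0 < x' t) :
    ∃ Φ : ℝ → ℝ, (∀ s ∈ Icc (x a) (x b), ∃ t ∈ Icc a b, x t = s ∧ Φ s = y t ∧
      HasDerivWithinAt Φ (y' t / x' t) (Icc (x a) (x b)) s) ∧
      ∀ t ∈ Icc a b, x t ∈ Icc (x a) (x b) ∧ Φ (x t) = y t := by
  obtain ⟨τ, h1, h2⟩ := exists_inverse_of_deriv_pos hab hx hpos
  refine ⟨y ∘ τ, fun s hs => ⟨τ s, (h1 s hs).1, (h1 s hs).2.1, rfl, ?_⟩, fun t ht =>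
    ⟨(h2 t ht).1, by rw [Function.comp_apply, (h2 t ht).2]⟩⟩
  have := (hy _ (h1 s hs).1).comp s (h1 s hs).2.2 fun s' hs' => (h1 s' hs').1
  simpa [div_eq_mul_inv] using this

theorem exists_graph_of_deriv_neg {x y x' y' : ℝ → ℝ} {a b : ℝ} (hab : a ≤ b)
    (hx : ∀ t ∈ Icc a b, HasDerivWithinAt x (x' t) (Icc a b) t)
    (hy : ∀ t ∈ Icc a b, HasDerivWithinAt y (y' t) (Icc a b) t) (hneg : ∀ t ∈ Icc a b, x' t < 0) :
    ∃ Φ : ℝ → ℝ, (∀ s ∈ Icc (x b) (x a), ∃ t ∈ Icc a b, x t = s ∧ Φ s = y t ∧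
      HasDerivWithinAt Φ (y' t / x' t) (Icc (x b) (x a)) s) ∧
      ∀ t ∈ Icc a b, x t ∈ Icc (x b) (x a) ∧ Φ (x t) = y t := by
  obtain ⟨Φ, h1, h2⟩ := exists_graph_of_deriv_pos (x := fun t => -x t) hab
    (fun t ht => (hx t ht).neg) hy fun t ht => neg_pos.2 (hneg t ht)
  refine ⟨fun s => Φ (-s), fun s hs => ?_, fun t ht => ?_⟩
  · obtain ⟨t, ht, h3, h4, h5⟩ := h1 (-s) ⟨neg_le_neg hs.2, neg_le_neg hs.1⟩
    refine ⟨t, ht, neg_injective h3, h4, ?_⟩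
    have := h5.comp s (hasDerivAt_neg s).hasDerivWithinAt
      (s := Icc (x b) (x a)) fun s' hs' => ⟨neg_le_neg hs'.2, neg_le_neg hs'.1⟩
    convert! this using 1
    rw [div_neg]; ring
  · have := h2 t ht
    exact ⟨⟨neg_le_neg_iff.1 this.1.2, neg_le_neg_iff.1 this.1.1⟩, this.2⟩

theorem pos_or_neg_of_ne_zero {g : ℝ → ℝ} {s : Set ℝ} (hs : IsPreconnected s)
    (hg : ContinuousOn g s) (h0 : ∀ t ∈ s, g t ≠ 0) : (∀ t ∈ s, 0 < g t) ∨ ∀ t ∈ s, g t < 0 := by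
  by_contra! hcon
  obtain ⟨⟨x, hx, hx'⟩, y, hy, hy'⟩ := hcon
  obtain ⟨t, ht, h⟩ := hs.intermediate_value hx hy hg ⟨hx', hy'⟩
  exact h0 t ht h

/-- A turn, in weighted polar coordinates, is the graph of a solution of `dρ/dφ = F`. -/
theorem IsTurn.exists_isSolOn (h : GoodStrip p q r P Q e) {ε T : ℝ} {γ : ℝ → ℝ × ℝ} {θ : ℝ → ℝ}
    (hT : IsTurn P Q ε T γ θ) (hsmall : ∀ t ∈ Icc 0 T, γ t ≠ 0 → radius p q (γ t) < e) :
    ∃ φ : ℝ → ℝ, ∃ Φ : ℝ → ℝ, ∃ a b : ℝ,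
      (∀ t ∈ Icc 0 T, γ t ≠ 0 ∧ blow p q (φ t, radius p q (γ t)) = γ t) ∧
      (∀ t, Real.sin (θ t) = 0 → φ t = θ t) ∧
      IsSolOn (F p q r P Q) e a b Φ ∧
      (∀ t ∈ Icc 0 T, φ t ∈ Icc a b ∧ Φ (φ t) = radius p q (γ t)) ∧
      ((0 < Theta p q r P Q (φ 0) (radius p q (γ 0)) ∧ a = φ 0 ∧ b = φ T) ∨
        (Theta p q r P Q (φ 0) (radius p q (γ 0)) < 0 ∧ a = φ T ∧ b = φ 0)) := by
  have hT0 : (0 : ℝ) ∈ Icc 0 T := left_mem_Icc.2 hT.pos.le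
  have hpq : ∀ t ∈ Icc 0 T, γ t ≠ 0 ∧ blow p q (twist (radius p q (γ t) ^ q)
      (radius p q (γ t) ^ p) (θ t), radius p q (γ t)) = γ t := by
    intro t ht
    obtain ⟨s, hs, hγ⟩ := hT.angle t ht
    exact blow_twist h.p_pos h.q_pos hs hγ
  set ρ := fun t => radius p q (γ t) with hρdef
  set φ := fun t => twist (ρ t ^ q) (ρ t ^ p) (θ t) with hφdef
  have hρ0 : ∀ t ∈ Icc 0 T, 0 < ρ t := fun t ht => (radius_spec h.p_pos h.q_pos (hpq t ht).1).1
  have hρe : ∀ t ∈ Icc 0 T, ρ t < e := fun t ht => hsmall t ht (hpq t ht).1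
  have hρc : ContinuousOn ρ (Icc 0 T) := fun t ht =>
    (continuousAt_radius h.p_pos h.q_pos (hpq t ht).1).comp_continuousWithinAt
      (hT.ode t ht).continuousWithinAt
  have hφc : ContinuousOn φ (Icc 0 T) := ContinuousOn.twist (hρc.pow q) (hρc.pow p) hT.cont
    (fun t ht => pow_pos (hρ0 t ht) q) fun t ht => pow_pos (hρ0 t ht) p
  have hd := fun t (ht : t ∈ Icc 0 T) => hasDerivWithinAt_polar (r := r) h.p_pos h.q_pos ht
    (hφc t ht) (hρc t ht) (hρ0 t ht) (fun s hs => (hpq s hs).2) (hT.ode t ht)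
  have hΘc : ContinuousOn (fun t => ρ t ^ r * Theta p q r P Q (φ t) (ρ t)) (Icc 0 T) :=
    (hρc.pow r).mul ((contDiffOn_Theta (n := 1) h).continuousOn.comp (hφc.prodMk hρc)
      fun t ht => ⟨hρ0 t ht, hρe t ht⟩)
  have hF : ∀ t ∈ Icc 0 T, ρ t ^ r * Rad p q r P Q (φ t) (ρ t)
      / (ρ t ^ r * Theta p q r P Q (φ t) (ρ t)) = F p q r P Q (φ t) (ρ t) := fun t ht =>
    mul_div_mul_left _ _ (pow_pos (hρ0 t ht) r).ne'
  have hsol : ∀ {a b : ℝ} {Φ : ℝ → ℝ}, (∀ s ∈ Icc a b, ∃ t ∈ Icc 0 T, φ t = s ∧ Φ s = ρ t ∧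
      HasDerivWithinAt Φ (ρ t ^ r * Rad p q r P Q (φ t) (ρ t)
      / (ρ t ^ r * Theta p q r P Q (φ t) (ρ t))) (Icc a b) s) →
      IsSolOn (F p q r P Q) e a b Φ := by
    intro a b Φ hΦ s hs
    obtain ⟨t, ht, h1, h2, h3⟩ := hΦ s hs
    rw [hF t ht, h1] at h3
    rw [h2]
    exact ⟨hρ0 t ht, hρe t ht, h3⟩
  have hsin : ∀ t, Real.sin (θ t) = 0 → φ t = θ t := fun t ht => twist_of_sin_eq_zero ht
  -- The angular speed keeps its sign, so the angle is monotone in time; in the negative case the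
  -- end points of the graph are interchanged.
  have hcases := pos_or_neg_of_ne_zero isPreconnected_Icc hΘc
    fun t ht => mul_ne_zero (pow_pos (hρ0 t ht) r).ne' (h.theta_ne _ _ (hρ0 t ht) (hρe t ht))
  rcases hcases with hpos | hneg
  · obtain ⟨Φ, h1, h2⟩ := exists_graph_of_deriv_pos hT.pos.le (fun t ht => (hd t ht).1)
      (fun t ht => (hd t ht).2) hpos
    exact ⟨φ, Φ, _, _, hpq, hsin, hsol h1, h2, Or.inl
      ⟨pos_of_mul_pos_right (hpos 0 hT0) (pow_pos (hρ0 0 hT0) r).le, rfl, rfl⟩⟩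
  · obtain ⟨Φ, h1, h2⟩ := exists_graph_of_deriv_neg hT.pos.le (fun t ht => (hd t ht).1)
      (fun t ht => (hd t ht).2) hneg
    exact ⟨φ, Φ, _, _, hpq, hsin, hsol h1, h2, Or.inr
      ⟨by
        by_contra! hc
        exact absurd (hneg 0 hT0) (mul_nonneg (pow_pos (hρ0 0 hT0) r).le hc).not_gt, rfl, rfl⟩⟩

end Monodromic

namespace Monodromic

variable {p q r : ℕ} {P Q : ℝ → ℝ → ℝ} {e : ℝ}

/-! ### Existence of the Poincaré map -/

/-- A turn that starts on the positive half-axis gives a solution over a whole period. -/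
theorem exists_isSolOn_of_axis (h : GoodStrip p q r P Q e) (hm : IsMonodromic P Q) :
    ∃ δ > 0, ∀ ρ₀, 0 < ρ₀ → ρ₀ < δ →
      (0 < Theta p q r P Q 0 ρ₀ →
        ∃ Φ, IsSolOn (F p q r P Q) e 0 (2 * Real.pi) Φ ∧ Φ 0 = ρ₀) ∧
      (Theta p q r P Q 0 ρ₀ < 0 →
        ∃ Φ, IsSolOn (F p q r P Q) e 0 (2 * Real.pi) Φ ∧ Φ (2 * Real.pi) = ρ₀) := by
  obtain ⟨δ₁, hδ₁, hrad⟩ := exists_radius_lt h.p_pos h.q_pos h.e_pos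
  obtain ⟨δ₂, hδ₂, hturn⟩ := hm.2.2 δ₁ hδ₁
  refine ⟨min 1 δ₂, lt_min one_pos hδ₂, fun ρ₀ h0 hρ₀ => ?_⟩
  have hz0 := blow_ne_zero (p := p) (q := q) (φ := 0) h0
  have hzn : ‖blow p q (0, ρ₀)‖ < δ₂ := by
    have h1 : |ρ₀| = ρ₀ := abs_of_pos h0
    have := norm_blow_le h.p_pos h.q_pos (φ := 0) (ρ := ρ₀)
      (by rw [h1]; exact hρ₀.le.trans (min_le_left _ _))
    rw [h1] at this
    exact this.trans_lt (hρ₀.trans_le (min_le_right _ _))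
  obtain ⟨T, γ, θ, hT, hγ0⟩ := hturn _ hz0 hzn
  have hT0 : (0 : ℝ) ∈ Icc 0 T := left_mem_Icc.2 hT.pos.le
  have hTT : T ∈ Icc 0 T := right_mem_Icc.2 hT.pos.le
  obtain ⟨φ, Φ, a, b, hblow, hsin, hsol, hΦ, hdir⟩ := hT.exists_isSolOn h
    fun t ht h0 => hrad _ h0 (hT.small t ht)
  obtain ⟨s, hs, hang⟩ := hT.angle 0 hT0
  -- The turn starts on the positive half-axis and `θ` changes by `±2π`. At both ends the ordinary
  -- and weighted angles coincide, so the graph covers exactly one period even if the orbit is not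
  -- closed.
  have hsin0 : Real.sin (θ 0) = 0 := by
    have : (γ 0).2 = 0 := by simp [hγ0, blow]
    rw [hang] at this
    exact (mul_eq_zero.1 this).resolve_left hs.ne'
  have hcos0 : Real.cos (θ 0) = 1 := by
    have h1 : 0 < (γ 0).1 := by simp [hγ0, blow, pow_pos h0]
    rw [hang] at h1
    have h2 : 0 < Real.cos (θ 0) := pos_of_mul_pos_right h1 hs.le
    have h3 := Real.cos_sq_add_sin_sq (θ 0)
    rw [hsin0] at h3
    nlinarith
  obtain ⟨k, hk⟩ := (Real.cos_eq_one_iff _).1 hcos0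
  have hφ0 : φ 0 = k * (2 * Real.pi) := by rw [hsin 0 hsin0, hk]
  have hturn := hT.turn
  have hsinT : Real.sin (θ T) = 0 := by
    rcases (abs_eq Real.two_pi_pos.le).1 hturn with h1 | h1
    · rw [show θ T = θ 0 + 2 * Real.pi by linarith, Real.sin_add_two_pi, hsin0]
    · rw [show θ T = θ 0 - 2 * Real.pi by linarith, Real.sin_sub_two_pi, hsin0]
  have hφT : |φ T - φ 0| = 2 * Real.pi := by rw [hsin T hsinT, hsin 0 hsin0, hturn]
  have hρ : radius p q (γ 0) = ρ₀ := by rw [hγ0, radius_blow h.p_pos h.q_pos h0]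
  have hΘ : Theta p q r P Q (φ 0) (radius p q (γ 0)) = Theta p q r P Q 0 ρ₀ := by
    rw [hφ0, hρ]
    have := Function.Periodic.int_mul (f := fun φ => Theta p q r P Q φ ρ₀)
      (fun φ => Theta_add_two_pi φ ρ₀) k 0
    simpa using this
  rw [hΘ] at hdir
  have hΦ0 : Φ (φ 0) = ρ₀ := by rw [(hΦ 0 hT0).2, hρ]
  have hpi := Real.two_pi_pos
  refine ⟨fun hpos => ?_, fun hneg => ?_⟩
  · rcases hdir with ⟨_, ha, hb⟩ | ⟨h1, _, _⟩
    swap; · exact absurd h1 hpos.not_gt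
    have hle : φ 0 ≤ φ T := by have := (hΦ T hTT).1.1; rwa [ha] at this
    rw [abs_of_nonneg (sub_nonneg.2 hle)] at hφT
    have hsh := hsol.shift (c := k * (2 * Real.pi)) fun φ ρ => F_add_int_mul_two_pi k φ ρ
    rw [show a - k * (2 * Real.pi) = 0 by rw [ha, hφ0]; ring,
      show b - k * (2 * Real.pi) = 2 * Real.pi by rw [hb, ← hφ0]; linarith] at hsh
    exact ⟨_, hsh, by rw [zero_add, ← hφ0, hΦ0]⟩
  · rcases hdir with ⟨h1, _, _⟩ | ⟨_, ha, hb⟩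
    · exact absurd h1 hneg.not_gt
    have hle : φ T ≤ φ 0 := by have := (hΦ T hTT).1.2; rwa [hb] at this
    rw [abs_of_nonpos (sub_nonpos.2 hle)] at hφT
    -- In the clockwise case the interval starts at `φ T`, which is `φ 0 - 2π`, one period earlier.
    have hsh := hsol.shift (c := ((k - 1 : ℤ) : ℝ) * (2 * Real.pi))
      fun φ ρ => F_add_int_mul_two_pi (k - 1) φ ρ
    push_cast at hsh
    rw [show a - (k - 1) * (2 * Real.pi) = 0 by rw [ha]; linarith,
      show b - (k - 1) * (2 * Real.pi) = 2 * Real.pi by rw [hb, hφ0]; ring] at hsh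
    exact ⟨_, hsh, by
      rw [show 2 * Real.pi + (k - 1) * (2 * Real.pi) = φ 0 by rw [hφ0]; ring, hΦ0]⟩

/-- If every small value is attained at `b` by a small solution, then every small value is
attained at `a` by a small solution. -/
theorem exists_isSolOn_forward_of_backward {f : ℝ → ℝ → ℝ} {a b : ℝ} (hab : a ≤ b)
    (hf : ContDiffOn ℝ 1 (fun z : ℝ × ℝ => f z.1 z.2) (strip e))
    (hbwd : ∀ ε, 0 < ε → ε ≤ e → ∃ δ > 0, ∀ ρ₀, 0 < ρ₀ → ρ₀ < δ →
      ∃ Φ, IsSolOn f ε a b Φ ∧ Φ b = ρ₀) {ε : ℝ} (hε : 0 < ε) (hεe : ε ≤ e) :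
    ∃ δ > 0, ∀ ρ₀, 0 < ρ₀ → ρ₀ < δ → ∃ Φ, IsSolOn f ε a b Φ ∧ Φ a = ρ₀ := by
  obtain ⟨δ, hδ, h1⟩ := hbwd ε hε hεe
  choose! Ψ hΨ using h1
  have haI : a ∈ Icc a b := left_mem_Icc.2 hab
  have hbI : b ∈ Icc a b := right_mem_Icc.2 hab
  have hS : ∀ x, 0 < x → x < δ → IsSolOn f e a b (Ψ x) := fun x h0 hx =>
    (hΨ x h0 hx).1.mono_strip hεe
  have hs0 : 0 < δ / 2 := by linarith
  have hs1 : δ / 2 < δ := by linarith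
  refine ⟨Ψ (δ / 2) a, (hS _ hs0 hs1 a haI).1, fun ρ₀ h0 hρ₀ => ?_⟩
  -- A solution confined below `ρ₀` has its value at `a` below `ρ₀`. The intermediate value theorem
  -- between it and `Ψ (δ / 2)` produces a solution through `ρ₀` at `a`.
  obtain ⟨δ', hδ', h2⟩ := hbwd (min ρ₀ ε) (lt_min h0 hε) ((min_le_right _ _).trans hεe)
  set x := min (δ' / 2) (δ / 2) with hx
  have hx0 : 0 < x := lt_min (by linarith) hs0
  have hxδ : x < δ := (min_le_right _ _).trans_lt hs1
  obtain ⟨Φ, hΦ, hΦb⟩ := h2 x hx0 ((min_le_left _ _).trans_lt (by linarith))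
  have hxa : Ψ x a < ρ₀ := by
    have := (hS x hx0 hxδ).eqOn hf (hΦ.mono_strip ((min_le_right _ _).trans hεe)) hbI
      (by rw [hΦb, (hΨ x hx0 hxδ).2]) haI
    rw [this]
    exact (hΦ a haI).2.1.trans_le (min_le_left _ _)
  obtain ⟨C, hC0, k, K, -, -, -, hlip⟩ := exists_lipschitz_of_between hf (hS x hx0 hxδ)
    (hS _ hs0 hs1) hbI
  rw [(hΨ x hx0 hxδ).2, (hΨ _ hs0 hs1).2] at hlip
  have hcont : ContinuousOn (fun y => Ψ y a) (Icc x (δ / 2)) := by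
    refine LipschitzOnWith.continuousOn (K := ⟨C, hC0⟩) (LipschitzOnWith.of_dist_le_mul ?_)
    intro y hy y' hy'
    have hy1 := hΨ y (hx0.trans_le hy.1) (hy.2.trans_lt hs1)
    have hy2 := hΨ y' (hx0.trans_le hy'.1) (hy'.2.trans_lt hs1)
    have := hlip _ _ (hy1.1.mono_strip hεe) (hy2.1.mono_strip hεe) (by rwa [hy1.2])
      (by rwa [hy2.2]) a haI
    rw [hy1.2, hy2.2] at this
    exact this
  obtain ⟨y, hy, hya⟩ := intermediate_value_Icc (min_le_right (δ' / 2) (δ / 2)) hcont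
    ⟨hxa.le, hρ₀.le⟩
  exact ⟨Ψ y, (hΨ y (hx0.trans_le hy.1) (hy.2.trans_lt hs1)).1, hya⟩

/-- `Θ` has constant sign on the ray `φ = 0`. If it is positive, orbits run from `0` to `2π`; if it
is negative, they run from `2π` to `0`, and the return map so obtained has to be inverted. -/
theorem exists_isSolOn_forward (h : GoodStrip p q r P Q e) (hm : IsMonodromic P Q) {ε : ℝ}
    (hε : 0 < ε) (hεe : ε ≤ e) :
    ∃ δ > 0, ∀ ρ₀, 0 < ρ₀ → ρ₀ < δ →
      ∃ Φ, IsSolOn (F p q r P Q) ε 0 (2 * Real.pi) Φ ∧ Φ 0 = ρ₀ := by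
  have hc : ContinuousOn (fun ρ => Theta p q r P Q 0 ρ) (Ioo 0 e) :=
    (contDiffOn_Theta (n := 1) h).continuousOn.comp
      (continuousOn_const.prodMk continuousOn_id) fun ρ hρ => hρ
  rcases pos_or_neg_of_ne_zero isPreconnected_Ioo hc fun ρ hρ => h.theta_ne 0 ρ hρ.1 hρ.2
    with hpos | hneg
  · obtain ⟨δ, hδ, h1⟩ := exists_isSolOn_of_axis (h.mono hε hεe) hm
    refine ⟨min δ e, lt_min hδ h.e_pos, fun ρ₀ h0 hρ₀ => ?_⟩
    exact (h1 ρ₀ h0 (hρ₀.trans_le (min_le_left _ _))).1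
      (hpos ρ₀ ⟨h0, hρ₀.trans_le (min_le_right _ _)⟩)
  · refine exists_isSolOn_forward_of_backward Real.two_pi_pos.le (contDiffOn_F h) ?_ hε hεe
    intro ε hε hεe
    obtain ⟨δ, hδ, h1⟩ := exists_isSolOn_of_axis (h.mono hε hεe) hm
    refine ⟨min δ e, lt_min hδ h.e_pos, fun ρ₀ h0 hρ₀ => ?_⟩
    exact (h1 ρ₀ h0 (hρ₀.trans_le (min_le_left _ _))).2
      (hneg ρ₀ ⟨h0, hρ₀.trans_le (min_le_right _ _)⟩)

/-- One choice of solutions, in the full strip, defines the map. By uniqueness, solutions confined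
to thinner strips have the same end values. -/
theorem exists_isPoincareMap (h : GoodStrip p q r P Q e) (hm : IsMonodromic P Q) :
    ∃ Pi : ℝ → ℝ, IsPoincareMap p q r P Q Pi := by
  obtain ⟨δ₀, hδ₀, h0⟩ := exists_isSolOn_forward h hm h.e_pos le_rfl
  choose! Ψ hΨ using h0
  refine ⟨fun x => Ψ x (2 * Real.pi), fun ε hε => ?_⟩
  obtain ⟨δ, hδ, h1⟩ := exists_isSolOn_forward h hm (lt_min hε h.e_pos) (min_le_right _ _)
  refine ⟨min δ δ₀, lt_min hδ hδ₀, fun ρ₀ hpos hρ₀ => ?_⟩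
  obtain ⟨Φ, hΦ, hΦ0⟩ := h1 ρ₀ hpos (hρ₀.trans_le (min_le_left _ _))
  have hΨ' := hΨ ρ₀ hpos (hρ₀.trans_le (min_le_right _ _))
  refine ⟨Φ, hΦ0, ?_, fun φ hφ =>
    ⟨(hΦ φ hφ).1, (hΦ φ hφ).2.1.trans_le (min_le_left _ _), (hΦ φ hφ).2.2⟩⟩
  exact (hΦ.mono_strip (min_le_right _ _)).eqOn (contDiffOn_F h) hΨ'.1
    (left_mem_Icc.2 Real.two_pi_pos.le) (by rw [hΦ0, hΨ'.2])
    (right_mem_Icc.2 Real.two_pi_pos.le)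

theorem IsPoincareMap.exists_isSolOn {Pi : ℝ → ℝ} (hPi : IsPoincareMap p q r P Q Pi) {ε : ℝ}
    (hε : 0 < ε) : ∃ δ > 0, ∀ ρ₀, 0 < ρ₀ → ρ₀ < δ →
      ∃ Φ, IsSolOn (F p q r P Q) ε 0 (2 * Real.pi) Φ ∧ Φ 0 = ρ₀ ∧ Φ (2 * Real.pi) = Pi ρ₀ := by
  obtain ⟨δ, hδ, h⟩ := hPi ε hε
  refine ⟨δ, hδ, fun ρ₀ h0 h1 => ?_⟩
  obtain ⟨Φ, h2, h3, h4⟩ := h ρ₀ h0 h1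
  exact ⟨Φ, h4, h2, h3⟩

/-! ### Closed orbits -/

/-- An autonomous scalar equation with positive right-hand side reaches every point on the
right. -/
theorem exists_autonomous_of_pos {w : ℝ → ℝ} (hw : Continuous w) (hpos : ∀ x, 0 < w x) (x₀ : ℝ)
    {l : ℝ} (hl : 0 < l) :
    ∃ T > 0, ∃ τ : ℝ → ℝ, τ 0 = x₀ ∧ τ T = x₀ + l ∧
      ∀ t ∈ Icc 0 T, HasDerivWithinAt τ (w (τ t)) (Icc 0 T) t := by
  have hwi : Continuous fun x => (w x)⁻¹ := hw.inv₀ fun x => (hpos x).ne'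
  -- `g x` is the time needed to travel from `x₀` to `x`; the solution is its inverse.
  set g := fun x => ∫ s in x₀..x, (w s)⁻¹ with hg
  have hg0 : g x₀ = 0 := intervalIntegral.integral_same
  have hab : x₀ ≤ x₀ + l := by linarith
  obtain ⟨τ, h1, h2⟩ := exists_inverse_of_deriv_pos (g := g) hab
    (fun x _ => (hwi.integral_hasStrictDerivAt x₀ x).hasDerivAt.hasDerivWithinAt)
    fun x _ => inv_pos.2 (hpos x)
  have ha := h2 x₀ (left_mem_Icc.2 hab)
  have hb := h2 (x₀ + l) (right_mem_Icc.2 hab)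
  rw [hg0] at ha hb h1
  refine ⟨g (x₀ + l), lt_of_le_of_ne hb.1.1 fun h0 => ?_, τ, ha.2, hb.2, fun t ht => ?_⟩
  · rw [← h0, ha.2] at hb
    linarith [hb.2]
  · simpa using (h1 t ht).2.2

theorem exists_autonomous {w : ℝ → ℝ} (hw : Continuous w) (hne : ∀ x, w x ≠ 0) (x₀ : ℝ)
    {l : ℝ} (hl : 0 < l) :
    ∃ T > 0, ∃ τ : ℝ → ℝ, τ 0 = x₀ ∧ (τ T = x₀ + l ∨ τ T = x₀ - l) ∧
      ∀ t ∈ Icc 0 T, HasDerivWithinAt τ (w (τ t)) (Icc 0 T) t := by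
  rcases pos_or_neg_of_ne_zero isPreconnected_univ hw.continuousOn fun x _ => hne x with h | h
  · obtain ⟨T, hT, τ, h1, h2, h3⟩ := exists_autonomous_of_pos hw (fun x => h x trivial) x₀ hl
    exact ⟨T, hT, τ, h1, Or.inl h2, h3⟩
  · obtain ⟨T, hT, τ, h1, h2, h3⟩ := exists_autonomous_of_pos (w := fun x => -w (-x))
      (by fun_prop) (fun x => neg_pos.2 (h _ trivial)) (-x₀) hl
    refine ⟨T, hT, fun t => -τ t, by simp [h1], Or.inr (by simp only [h2]; ring), fun t ht => ?_⟩
    simpa using (h3 t ht).fun_neg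

/-- A periodic solution of the polar equation is a closed orbit that makes one turn. -/
theorem exists_isTurn_of_periodic (h : GoodStrip p q r P Q e) {Φ : ℝ → ℝ}
    (hΦ : ∀ x, 0 < Φ x ∧ Φ x < e ∧ HasDerivAt Φ (F p q r P Q x (Φ x)) x)
    (hper : ∀ x, Φ (x + 2 * Real.pi) = Φ x) (φ₀ : ℝ) :
    ∃ T γ θ, IsTurn P Q e T γ θ ∧ γ 0 = blow p q (φ₀, Φ φ₀) ∧ γ T = blow p q (φ₀, Φ φ₀) := by
  have hΦc : Continuous Φ := continuous_iff_continuousAt.2 fun x => (hΦ x).2.2.continuousAt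
  have hw : Continuous fun x => Φ x ^ r * Theta p q r P Q x (Φ x) :=
    (hΦc.pow r).mul ((contDiffOn_Theta (n := 1) h).continuousOn.comp_continuous
      (continuous_id.prodMk hΦc) fun x => ⟨(hΦ x).1, (hΦ x).2.1⟩)
  obtain ⟨T, hT, τ, hτ0, hτT, hτ⟩ := exists_autonomous hw
    (fun x => mul_ne_zero (pow_pos (hΦ x).1 r).ne' (h.theta_ne _ _ (hΦ x).1 (hΦ x).2.1)) φ₀
    Real.two_pi_pos
  have hτc : ContinuousOn τ (Icc 0 T) := fun t ht => (hτ t ht).continuousWithinAt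
  have hρc : ContinuousOn (fun t => Φ (τ t)) (Icc 0 T) := hΦc.comp_continuousOn hτc
  -- This goes from the weighted to the ordinary angle, so the exponents are not interchanged as
  -- they are in `blow_twist`.
  set θ := fun x => twist (Φ x ^ p) (Φ x ^ q) x with hθ
  have hθper : ∀ x, θ (x + 2 * Real.pi) = θ x + 2 * Real.pi := fun x => by
    simp only [hθ, hper, twist_add_two_pi]
  have hbper : ∀ x, blow p q (x + 2 * Real.pi, Φ (x + 2 * Real.pi)) = blow p q (x, Φ x) := fun x => by
    simp [blow, hper]
  have hTend : |θ (τ T) - θ φ₀| = 2 * Real.pi ∧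
      blow p q (τ T, Φ (τ T)) = blow p q (φ₀, Φ φ₀) := by
    rcases hτT with h1 | h1
    · rw [h1, hθper, hbper, add_sub_cancel_left, abs_of_pos Real.two_pi_pos]
      exact ⟨rfl, rfl⟩
    · have h2 := hθper (φ₀ - 2 * Real.pi)
      have h3 := hbper (φ₀ - 2 * Real.pi)
      rw [sub_add_cancel] at h2 h3
      rw [h1, h2, h3, sub_add_cancel_left, abs_neg, abs_of_pos Real.two_pi_pos]
      exact ⟨rfl, rfl⟩
  refine ⟨T, fun t => blow p q (τ t, Φ (τ t)), fun t => θ (τ t), ⟨hT, fun t ht => ?_,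
    fun t ht => ?_, ?_, fun t ht => ?_, ?_⟩, by simp only [hτ0], hTend.2⟩
  · set c := τ t
    set s := Φ c with hs
    have hs0 : 0 < s := (hΦ c).1
    have hd1 : HasDerivWithinAt τ (s ^ r * Theta p q r P Q c s) (Icc 0 T) t := hτ t ht
    have hd2 := (hΦ c).2.2.comp_hasDerivWithinAt t hd1
    have hΘ := h.theta_ne c s hs0 (hΦ c).2.1
    have hd2' : HasDerivWithinAt (fun t => Φ (τ t)) (s ^ r * Rad p q r P Q c s) (Icc 0 T) t := by
      convert! hd2 using 1
      change _ = Rad p q r P Q c s / Theta p q r P Q c s * (s ^ r * Theta p q r P Q c s)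
      field_simp
    have hX := ((hd2'.pow p).mul hd1.cos).prodMk ((hd2'.pow q).mul hd1.sin)
    convert! hX using 1
    have hP : P (blow p q (c, s)).1 (blow p q (c, s)).2 = polar p q P c s := rfl
    have hQ : Q (blow p q (c, s)).1 (blow p q (c, s)).2 = polar p q Q c s := rfl
    rw [hP, hQ]
    have hΘ' : s ^ r * Theta p q r P Q c s = (p * s ^ (p - 1) * Real.cos c * polar p q Q c s
        - q * s ^ (q - 1) * Real.sin c * polar p q P c s) / jac p q c s := by
      rw [Theta, if_neg hs0.ne']
      have := (jac_pos h.p_pos h.q_pos (φ := c) hs0).ne'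
      have := (pow_pos hs0 r).ne'
      field_simp
    have hR' : s ^ r * Rad p q r P Q c s = (s ^ q * Real.cos c * polar p q P c s
        + s ^ p * Real.sin c * polar p q Q c s) / jac p q c s := by
      rw [Rad]
      have := (jac_pos h.p_pos h.q_pos (φ := c) hs0).ne'
      have := (pow_pos hs0 r).ne'
      field_simp
    simp only [Pi.pow_apply]
    rw [hΘ', hR']
    have hj := (jac_pos h.p_pos h.q_pos (φ := c) hs0).ne'
    obtain ⟨p', hp'⟩ := Nat.exists_eq_succ_of_ne_zero h.p_pos.ne'
    obtain ⟨q', hq'⟩ := Nat.exists_eq_succ_of_ne_zero h.q_pos.ne'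
    have hjac : jac p q c s = s ^ p' * s ^ q' * s
        * (p * Real.cos c ^ 2 + q * Real.sin c ^ 2) := by
      unfold jac
      rw [show p + q - 1 = p' + q' + 1 by omega]
      ring
    rw [show p - 1 = p' by omega, show q - 1 = q' by omega, show s ^ p = s ^ p' * s by
      rw [hp', pow_succ], show s ^ q = s ^ q' * s by rw [hq', pow_succ]]
    ext
    · change polar p q P c s = _
      simp only
      field_simp
      rw [hjac]
      ring
    · change polar p q Q c s = _
      simp only
      field_simp
      rw [hjac]
      ring
  · have h1 : |Φ (τ t)| = Φ (τ t) := abs_of_pos (hΦ _).1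
    have h2 := norm_blow_le h.p_pos h.q_pos (φ := τ t) (ρ := Φ (τ t))
      (by rw [h1]; exact (hΦ _).2.1.le.trans h.e_le)
    rw [h1] at h2
    exact h2.trans_lt (hΦ _).2.1
  · exact ContinuousOn.twist (hρc.pow p) (hρc.pow q) hτc
      (fun t _ => pow_pos (hΦ _).1 p) fun t _ => pow_pos (hΦ _).1 q
  · obtain ⟨n, hn, h1, h2⟩ := exists_eq_twist (pow_pos (hΦ (τ t)).1 p) (pow_pos (hΦ (τ t)).1 q)
      (τ t)
    exact ⟨n, hn, Prod.ext h1 h2⟩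
  · simp only [hτ0]
    exact hTend.1

/-- A solution over a period with equal values at the end points extends periodically. -/
theorem exists_periodic_of_isSolOn {f : ℝ → ℝ → ℝ} {c : ℝ} (hc : 0 < c)
    (hf : ∀ φ ρ, f (φ + c) ρ = f φ ρ) {Φ : ℝ → ℝ} (hΦ : IsSolOn f e 0 c Φ) (hend : Φ c = Φ 0) :
    ∃ Ψ : ℝ → ℝ, (∀ x, 0 < Ψ x ∧ Ψ x < e ∧ HasDerivAt Ψ (f x (Ψ x)) x) ∧
      (∀ x, Ψ (x + c) = Ψ x) ∧ Ψ 0 = Φ 0 := by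
  set Ψ := fun x => Φ (x - ⌊x / c⌋ * c) with hΨ
  have hper : ∀ x, Ψ (x + c) = Ψ x := fun x => by
    simp only [hΨ]
    rw [add_div, div_self hc.ne', Int.floor_add_one]
    push_cast
    ring_nf
  -- At the right end of a cell the floor has already jumped, and equality there is exactly `hend`.
  have hEq : ∀ k : ℤ, EqOn Ψ (fun x => Φ (x - k * c)) (Icc (k * c) (k * c + c)) := by
    intro k x hx
    rcases hx.2.eq_or_lt with h1 | h1
    · have hfl : ⌊x / c⌋ = k + 1 := by
        rw [h1, add_div, mul_div_cancel_right₀ _ hc.ne', div_self hc.ne']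
        exact_mod_cast Int.floor_intCast (k + 1)
      simp only [hΨ]
      rw [hfl, h1]
      push_cast
      rw [show k * c + c - (k + 1) * c = 0 by ring, show k * c + c - k * c = c by ring, hend]
    · have hfl : ⌊x / c⌋ = k := by
        rw [Int.floor_eq_iff, le_div_iff₀ hc, div_lt_iff₀ hc]
        exact ⟨hx.1, by linarith⟩
      simp only [hΨ, hfl]
  have hsol : ∀ k : ℤ, IsSolOn f e (k * c) (k * c + c) Ψ := by
    intro k
    refine IsSolOn.congr ?_ (hEq k)
    have hp : Function.Periodic (fun φ => f φ) c := fun φ => funext (hf φ)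
    have := hΦ.shift (c := ((-k : ℤ) : ℝ) * c) fun φ ρ => congrFun (hp.int_mul (-k) φ) ρ
    push_cast at this
    rw [show 0 - -(k : ℝ) * c = k * c by ring, show c - -(k : ℝ) * c = k * c + c by ring] at this
    convert! this using 3
    ring
  refine ⟨Ψ, fun x => ?_, hper, by simp [hΨ]⟩
  set k := ⌊x / c⌋ with hk
  have h1 : k * c ≤ x := by rw [← le_div_iff₀ hc]; exact Int.floor_le _
  have h2 : x < k * c + c := by
    have := Int.lt_floor_add_one (x / c)
    rw [div_lt_iff₀ hc] at this
    linarith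
  have hx := hsol k x ⟨h1, h2.le⟩
  refine ⟨hx.1, hx.2.1, ?_⟩
  -- At a boundary between two cells, the derivatives within the two closed cells agree and are
  -- glued.
  rcases h1.eq_or_lt with heq | hlt
  · have hkc : ((k - 1 : ℤ) : ℝ) * c + c = x := by push_cast; rw [← heq]; ring
    have hx' := hsol (k - 1) x ⟨by linarith, hkc.ge⟩
    have hu := hx'.2.2.union hx.2.2
    refine hu.hasDerivAt ?_
    rw [hkc, heq, Icc_union_Icc_eq_Icc (by linarith) (by linarith)]
    exact Icc_mem_nhds (by linarith) (by linarith)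
  · exact hx.2.2.hasDerivAt (Icc_mem_nhds hlt h2)

/-- If the Poincaré map is the identity near `0`, then the origin is a center. -/
theorem isCenter_of_poincareMap_eq_id (h : GoodStrip p q r P Q e) (hm : IsMonodromic P Q)
    {Pi : ℝ → ℝ} (hPi : IsPoincareMap p q r P Q Pi) (hid : ∀ᶠ ρ in 𝓝[>] (0 : ℝ), Pi ρ = ρ) :
    IsCenter P Q := by
  refine ⟨hm.1, hm.2.1, fun ε hε => ?_⟩
  obtain ⟨d, hd, hid⟩ := mem_nhdsGT_iff_exists_Ioo_subset.1 hid
  have hd : 0 < d := hd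
  set e₁ := min ε e
  have he₁ : 0 < e₁ := lt_min hε h.e_pos
  obtain ⟨δ₁, hδ₁, hsol⟩ := hPi.exists_isSolOn he₁
  -- `e₁` keeps the closed orbit in the `ε`-ball. `e₂` ensures that wherever the turn from `z`
  -- crosses the section, the periodic solution in the `e₁`-strip exists.
  set e₂ := min (min δ₁ d) e
  have he₂ : 0 < e₂ := lt_min (lt_min hδ₁ hd) h.e_pos
  obtain ⟨δ₃, hδ₃, hrad⟩ := exists_radius_lt h.p_pos h.q_pos he₂
  obtain ⟨δ₄, hδ₄, hturn⟩ := hm.2.2 δ₃ hδ₃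
  refine ⟨δ₄, hδ₄, fun z hz hzn => ?_⟩
  obtain ⟨T, γ, θ, hT, hγ0⟩ := hturn z hz hzn
  have hT0 : (0 : ℝ) ∈ Icc 0 T := left_mem_Icc.2 hT.pos.le
  obtain ⟨φ, Φ, a, b, hblow, hsin, hΦsol, hΦ, -⟩ := hT.exists_isSolOn
    (h.mono he₂ (min_le_right _ _)) fun t ht h0 => hrad _ h0 (hT.small t ht)
  -- An angle changing by `2π` passes a multiple of `2π`, so the turn from `z` meets the section.
  obtain ⟨t₁, ht₁, k, hk⟩ : ∃ t₁ ∈ Icc 0 T, ∃ k : ℤ, θ t₁ = k * (2 * Real.pi) := by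
    have hpi := Real.two_pi_pos
    have hTT : T ∈ Icc 0 T := right_mem_Icc.2 hT.pos.le
    have key : ∀ {x y : ℝ}, y - x = 2 * Real.pi → ∃ k : ℤ, k * (2 * Real.pi) ∈ Icc x y := by
      intro x y hxy
      refine ⟨⌈x / (2 * Real.pi)⌉, ?_, ?_⟩
      · rw [← div_le_iff₀ hpi]; exact Int.le_ceil _
      · have := Int.ceil_lt_add_one (x / (2 * Real.pi))
        have h2 : (⌈x / (2 * Real.pi)⌉ : ℝ) * (2 * Real.pi)
            ≤ (x / (2 * Real.pi) + 1) * (2 * Real.pi) := by gcongr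
        rw [add_mul, div_mul_cancel₀ _ hpi.ne'] at h2
        linarith
    rcases (abs_eq hpi.le).1 hT.turn with h1 | h1
    · obtain ⟨k, hk⟩ := key h1
      obtain ⟨t, ht, h2⟩ := isPreconnected_Icc.intermediate_value hT0 hTT hT.cont hk
      exact ⟨t, ht, k, h2⟩
    · obtain ⟨k, hk⟩ := key (x := θ T) (y := θ 0) (by linarith)
      obtain ⟨t, ht, h2⟩ := isPreconnected_Icc.intermediate_value hTT hT0 hT.cont hk
      exact ⟨t, ht, k, h2⟩
  have hφt₁ : φ t₁ = k * (2 * Real.pi) := by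
    rw [hsin t₁, hk]
    rw [hk, show (k : ℝ) * (2 * Real.pi) = (2 * k : ℤ) * Real.pi by push_cast; ring]
    exact Real.sin_int_mul_pi _
  set ρ₁ := radius p q (γ t₁) with hρ₁
  have hρ₁0 : 0 < ρ₁ := (radius_spec h.p_pos h.q_pos (hblow t₁ ht₁).1).1
  have hρ₁e : ρ₁ < e₂ := hrad _ (hblow t₁ ht₁).1 (hT.small t₁ ht₁)
  have hρ₁δ : ρ₁ < min δ₁ d := hρ₁e.trans_le (min_le_left _ _)
  obtain ⟨Φ₁, hΦ₁, hΦ₁0, hΦ₁e⟩ := hsol ρ₁ hρ₁0 (hρ₁δ.trans_le (min_le_left _ _))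
  have hPi1 : Pi ρ₁ = ρ₁ := hid ⟨hρ₁0, hρ₁δ.trans_le (min_le_right _ _)⟩
  obtain ⟨Ψ, hΨ, hΨper, hΨ0⟩ := exists_periodic_of_isSolOn Real.two_pi_pos
    (fun φ ρ => F_add_two_pi φ ρ) hΦ₁ (by rw [hΦ₁e, hPi1, hΦ₁0])
  have hΨk : Ψ (φ t₁) = ρ₁ := by
    have hp : Function.Periodic Ψ (2 * Real.pi) := hΨper
    have := hp.int_mul k 0
    rw [zero_add] at this
    rw [hφt₁, this, hΨ0, hΦ₁0]
  -- The periodic solution and the graph of the turn agree at the section, hence everywhere on the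
  -- graph; so the closed orbit passes through `z`.
  have hEq := IsSolOn.eqOn (contDiffOn_F h) (Φ := Ψ) (Ψ := Φ) (a := a) (b := b)
    (fun x _ => ⟨(hΨ x).1, (hΨ x).2.1.trans_le (min_le_right _ _), (hΨ x).2.2.hasDerivWithinAt⟩)
    (hΦsol.mono_strip (min_le_right _ _)) (hΦ t₁ ht₁).1 (by rw [hΨk, (hΦ t₁ ht₁).2])
    (hΦ 0 hT0).1
  rw [(hΦ 0 hT0).2] at hEq
  have hz' : blow p q (φ 0, Ψ (φ 0)) = z := by rw [hEq, (hblow 0 hT0).2, hγ0]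
  obtain ⟨T', γ', θ', hT', h0', h1'⟩ := exists_isTurn_of_periodic
    (h.mono he₁ (min_le_right _ _)) hΨ hΨper (φ 0)
  refine ⟨T', γ', θ', ⟨hT'.pos, hT'.ode, fun t ht => (hT'.small t ht).trans_le (min_le_left _ _),
    hT'.cont, hT'.angle, hT'.turn⟩, by rw [h0', hz'], by rw [h1', hz']⟩

end Monodromic

namespace Monodromic

open scoped ContDiff

/-! ### Taylor bounds, uniform in the angle -/

/-- The band `|ρ| < e`. -/
def band (e : ℝ) : Set (ℝ × ℝ) := {z | |z.2| < e}

theorem isOpen_band (e : ℝ) : IsOpen (band e) :=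
  isOpen_lt (continuous_abs.comp continuous_snd) continuous_const

variable {e a b : ℝ}

theorem hasDerivAt_of_contDiffOn_band {f : ℝ → ℝ → ℝ}
    (hf : ContDiffOn ℝ ∞ (fun z : ℝ × ℝ => f z.1 z.2) (band e)) {z : ℝ × ℝ} (hz : z ∈ band e) :
    HasDerivAt (fun x => f z.1 x) (fderiv ℝ (fun z : ℝ × ℝ => f z.1 z.2) z (0, 1)) z.2 := by
  have h1 : HasFDerivAt (fun z : ℝ × ℝ => f z.1 z.2) _ z :=
    ((hf.contDiffAt ((isOpen_band e).mem_nhds hz)).differentiableAt (by simp)).hasFDerivAt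
  have h2 : HasDerivAt (fun x : ℝ => (z.1, x)) ((0 : ℝ), (1 : ℝ)) z.2 :=
    (hasDerivAt_const _ _).prodMk (hasDerivAt_id _)
  exact HasFDerivAt.comp_hasDerivAt z.2 (f := fun x : ℝ => (z.1, x)) h1 h2

theorem hasDerivAt_dRho_band {f : ℝ → ℝ → ℝ}
    (hf : ContDiffOn ℝ ∞ (fun z : ℝ × ℝ => f z.1 z.2) (band e)) {φ ρ : ℝ} (hρ : |ρ| < e) :
    HasDerivAt (fun x => f φ x) (dRho f φ ρ) ρ :=
  (hasDerivAt_of_contDiffOn_band hf (z := (φ, ρ)) hρ).differentiableAt.hasDerivAt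

theorem contDiffOn_dRho {f : ℝ → ℝ → ℝ}
    (hf : ContDiffOn ℝ ∞ (fun z : ℝ × ℝ => f z.1 z.2) (band e)) :
    ContDiffOn ℝ ∞ (fun z : ℝ × ℝ => dRho f z.1 z.2) (band e) := by
  have h1 := hf.fderiv_of_isOpen (m := ∞) (isOpen_band e) (by simp)
  exact (h1.clm_apply contDiffOn_const).congr fun z hz =>
    (hasDerivAt_of_contDiffOn_band hf hz).deriv

theorem contDiffOn_dRho_iterate {f : ℝ → ℝ → ℝ}
    (hf : ContDiffOn ℝ ∞ (fun z : ℝ × ℝ => f z.1 z.2) (band e)) (N : ℕ) :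
    ContDiffOn ℝ ∞ (fun z : ℝ × ℝ => dRho^[N] f z.1 z.2) (band e) := by
  induction N with
  | zero => exact hf
  | succ N ih => simp only [Function.iterate_succ_apply']; exact contDiffOn_dRho ih

theorem dRho_iterate_eq (f : ℝ → ℝ → ℝ) (N : ℕ) (φ ρ : ℝ) :
    dRho^[N] f φ ρ = iteratedDeriv N (f φ) ρ := by
  induction N generalizing ρ with
  | zero => simp
  | succ N ih =>
    rw [Function.iterate_succ_apply', iteratedDeriv_succ, dRho]
    congr 1
    funext x
    exact ih x

theorem exists_abs_le_on_band {f : ℝ → ℝ → ℝ}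
    (hf : ContDiffOn ℝ ∞ (fun z : ℝ × ℝ => f z.1 z.2) (band e)) {e' : ℝ} (he' : e' < e) :
    ∃ C, 0 ≤ C ∧ ∀ φ ∈ Icc a b, ∀ ρ ∈ Icc 0 e', |f φ ρ| ≤ C := by
  have hsub : Icc a b ×ˢ Icc 0 e' ⊆ band e := fun z hz => by
    change |z.2| < e
    rw [abs_of_nonneg hz.2.1]
    exact hz.2.2.trans_lt he'
  obtain ⟨C, hC⟩ := (isCompact_Icc.prod isCompact_Icc).exists_bound_of_continuousOn
    (hf.continuousOn.mono hsub)
  exact ⟨max C 0, le_max_right _ _, fun φ hφ ρ hρ => (hC (φ, ρ) ⟨hφ, hρ⟩).trans (le_max_left _ _)⟩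

/-- Taylor's formula in `ρ` at `ρ = 0`, with a bound uniform in `φ`, for a function whose
derivatives of order less than `N` vanish at `ρ = 0`. -/
theorem exists_taylor_bound {e' : ℝ} (he' : e' < e) (N : ℕ) : ∀ f : ℝ → ℝ → ℝ,
    ContDiffOn ℝ ∞ (fun z : ℝ × ℝ => f z.1 z.2) (band e) →
    (∀ φ ∈ Icc a b, ∀ k < N, dRho^[k] f φ 0 = 0) →
    ∃ C, 0 ≤ C ∧ ∀ φ ∈ Icc a b, ∀ ρ ∈ Icc 0 e',
      |f φ ρ - dRho^[N] f φ 0 / N.factorial * ρ ^ N| ≤ C * ρ ^ (N + 1) := by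
  have habs : ∀ {x ρ : ℝ}, ρ ∈ Icc 0 e' → x ∈ Icc 0 ρ → |x| < e := fun hρ hx => by
    rw [abs_of_nonneg hx.1]; exact (hx.2.trans hρ.2).trans_lt he'
  induction N with
  | zero =>
    intro f hf _
    obtain ⟨C, hC0, hC⟩ := exists_abs_le_on_band (a := a) (b := b) (contDiffOn_dRho hf) he'
    refine ⟨C, hC0, fun φ hφ ρ hρ => ?_⟩
    have := (convex_Icc 0 ρ).norm_image_sub_le_of_norm_hasDerivWithin_le (C := C)
      (fun x hx => (hasDerivAt_dRho_band (φ := φ) hf (habs hρ hx)).hasDerivWithinAt)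
      (fun x hx => hC φ hφ x ⟨hx.1, hx.2.trans hρ.2⟩) (left_mem_Icc.2 hρ.1) (right_mem_Icc.2 hρ.1)
    simpa [abs_of_nonneg hρ.1] using this
  | succ N ih =>
    intro f hf h0
    -- The bound for `∂f/∂ρ` is integrated from `0` by the mean value inequality, which keeps it
    -- uniform in `φ`.
    obtain ⟨C, hC0, hC⟩ := ih (dRho f) (contDiffOn_dRho hf) fun φ hφ k hk => by
      rw [← Function.iterate_succ_apply]; exact h0 φ hφ (k + 1) (by omega)
    refine ⟨C, hC0, fun φ hφ ρ hρ => ?_⟩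
    set D := dRho^[N + 1] f φ 0 with hD
    rw [← Function.iterate_succ_apply] at hC
    have hder : ∀ x ∈ Icc 0 ρ, HasDerivWithinAt
        (fun x => f φ x - D / (N + 1).factorial * x ^ (N + 1))
        (dRho f φ x - D / N.factorial * x ^ N) (Icc 0 ρ) x := by
      intro x hx
      have h1 := (hasDerivAt_dRho_band (φ := φ) hf (habs hρ hx)).fun_sub
        ((hasDerivAt_pow (N + 1) x).const_mul (D / (N + 1).factorial))
      convert! h1.hasDerivWithinAt using 1
      have : (N.factorial : ℝ) ≠ 0 := by positivity
      rw [Nat.factorial_succ]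
      push_cast
      field_simp
    have hf0 : f φ 0 = 0 := h0 φ hφ 0 (Nat.succ_pos N)
    have := (convex_Icc 0 ρ).norm_image_sub_le_of_norm_hasDerivWithin_le (C := C * ρ ^ (N + 1))
      hder (fun x hx => (hC φ hφ x ⟨hx.1, hx.2.trans hρ.2⟩).trans (by
        have := hx.1
        have := hx.2
        gcongr)) (left_mem_Icc.2 hρ.1) (right_mem_Icc.2 hρ.1)
    rw [hf0, Real.norm_eq_abs, Real.norm_eq_abs, sub_zero, abs_of_nonneg hρ.1] at this
    simp only [ne_eq, Nat.add_eq_zero_iff, one_ne_zero, and_false, not_false_eq_true, zero_pow,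
      mul_zero, sub_zero] at this
    rw [pow_succ ρ (N + 1), ← mul_assoc]
    exact this

/-- The leading Taylor coefficient is bounded on the compact arc, so it can be absorbed in the
constant together with the remainder. -/
theorem exists_pow_bound {e' : ℝ} (he : 0 < e) (he' : e' < e) {N : ℕ} {f : ℝ → ℝ → ℝ}
    (hf : ContDiffOn ℝ ∞ (fun z : ℝ × ℝ => f z.1 z.2) (band e))
    (h0 : ∀ φ ∈ Icc a b, ∀ k < N, dRho^[k] f φ 0 = 0) :
    ∃ C, 0 ≤ C ∧ ∀ φ ∈ Icc a b, ∀ ρ ∈ Icc 0 e', |f φ ρ| ≤ C * ρ ^ N := by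
  obtain ⟨C, hC0, hC⟩ := exists_taylor_bound he' N f hf h0
  obtain ⟨C', hC'0, hC'⟩ := exists_abs_le_on_band (a := a) (b := b) (contDiffOn_dRho_iterate hf N)
    (e' := 0) he
  refine ⟨C * e + C', by positivity, fun φ hφ ρ hρ => ?_⟩
  have h1 := hC φ hφ ρ hρ
  have h2 := hC' φ hφ 0 (left_mem_Icc.2 le_rfl)
  have hρN : 0 ≤ ρ ^ N := pow_nonneg hρ.1 N
  have h3 : |dRho^[N] f φ 0 / N.factorial * ρ ^ N| ≤ C' * ρ ^ N := by
    rw [abs_mul, abs_div, abs_of_nonneg hρN, Nat.abs_cast]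
    gcongr
    refine (div_le_self (abs_nonneg _) ?_).trans h2
    exact_mod_cast Nat.one_le_iff_ne_zero.2 (Nat.factorial_ne_zero N)
  have h4 : C * ρ ^ (N + 1) ≤ C * e * ρ ^ N := by
    have : ρ ≤ e := hρ.2.trans he'.le
    rw [pow_succ, mul_assoc, mul_comm (ρ ^ N)]
    gcongr
  calc |f φ ρ| = |(f φ ρ - dRho^[N] f φ 0 / N.factorial * ρ ^ N)
        + dRho^[N] f φ 0 / N.factorial * ρ ^ N| := by rw [sub_add_cancel]
    _ ≤ _ := abs_add_le _ _
    _ ≤ (C * e + C') * ρ ^ N := by linarith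

/-- The quotient of `polar p q f` by the leading power of `ρ`, near `ρ = 0`. -/
theorem exists_polar_bounds {p q n : ℕ} (hp : 0 < p) (hq : 0 < q) (hn : 0 < n) (he : 0 < e)
    (he1 : e ≤ 1) {f : ℝ → ℝ → ℝ}
    (hf : ∀ z : ℝ × ℝ, ‖z‖ < e → AnalyticAt ℝ (fun z : ℝ × ℝ => f z.1 z.2) z)
    (h0 : ∀ k < n, ∀ x y, quasiPart p q f k x y = 0) {e' : ℝ} (he' : e' < e) :
    ContinuousOn (fun φ => quasiPart p q f n (Real.cos φ) (Real.sin φ)) (Icc a b) ∧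
    ∃ C, 0 ≤ C ∧ ∀ φ ∈ Icc a b, ∀ ρ, 0 < ρ → ρ ≤ e' →
      |polar p q f φ ρ / ρ ^ n - quasiPart p q f n (Real.cos φ) (Real.sin φ)| ≤ C * ρ ∧
      |polar p q f φ ρ / ρ ^ n| ≤ C ∧
      ∃ d, HasDerivAt (fun x => polar p q f φ x / x ^ n) d ρ ∧ |ρ * d| ≤ C := by
  have hsm : ContDiffOn ℝ ∞ (fun z : ℝ × ℝ => polar p q f z.1 z.2) (band e) := fun z hz =>
    (contDiffAt_polar hp hq he1 hf hz).contDiffWithinAt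
  -- On the unit circle the quasihomogeneous parts are the Taylor coefficients in `ρ` of the
  -- blown-up function.
  have hqp : ∀ k φ, quasiPart p q f k (Real.cos φ) (Real.sin φ)
      = dRho^[k] (polar p q f) φ 0 / k.factorial := fun k φ => by
    rw [dRho_iterate_eq]; rfl
  have hvan : ∀ φ ∈ Icc a b, ∀ k < n, dRho^[k] (polar p q f) φ 0 = 0 := by
    intro φ _ k hk
    have h1 := h0 k hk (Real.cos φ) (Real.sin φ)
    rw [hqp] at h1
    exact (div_eq_zero_iff.1 h1).resolve_right (by positivity)
  refine ⟨?_, ?_⟩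
  · simp only [hqp]
    refine ContinuousOn.div_const ?_ _
    exact (contDiffOn_dRho_iterate hsm n).continuousOn.comp (s := Icc a b)
      (f := fun φ : ℝ => ((φ, 0) : ℝ × ℝ)) (by fun_prop) fun φ _ => by simpa [band] using he
  obtain ⟨C₁, hC₁, h1⟩ := exists_taylor_bound he' n _ hsm hvan
  obtain ⟨C₂, hC₂, h2⟩ := exists_pow_bound he he' hsm hvan
  obtain ⟨C₃, hC₃, h3⟩ := exists_pow_bound (a := a) (b := b) (N := n - 1) he he'
    (contDiffOn_dRho hsm) fun φ hφ k hk => by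
      rw [← Function.iterate_succ_apply]; exact hvan φ hφ (k + 1) (by omega)
  refine ⟨C₁ + C₂ + (C₃ + n * C₂), by positivity, fun φ hφ ρ hρ0 hρ => ?_⟩
  have hρn : 0 < ρ ^ n := pow_pos hρ0 n
  have h1 := h1 φ hφ ρ ⟨hρ0.le, hρ⟩
  have h2 := h2 φ hφ ρ ⟨hρ0.le, hρ⟩
  have h3 := h3 φ hφ ρ ⟨hρ0.le, hρ⟩
  have hb : |polar p q f φ ρ / ρ ^ n| ≤ C₂ := by
    rw [abs_div, abs_of_pos hρn, div_le_iff₀ hρn]; exact h2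
  have hnC : 0 ≤ n * C₂ := by positivity
  refine ⟨?_, by linarith, ?_⟩
  · have h4 : |polar p q f φ ρ / ρ ^ n - quasiPart p q f n (Real.cos φ) (Real.sin φ)|
        ≤ C₁ * ρ := by
      rw [hqp, show polar p q f φ ρ / ρ ^ n - dRho^[n] (polar p q f) φ 0 / n.factorial
        = (polar p q f φ ρ - dRho^[n] (polar p q f) φ 0 / n.factorial * ρ ^ n) / ρ ^ n by
          field_simp, abs_div, abs_of_pos hρn, div_le_iff₀ hρn, mul_assoc, ← pow_succ']
      exact h1
    refine h4.trans ?_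
    gcongr
    linarith
  · have hd := (hasDerivAt_dRho_band (φ := φ) hsm (ρ := ρ)
      (by rw [abs_of_pos hρ0]; exact hρ.trans_lt he')).fun_div (hasDerivAt_pow n ρ) hρn.ne'
    refine ⟨_, hd, ?_⟩
    obtain ⟨n', rfl⟩ := Nat.exists_eq_succ_of_ne_zero hn.ne'
    have hρn' : 0 < ρ ^ n' := pow_pos hρ0 n'
    simp only [Nat.succ_eq_add_one, Nat.add_one_sub_one] at *
    -- Both terms on the right have bounded numerators relative to their powers of `ρ`. Bounding
    -- only `ρ * d` suffices, since `F` carries an extra factor `ρ`.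
    have heq : ρ * ((dRho (polar p q f) φ ρ * ρ ^ (n' + 1)
        - polar p q f φ ρ * (((n' + 1 : ℕ) : ℝ) * ρ ^ n')) / (ρ ^ (n' + 1)) ^ 2)
        = dRho (polar p q f) φ ρ / ρ ^ n'
          - ((n' + 1 : ℕ) : ℝ) * (polar p q f φ ρ / ρ ^ (n' + 1)) := by
      field_simp
      ring
    rw [heq]
    have h5 : |dRho (polar p q f) φ ρ / ρ ^ n'| ≤ C₃ := by
      rw [abs_div, abs_of_pos hρn', div_le_iff₀ hρn']; exact h3
    have h6 : |((n' + 1 : ℕ) : ℝ) * (polar p q f φ ρ / ρ ^ (n' + 1))|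
        ≤ ((n' + 1 : ℕ) : ℝ) * C₂ := by
      rw [abs_mul, Nat.abs_cast]; gcongr
    have := abs_sub (dRho (polar p q f) φ ρ / ρ ^ n')
      (((n' + 1 : ℕ) : ℝ) * (polar p q f φ ρ / ρ ^ (n' + 1)))
    linarith

end Monodromic

namespace Monodromic

variable {p q r : ℕ} {P Q : ℝ → ℝ → ℝ} {e a b : ℝ}

/-! ### The polar equation near an arc of non-characteristic directions -/

/-- `F` in terms of the quotients of `P` and `Q` by their leading powers of `ρ`. -/
theorem F_eq_of_pos (hp : 0 < p) (hq : 0 < q) {φ ρ : ℝ} (hρ : 0 < ρ) :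
    Theta p q r P Q φ ρ * (p * Real.cos φ ^ 2 + q * Real.sin φ ^ 2)
      = p * Real.cos φ * (polar p q Q φ ρ / ρ ^ (q + r))
        - q * Real.sin φ * (polar p q P φ ρ / ρ ^ (p + r)) ∧
    F p q r P Q φ ρ = ρ * (Real.cos φ * (polar p q P φ ρ / ρ ^ (p + r))
        + Real.sin φ * (polar p q Q φ ρ / ρ ^ (q + r)))
      / (p * Real.cos φ * (polar p q Q φ ρ / ρ ^ (q + r))
        - q * Real.sin φ * (polar p q P φ ρ / ρ ^ (p + r))) := by
  have hw := (weight_pos hp hq φ).ne'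
  obtain ⟨p', hp'⟩ := Nat.exists_eq_succ_of_ne_zero hp.ne'
  obtain ⟨q', hq'⟩ := Nat.exists_eq_succ_of_ne_zero hq.ne'
  have hjac : jac p q φ ρ = ρ ^ p' * ρ ^ q' * ρ
      * (p * Real.cos φ ^ 2 + q * Real.sin φ ^ 2) := by
    unfold jac
    rw [show p + q - 1 = p' + q' + 1 by omega]
    ring
  have e1 : ρ ^ p = ρ ^ p' * ρ := by rw [hp', pow_succ]
  have e2 : ρ ^ q = ρ ^ q' * ρ := by rw [hq', pow_succ]
  have e3 : ρ ^ (p + r) = ρ ^ p' * ρ * ρ ^ r := by rw [pow_add, e1]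
  have e4 : ρ ^ (q + r) = ρ ^ q' * ρ * ρ ^ r := by rw [pow_add, e2]
  have hΘ : Theta p q r P Q φ ρ * (p * Real.cos φ ^ 2 + q * Real.sin φ ^ 2)
      = p * Real.cos φ * (polar p q Q φ ρ / ρ ^ (q + r))
        - q * Real.sin φ * (polar p q P φ ρ / ρ ^ (p + r)) := by
    rw [Theta, if_neg hρ.ne', hjac, e3, e4, show p - 1 = p' by omega, show q - 1 = q' by omega]
    field_simp
  have hR : Rad p q r P Q φ ρ * (p * Real.cos φ ^ 2 + q * Real.sin φ ^ 2)
      = ρ * (Real.cos φ * (polar p q P φ ρ / ρ ^ (p + r))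
        + Real.sin φ * (polar p q Q φ ρ / ρ ^ (q + r))) := by
    rw [Rad, hjac, e1, e2, e3, e4]
    generalize (p : ℝ) * Real.cos φ ^ 2 + q * Real.sin φ ^ 2 = w at hw ⊢
    field_simp
  refine ⟨hΘ, ?_⟩
  rw [← hΘ, ← hR, F, mul_div_mul_right _ _ hw]

/-- Near a compact arc of non-characteristic directions, `F` is `O(ρ)` and `∂F/∂ρ` is bounded. -/
theorem exists_F_bounds (h : GoodStrip p q r P Q e) (hr : IsLeadingDegree p q r P Q) (hab : a ≤ b)
    (hΩ : ∀ φ ∈ Icc a b, φ ∉ Omega p q r P Q) :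
    ∃ e₁ > 0, e₁ ≤ e ∧ ∃ L, 0 ≤ L ∧ ∀ φ ∈ Icc a b, ∀ ρ, 0 < ρ → ρ < e₁ →
      |F p q r P Q φ ρ| ≤ L * ρ ∧ |dRho (F p q r P Q) φ ρ| ≤ L := by
  have he2 : e / 2 < e := by linarith [h.e_pos]
  obtain ⟨hPc, A, hA0, hA⟩ := exists_polar_bounds (a := a) (b := b) h.p_pos h.q_pos
    (Nat.add_pos_left h.p_pos r) h.e_pos h.e_le h.anP hr.1 he2
  obtain ⟨hQc, B, hB0, hB⟩ := exists_polar_bounds (a := a) (b := b) h.p_pos h.q_pos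
    (Nat.add_pos_left h.q_pos r) h.e_pos h.e_le h.anQ hr.2.1 he2
  -- `T₀` is `Θ(φ, 0)` up to a positive weight, so `|T₀|` has a positive minimum on the arc; half of
  -- it is the bound `τ` kept for small `ρ`.
  set T₀ := fun φ => p * Real.cos φ * quasiPart p q Q (q + r) (Real.cos φ) (Real.sin φ)
      - q * Real.sin φ * quasiPart p q P (p + r) (Real.cos φ) (Real.sin φ) with hT₀
  have hT₀c : ContinuousOn T₀ (Icc a b) :=
    ((Continuous.continuousOn (by fun_prop)).mul hQc).sub
      ((Continuous.continuousOn (by fun_prop)).mul hPc)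
  have hT₀ne : ∀ φ ∈ Icc a b, T₀ φ ≠ 0 := by
    intro φ hφ h0
    apply hΩ φ hφ
    change Theta p q r P Q φ 0 = 0
    rw [Theta, if_pos rfl]
    simp only [hT₀] at h0
    rw [h0, zero_div]
  obtain ⟨x, hx, hmin⟩ := isCompact_Icc.exists_isMinOn (nonempty_Icc.2 hab) hT₀c.abs
  set τ := |T₀ x| / 2 with hτ
  have hτ0 : 0 < τ := half_pos (abs_pos.2 (hT₀ne x hx))
  set S := (p + q) * (A + B) with hS
  have hS0 : 0 ≤ S := by positivity
  have hcos := Real.abs_cos_le_one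
  have hsin := Real.abs_sin_le_one
  have combP : ∀ φ u v c d : ℝ, |u| ≤ c → |v| ≤ d →
      |Real.cos φ * u + Real.sin φ * v| ≤ c + d := by
    intro φ u v c d hu hv
    refine (abs_add_le _ _).trans (add_le_add ?_ ?_) <;> rw [abs_mul]
    · calc _ ≤ 1 * c := mul_le_mul (hcos φ) hu (abs_nonneg _) zero_le_one
        _ = c := one_mul c
    · calc _ ≤ 1 * d := mul_le_mul (hsin φ) hv (abs_nonneg _) zero_le_one
        _ = d := one_mul d
  have combT : ∀ φ u v c d : ℝ, |u| ≤ c → |v| ≤ d →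
      |p * Real.cos φ * v - q * Real.sin φ * u| ≤ (p + q) * (c + d) := by
    intro φ u v c d hu hv
    have hc0 : 0 ≤ c := (abs_nonneg _).trans hu
    have hd0 : 0 ≤ d := (abs_nonneg _).trans hv
    have h1 : |p * Real.cos φ * v| ≤ p * d := by
      rw [abs_mul, abs_mul, Nat.abs_cast]
      calc _ ≤ p * 1 * d := by gcongr; exact hcos φ
        _ = p * d := by ring
    have h2 : |q * Real.sin φ * u| ≤ q * c := by
      rw [abs_mul, abs_mul, Nat.abs_cast]
      calc _ ≤ q * 1 * c := by gcongr; exact hsin φ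
        _ = q * c := by ring
    have h3 := abs_sub (p * Real.cos φ * v) (q * Real.sin φ * u)
    have h4 : 0 ≤ (p : ℝ) * c := by positivity
    have h5 : 0 ≤ (q : ℝ) * d := by positivity
    nlinarith
  -- The denominator differs from `T₀` by at most `S * ρ`, which this choice keeps below `τ`; the
  -- summand `1` avoids dividing by zero.
  set e₁ := min (e / 2) (τ / (S + 1)) with he₁
  refine ⟨e₁, lt_min (by linarith [h.e_pos]) (by positivity),
    (min_le_left _ _).trans he2.le, max ((A + B) / τ) (2 * ((A + B) * S + (A + B) * S) / τ ^ 2),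
    le_max_of_le_left (by positivity), fun φ hφ ρ hρ0 hρ => ?_⟩
  have hρe : ρ ≤ e / 2 := hρ.le.trans (min_le_left _ _)
  obtain ⟨hP1, hP2, dP, hP3, hP4⟩ := hA φ hφ ρ hρ0 hρe
  obtain ⟨hQ1, hQ2, dQ, hQ3, hQ4⟩ := hB φ hφ ρ hρ0 hρe
  set u := fun x => polar p q P φ x / x ^ (p + r) with hu
  set v := fun x => polar p q Q φ x / x ^ (q + r) with hv
  set N := fun x => Real.cos φ * u x + Real.sin φ * v x with hN
  set T := fun x => p * Real.cos φ * v x - q * Real.sin φ * u x with hT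
  have hNb : |N ρ| ≤ A + B := combP φ _ _ _ _ hP2 hQ2
  have hTb : |T ρ| ≤ S := combT φ _ _ _ _ hP2 hQ2
  have hTlow : τ ≤ |T ρ| := by
    have h1 : |T ρ - T₀ φ| ≤ S * ρ := by
      have := combT φ _ _ _ _ hP1 hQ1
      rw [← add_mul, ← mul_assoc] at this
      convert! this using 2
      simp only [hT, hT₀, hu, hv]; ring
    have h2 : S * ρ ≤ τ := by
      have h3 : ρ ≤ τ / (S + 1) := hρ.le.trans (min_le_right _ _)
      rw [le_div_iff₀ (by positivity)] at h3
      nlinarith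
    have h3 : 2 * τ ≤ |T₀ φ| := by
      have : |T₀ x| ≤ |T₀ φ| := hmin hφ
      rw [hτ]; linarith
    have h4 := abs_sub_abs_le_abs_sub (T₀ φ) (T ρ)
    rw [abs_sub_comm (T₀ φ) (T ρ)] at h4
    linarith
  have hTpos : 0 < |T ρ| := hτ0.trans_le hTlow
  have hTne : T ρ ≠ 0 := abs_pos.1 hTpos
  have hF : ∀ x, 0 < x → F p q r P Q φ x = x * N x / T x := fun x hx =>
    (F_eq_of_pos h.p_pos h.q_pos hx).2
  constructor
  · rw [hF ρ hρ0, abs_div, abs_mul, abs_of_pos hρ0]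
    refine le_trans ?_ (mul_le_mul_of_nonneg_right (le_max_left _ _) hρ0.le)
    rw [div_mul_eq_mul_div, mul_comm]
    gcongr
  · have hN' : HasDerivAt N (Real.cos φ * dP + Real.sin φ * dQ) ρ :=
      (hP3.const_mul _).add (hQ3.const_mul _)
    have hT' : HasDerivAt T (p * Real.cos φ * dQ - q * Real.sin φ * dP) ρ :=
      (hQ3.const_mul _).sub (hP3.const_mul _)
    have hd := ((hasDerivAt_id ρ).mul hN').fun_div hT' hTne
    have hFd : HasDerivAt (F p q r P Q φ) _ ρ := hd.congr_of_eventuallyEq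
      (by filter_upwards [lt_mem_nhds hρ0] with x hx using hF x hx)
    refine le_trans (le_of_eq_of_le (congrArg abs hFd.deriv) ?_) (le_max_right _ _)
    have b1 : |ρ * (Real.cos φ * dP + Real.sin φ * dQ)| ≤ A + B := by
      have := combP φ _ _ _ _ hP4 hQ4
      convert! this using 2; ring
    have b2 : |ρ * (p * Real.cos φ * dQ - q * Real.sin φ * dP)| ≤ S := by
      have := combT φ _ _ _ _ hP4 hQ4
      convert! this using 2; ring
    simp only [Pi.mul_apply, id, one_mul]
    set N' := ρ * (Real.cos φ * dP + Real.sin φ * dQ) with hN'def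
    set T' := ρ * (p * Real.cos φ * dQ - q * Real.sin φ * dP) with hT'def
    have heq : (N ρ + N') * T ρ - ρ * N ρ * (p * Real.cos φ * dQ - q * Real.sin φ * dP)
        = (N ρ + N') * T ρ - N ρ * T' := by rw [hT'def]; ring
    rw [heq, abs_div, abs_pow]
    have hAB : 0 ≤ A + B := by positivity
    have b3 : |(N ρ + N') * T ρ - N ρ * T'| ≤ 2 * ((A + B) * S + (A + B) * S) := by
      have c1 : |(N ρ + N') * T ρ| ≤ (A + B + (A + B)) * S := by
        rw [abs_mul]
        exact mul_le_mul ((abs_add_le _ _).trans (add_le_add hNb b1)) hTb (abs_nonneg _)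
          (by positivity)
      have c2 : |N ρ * T'| ≤ (A + B) * S := by
        rw [abs_mul]; exact mul_le_mul hNb b2 (abs_nonneg _) hAB
      have c3 := abs_sub ((N ρ + N') * T ρ) (N ρ * T')
      have c4 : 0 ≤ (A + B) * S := by positivity
      linarith
    gcongr

/-- On an arc of non-characteristic directions, the leading coefficient of an inverse integrating
factor vanishes everywhere or nowhere. -/
theorem leading_eq_zero_of_arc (h : GoodStrip p q r P Q e) (hr : IsLeadingDegree p q r P Q)
    {Pi : ℝ → ℝ} (hPi : IsPoincareMap p q r P Q Pi) {V : ℝ → ℝ → ℝ}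
    (hV : ContDiffOn ℝ 1 (fun z : ℝ × ℝ => V z.1 z.2) (strip e))
    (hpde : ∀ z ∈ strip e, deriv (fun φ => V φ z.2) z.1
      + dRho V z.1 z.2 * F p q r P Q z.1 z.2 = dRho (F p q r P Q) z.1 z.2 * V z.1 z.2)
    (ha : 0 ≤ a) (hb : b ≤ 2 * Real.pi) (hΩ : ∀ φ ∈ Icc a b, φ ∉ Omega p q r P Q)
    {s t A : ℝ} (hs : s ∈ Icc a b) (ht : t ∈ Icc a b) {m : ℤ}
    (hsA : Tendsto (fun ρ => V s ρ / ρ ^ m) (𝓝[>] 0) (𝓝 A))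
    (ht0 : Tendsto (fun ρ => V t ρ / ρ ^ m) (𝓝[>] 0) (𝓝 0)) : A = 0 := by
  have hab : a ≤ b := hs.1.trans hs.2
  obtain ⟨e₁, he₁, he₁e, L, hL0, hL⟩ := exists_F_bounds h hr hab hΩ
  set E := Real.exp (L * (b - a)) with hE
  have hE1 : 1 ≤ E := Real.one_le_exp (mul_nonneg hL0 (sub_nonneg.2 hab))
  have hE0 : 0 < E := one_pos.trans_le hE1
  -- One factor `E` bounds the change of `V`, and `E ^ |m|` the change of `ρ ^ m` for either sign of
  -- `m`.
  set κ := E * E ^ m.natAbs with hκ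
  have hκ0 : 0 < κ := by positivity
  by_contra hA
  have hA' : 0 < |A| := abs_pos.2 hA
  have h1 : ∀ᶠ ρ in 𝓝[>] (0 : ℝ), |A| / 2 < |V s ρ / ρ ^ m| :=
    hsA.abs.eventually_const_lt (by linarith)
  have h2 : ∀ᶠ ρ in 𝓝[>] (0 : ℝ), |V t ρ / ρ ^ m| < |A| / (2 * κ) :=
    ht0.abs.eventually_lt_const (by rw [abs_zero]; positivity)
  obtain ⟨e₂, he₂, h12⟩ := mem_nhdsGT_iff_exists_Ioo_subset.1 (h1.and h2)
  have he₂ : 0 < e₂ := he₂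
  -- A single sufficiently small solution along the arc suffices for the contradiction; the Poincaré
  -- map supplies it.
  obtain ⟨δ, hδ, hsol⟩ := hPi.exists_isSolOn (lt_min he₁ he₂)
  obtain ⟨Φ, hΦ, -⟩ := hsol (δ / 2) (by linarith) (by linarith)
  have hΦ := hΦ.mono ha hb
  have hΦ1 : ∀ φ ∈ Icc a b, Φ φ < e₁ := fun φ hφ => (hΦ φ hφ).2.1.trans_le (min_le_left _ _)
  have hΦ2 : ∀ φ ∈ Icc a b, Φ φ < e₂ := fun φ hφ => (hΦ φ hφ).2.1.trans_le (min_le_right _ _)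
  have hΦe : IsSolOn (F p q r P Q) e a b Φ := hΦ.mono_strip ((min_le_left _ _).trans he₁e)
  have hratio : ∀ {x y : ℝ}, x ∈ Icc a b → y ∈ Icc a b → Φ y ≤ Φ x * E := by
    intro x y hx hy
    have := abs_le_mul_exp_of_abs_deriv_le hL0 (fun φ hφ => (hΦ φ hφ).2.2) (fun φ hφ => by
      rw [abs_of_pos (hΦ φ hφ).1]
      exact (hL φ hφ _ (hΦ φ hφ).1 (hΦ1 φ hφ)).1) hx hy
    rwa [abs_of_pos (hΦ x hx).1, abs_of_pos (hΦ y hy).1] at this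
  have hVle := hΦe.abs_invIntFactor_le hV hpde hL0
    (fun φ hφ => (hL φ hφ _ (hΦ φ hφ).1 (hΦ1 φ hφ)).2) ht hs
  have hs0 := (hΦ s hs).1
  have ht0' := (hΦ t ht).1
  have hpow : Φ t ^ m ≤ E ^ m.natAbs * Φ s ^ m := by
    obtain ⟨n, rfl | rfl⟩ := m.eq_nat_or_neg
    · simp only [zpow_natCast, Int.natAbs_natCast]
      rw [← mul_pow, mul_comm]
      exact pow_le_pow_left₀ ht0'.le (hratio hs ht) n
    · simp only [zpow_neg, zpow_natCast, Int.natAbs_neg, Int.natAbs_natCast]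
      rw [inv_le_iff_one_le_mul₀ (pow_pos ht0' n), mul_right_comm, ← mul_pow,
        ← div_eq_mul_inv, one_le_div (pow_pos hs0 n), mul_comm]
      exact pow_le_pow_left₀ hs0.le (hratio ht hs) n
  have h3 := (h12 ⟨hs0, hΦ2 s hs⟩).1
  have h4 := (h12 ⟨ht0', hΦ2 t ht⟩).2
  have hsm := zpow_pos hs0 m
  have htm := zpow_pos ht0' m
  rw [abs_div, abs_of_pos hsm, lt_div_iff₀ hsm] at h3
  rw [abs_div, abs_of_pos htm, div_lt_iff₀ htm] at h4
  have h5 : |V s (Φ s)| ≤ |A| / 2 * Φ s ^ m := by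
    calc |V s (Φ s)| ≤ |V t (Φ t)| * E := hVle
      _ ≤ |A| / (2 * κ) * Φ t ^ m * E := by gcongr
      _ ≤ |A| / (2 * κ) * (E ^ m.natAbs * Φ s ^ m) * E := by gcongr
      _ = |A| / 2 * Φ s ^ m := by rw [hκ]; field_simp
  linarith

end Monodromic

namespace Monodromic

open scoped ContDiff
open Asymptotics

/-! ### One-dimensional analysis of the Poincaré map -/

/-- A power series that converges on `(0, δ)` has an analytic sum near `0`. -/
theorem exists_analyticAt_of_hasSum {c : ℕ → ℝ} {B : ℝ → ℝ} {δ : ℝ} (hδ : 0 < δ)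
    (h : ∀ ρ, 0 < ρ → ρ < δ → HasSum (fun k => c k * ρ ^ k) (B ρ)) :
    ∃ g : ℝ → ℝ, AnalyticAt ℝ g 0 ∧ g 0 = c 0 ∧ ∀ ρ, 0 < ρ → ρ < δ → g ρ = B ρ := by
  set S := FormalMultilinearSeries.ofScalars ℝ c with hS
  have hval : ∀ x, S.sum x = ∑' n, c n * x ^ n := fun x => by
    rw [FormalMultilinearSeries.sum]
    refine tsum_congr fun n => ?_
    rw [hS, FormalMultilinearSeries.ofScalars_apply_eq, smul_eq_mul]
  have hd : 0 < δ / 2 := by linarith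
  have hrad : ENNReal.ofNNReal ⟨δ / 2, hd.le⟩ ≤ S.radius := by
    refine S.le_radius_of_tendsto (l := 0) ?_
    have h1 := (h (δ / 2) hd (by linarith)).summable.tendsto_atTop_zero.norm
    rw [norm_zero] at h1
    refine h1.congr fun n => ?_
    rw [hS, FormalMultilinearSeries.ofScalars_norm, norm_mul, norm_pow,
      Real.norm_of_nonneg hd.le]
    rfl
  have hpos : 0 < S.radius := lt_of_lt_of_le (ENNReal.coe_pos.2 hd) hrad
  refine ⟨S.sum, (S.hasFPowerSeriesOnBall hpos).analyticAt, ?_, fun ρ h0 h1 => ?_⟩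
  · rw [hval, tsum_eq_single 0 fun n hn => by simp [hn]]
    simp
  · rw [hval, (h ρ h0 h1).tsum_eq]

/-- An analytic function has a smooth local primitive. -/
theorem exists_primitive {g : ℝ → ℝ} (hg : AnalyticAt ℝ g 0) :
    ∃ G : ℝ → ℝ, ContDiffAt ℝ ∞ G 0 ∧ ∀ᶠ x in 𝓝 0, HasDerivAt G (g x) x := by
  obtain ⟨ε, hε, han⟩ := Metric.eventually_nhds_iff_ball.1 hg.eventually_analyticAt
  have hcont : ContinuousOn g (Metric.ball 0 ε) := fun x hx => (han x hx).continuousAt.continuousWithinAt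
  set G := fun x => ∫ t in (0 : ℝ)..x, g t with hG
  have hd : ∀ x ∈ Metric.ball (0 : ℝ) ε, HasDerivAt G (g x) x := by
    intro x hx
    have hsub : uIcc 0 x ⊆ Metric.ball 0 ε :=
      (convex_ball (0 : ℝ) ε).ordConnected.uIcc_subset (Metric.mem_ball_self hε) hx
    exact intervalIntegral.integral_hasDerivAt_right ((hcont.mono hsub).intervalIntegrable)
      (hcont.stronglyMeasurableAtFilter Metric.isOpen_ball x hx) (han x hx).continuousAt
  refine ⟨G, ?_, Metric.eventually_nhds_iff_ball.2 ⟨ε, hε, hd⟩⟩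
  have : ContDiffOn ℝ ∞ G (Metric.ball 0 ε) := by
    rw [contDiffOn_infty_iff_deriv_of_isOpen Metric.isOpen_ball]
    refine ⟨fun x hx => (hd x hx).differentiableAt.differentiableWithinAt, ?_⟩
    exact ContDiffOn.congr (fun x hx => (han x hx).contDiffAt.contDiffWithinAt)
      fun x hx => (hd x hx).deriv
  exact this.contDiffAt (Metric.ball_mem_nhds 0 hε)

/-- A primitive of `g x / x ^ (n + 1)` for `g` analytic: a Laurent part plus a logarithm. -/
theorem exists_laurent_primitive (n : ℕ) : ∀ g : ℝ → ℝ, AnalyticAt ℝ g 0 →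
    ∃ (A : ℝ → ℝ) (κ : ℝ), ContDiffAt ℝ ∞ A 0 ∧ (n = 0 → κ = g 0) ∧ (n ≠ 0 → n * A 0 = -g 0) ∧
      ∀ᶠ x in 𝓝[>] (0 : ℝ),
        HasDerivAt (fun x => A x / x ^ n + κ * Real.log x) (g x / x ^ (n + 1)) x := by
  induction n with
  | zero =>
    intro g hg
    obtain ⟨s, hs⟩ := hg
    have h1 : AnalyticAt ℝ (dslope g 0) 0 := ⟨_, hs.has_fpower_series_dslope_fslope⟩
    obtain ⟨A, hA, hA'⟩ := exists_primitive h1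
    refine ⟨A, g 0, hA, fun _ => rfl, by simp, ?_⟩
    filter_upwards [hA'.filter_mono nhdsWithin_le_nhds, self_mem_nhdsWithin] with x hx hx0
    have hx0 : 0 < x := hx0
    have h2 := hx.fun_add ((Real.hasDerivAt_log hx0.ne').const_mul (g 0))
    simp only [pow_zero, div_one, zero_add, pow_one]
    convert! h2 using 1
    rw [dslope_of_ne _ hx0.ne', slope_def_field, sub_zero]
    field_simp
    ring
  | succ n ih =>
    intro g hg
    obtain ⟨s, hs⟩ := hg
    -- Write `g = g 0 + x * dslope g 0 x`: the constant integrates to a pure power, and the rest has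
    -- a pole of order one less.
    have h1 : AnalyticAt ℝ (dslope g 0) 0 := ⟨_, hs.has_fpower_series_dslope_fslope⟩
    obtain ⟨A, κ, hA, -, -, hA'⟩ := ih _ h1
    refine ⟨fun x => -(g 0) / (n + 1) + x * A x, κ, ?_, by simp, ?_, ?_⟩
    · exact contDiffAt_const.add (contDiffAt_id.mul hA)
    · intro _
      simp only [zero_mul, add_zero]
      push_cast
      field_simp
    filter_upwards [hA', self_mem_nhdsWithin] with x hx hx0
    have hx0 : 0 < x := hx0
    have h2 : HasDerivAt (fun x : ℝ => -(g 0) / (n + 1) * (x ^ (n + 1))⁻¹)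
        (-(g 0) / (n + 1) * (-((n + 1 : ℕ) * x ^ n) / (x ^ (n + 1)) ^ 2)) x := by
      have := (hasDerivAt_pow (n + 1) x).fun_inv (pow_ne_zero _ hx0.ne')
      simpa using this.const_mul (-(g 0) / (n + 1))
    have h3 := h2.fun_add hx
    refine HasDerivAt.congr_of_eventuallyEq (f := fun x : ℝ => -(g 0) / (n + 1) * (x ^ (n + 1))⁻¹
      + (A x / x ^ n + κ * Real.log x)) ?_ ?_
    · convert! h3 using 1
      rw [dslope_of_ne _ hx0.ne', slope_def_field, sub_zero]
      push_cast
      field_simp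
      ring
    · filter_upwards [lt_mem_nhds hx0] with y hy
      field_simp
      ring

/-! ### The functional equation for a primitive of `1 / V` -/

/-- If `W' = 1 / V` and `Π' = V(Π) / V`, then `W ∘ Π - W` is constant. -/
theorem exists_comp_sub_eq_const {W V Pi : ℝ → ℝ} {d δ : ℝ}
    (hV : ∀ x, 0 < x → x < d → V x ≠ 0)
    (hW : ∀ x, 0 < x → x < d → HasDerivAt W (V x)⁻¹ x)
    (hδd : δ ≤ d) (hPi : ∀ x, 0 < x → x < δ → 0 < Pi x ∧ Pi x < d)
    (hPi' : ∀ x, 0 < x → x < δ → HasDerivAt Pi (V (Pi x) / V x) x) :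
    ∃ c, ∀ x, 0 < x → x < δ → W (Pi x) - W x = c := by
  have hder : ∀ x ∈ Ioo 0 δ, HasDerivWithinAt (fun x => W (Pi x) - W x) 0 (Ioo 0 δ) x := by
    intro x hx
    have h1 := hPi x hx.1 hx.2
    have h2 := (hW _ h1.1 h1.2).comp x (hPi' x hx.1 hx.2)
    have h3 := h2.sub (hW x hx.1 (hx.2.trans_le hδd))
    have h4 := hV _ h1.1 h1.2
    convert! h3.hasDerivWithinAt using 1
    field_simp
    simp
  refine ⟨W (Pi (δ / 2)) - W (δ / 2), fun x h0 hx => ?_⟩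
  have hδ : 0 < δ := h0.trans hx
  have := (convex_Ioo 0 δ).norm_image_sub_le_of_norm_hasDerivWithin_le (C := 0) hder
    (fun x _ => by simp) (x := δ / 2) (y := x) ⟨by linarith, by linarith⟩ ⟨h0, hx⟩
  rw [zero_mul] at this
  exact sub_eq_zero.1 (norm_le_zero_iff.1 this)

/-- By Rolle's theorem, since `1 / V` has no zeros. -/
theorem eq_of_primitive_eq {W V : ℝ → ℝ} {d : ℝ} (hV : ∀ x, 0 < x → x < d → V x ≠ 0)
    (hW : ∀ x, 0 < x → x < d → HasDerivAt W (V x)⁻¹ x) {x y : ℝ} (hx0 : 0 < x) (hx : x < d)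
    (hy0 : 0 < y) (hy : y < d) (h : W x = W y) : x = y := by
  have key : ∀ {x y : ℝ}, 0 < x → y < d → W x = W y → ¬ x < y := by
    intro x y hx0 hy h hlt
    have hpos : ∀ z ∈ Icc x y, 0 < z ∧ z < d := fun z hz =>
      ⟨hx0.trans_le hz.1, hz.2.trans_lt hy⟩
    obtain ⟨c, hc, hc0⟩ := exists_hasDerivAt_eq_zero (f := W) (f' := fun z => (V z)⁻¹) hlt
      (fun z hz => (hW z (hpos z hz).1 (hpos z hz).2).continuousAt.continuousWithinAt) h
      fun z hz => hW z (hpos z (Ioo_subset_Icc_self hz)).1 (hpos z (Ioo_subset_Icc_self hz)).2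
    have hc' := hpos c (Ioo_subset_Icc_self hc)
    exact inv_ne_zero (hV c hc'.1 hc'.2) hc0
  exact le_antisymm (not_lt.1 (key hy0 hx h.symm)) (not_lt.1 (key hx0 hy h))

/-- The implicit function theorem for the equation satisfied by `Π(ρ) / ρ`. -/
theorem exists_smooth_quotient {n : ℕ} {A : ℝ → ℝ} {κ g₀ c : ℝ} (hA : ContDiffAt ℝ ∞ A 0)
    (hg₀ : g₀ ≠ 0) (hκ : n = 0 → κ = g₀) (hA0 : n ≠ 0 → n * A 0 = -g₀) :
    ∃ ψ : ℝ → ℝ, ContDiffAt ℝ ∞ ψ 0 ∧ 0 < ψ 0 ∧ (n ≠ 0 → ψ 0 = 1) ∧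
      (n = 0 → ψ 0 = Real.exp (c / g₀)) ∧
      ∀ᶠ x in 𝓝 0, A (x * ψ x) / ψ x ^ n - A x + x ^ n * (κ * Real.log (ψ x) - c) = 0 := by
  -- The equation is `W (x w) - W x = c` multiplied by `x ^ n`. At `x = 0` it reads `κ log w = c`
  -- for `n = 0`, and `A 0 * (w ^ (-n) - 1) = 0` otherwise.
  obtain ⟨w₀, hw₀, hw1, hw2⟩ : ∃ w₀ : ℝ, 0 < w₀ ∧ (n ≠ 0 → w₀ = 1) ∧
      (n = 0 → w₀ = Real.exp (c / g₀)) := by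
    by_cases hn : n = 0
    · exact ⟨_, Real.exp_pos _, fun h => absurd hn h, fun _ => rfl⟩
    · exact ⟨1, one_pos, fun _ => rfl, fun h => absurd h hn⟩
  set E : ℝ × ℝ → ℝ := fun z => A (z.1 * z.2) / z.2 ^ n - A z.1
    + z.1 ^ n * (κ * Real.log z.2 - c) with hE
  have hEc : ContDiffAt ℝ ∞ E (0, w₀) := by
    have h1 : ContDiffAt ℝ ∞ (fun z : ℝ × ℝ => A (z.1 * z.2)) (0, w₀) :=
      ContDiffAt.comp (g := A) (f := fun z : ℝ × ℝ => z.1 * z.2) _ (by simpa using hA)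
        (by fun_prop)
    have h2 : ContDiffAt ℝ ∞ (fun z : ℝ × ℝ => A z.1) (0, w₀) :=
      ContDiffAt.comp (g := A) (f := fun z : ℝ × ℝ => z.1) _ hA (by fun_prop)
    have h3 : ContDiffAt ℝ ∞ (fun z : ℝ × ℝ => Real.log z.2) (0, w₀) :=
      ContDiffAt.log (f := fun z : ℝ × ℝ => z.2) (by fun_prop) hw₀.ne'
    exact ((h1.div (by fun_prop) (pow_ne_zero _ hw₀.ne')).sub h2).add
      ((by fun_prop : ContDiffAt ℝ ∞ (fun z : ℝ × ℝ => z.1 ^ n) (0, w₀)).mul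
        ((contDiffAt_const.mul h3).sub contDiffAt_const))
  have hE0 : E (0, w₀) = 0 := by
    by_cases hn : n = 0
    · subst hn
      simp only [hE, hw2 rfl, Real.log_exp, hκ rfl]
      simp
      field_simp
      simp
    · simp [hE, hw1 hn, hn]
  have hne0 : (∞ : WithTop ℕ∞) ≠ 0 := by simp
  -- The derivative in `w` is `g₀ / w₀` for `n = 0` and `-n * A 0 = g₀` for `n ≥ 1`, nonzero in both
  -- cases.
  obtain ⟨e', he', hEd⟩ : ∃ e' : ℝ, e' ≠ 0 ∧ HasDerivAt (fun w => E (0, w)) e' w₀ := by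
    by_cases hn : n = 0
    · subst hn
      refine ⟨g₀ * w₀⁻¹, mul_ne_zero hg₀ (inv_ne_zero hw₀.ne'), ?_⟩
      have := ((Real.hasDerivAt_log hw₀.ne').const_mul g₀).sub_const c
      simpa [hE, hκ rfl] using this
    · refine ⟨g₀, hg₀, ?_⟩
      have := (((hasDerivAt_pow n w₀).fun_inv (pow_ne_zero _ hw₀.ne')).const_mul (A 0)).sub_const (A 0)
      rw [hw1 hn] at this ⊢
      simp only [one_pow, mul_one, div_one] at this
      simp only [hE, zero_mul, ne_eq, hn, not_false_eq_true, zero_pow, add_zero]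
      convert! this using 1
      linear_combination hA0 hn
  have hfd : fderiv ℝ E (0, w₀) (0, 1) = e' := by
    have h1 : HasDerivAt (fun w => E (0, w)) (fderiv ℝ E (0, w₀) (0, 1)) w₀ :=
      HasFDerivAt.comp_hasDerivAt w₀ (f := fun w : ℝ => ((0 : ℝ), w))
        (hEc.differentiableAt hne0).hasFDerivAt ((hasDerivAt_const _ _).prodMk (hasDerivAt_id _))
    exact h1.unique hEd
  have hinv : (fderiv ℝ E (0, w₀) ∘L .inr ℝ ℝ ℝ).IsInvertible := by
    refine ⟨ContinuousLinearEquiv.unitsEquivAut ℝ (Units.mk0 e' he'), ?_⟩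
    ext
    simp [hfd]
  refine ⟨hEc.implicitFunction hne0 hinv, hEc.contDiffAt_implicitFunction hne0 hinv, ?_⟩
  have hself : hEc.implicitFunction hne0 hinv 0 = w₀ :=
    hEc.implicitFunction_apply_self hne0 hinv
  rw [hself]
  refine ⟨hw₀, hw1, hw2, ?_⟩
  have := hEc.eventually_apply_implicitFunction hne0 hinv
  rw [hE0] at this
  exact this

end Monodromic

namespace Monodromic

open scoped ContDiff
open Asymptotics

/-! ### The dichotomy for the Poincaré map -/

/-- Either `Π` is the identity near `0`, or `m ≥ 1` and `Π(ρ) = ρ ψ(ρ)` with `ψ` smooth. -/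
theorem eq_id_or_exists_smooth_quotient {m : ℤ} {b V Pi : ℝ → ℝ} {d : ℝ} (hd : 0 < d)
    (hb : AnalyticAt ℝ b 0) (hb0 : b 0 ≠ 0)
    (hV : ∀ x, 0 < x → x < d → V x = x ^ m * b x)
    (hPi : Tendsto Pi (𝓝[>] 0) (𝓝[>] 0))
    (hPi' : ∀ᶠ x in 𝓝[>] (0 : ℝ), HasDerivAt Pi (V (Pi x) / V x) x) :
    (∀ᶠ x in 𝓝[>] (0 : ℝ), Pi x = x) ∨
      ∃ (n : ℕ) (ψ : ℝ → ℝ), m = n + 1 ∧ ContDiffAt ℝ ∞ ψ 0 ∧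
        (∀ᶠ x in 𝓝[>] (0 : ℝ), Pi x = x * ψ x) ∧ (n = 0 → ψ 0 ≠ 1) ∧
        (n ≠ 0 → ∃ α ≠ 0, Tendsto (fun x => (Pi x - x) / x ^ (n + 1)) (𝓝[>] 0) (𝓝 α)) := by
  have hg : AnalyticAt ℝ (fun x => (b x)⁻¹) 0 := hb.inv hb0
  have hbne : ∀ᶠ x in 𝓝[>] (0 : ℝ), b x ≠ 0 :=
    (hb.continuousAt.eventually_ne hb0).filter_mono nhdsWithin_le_nhds
  -- a primitive of `1 / V`
  have setup : ∀ W : ℝ → ℝ, (∀ᶠ x in 𝓝[>] (0 : ℝ), HasDerivAt W (x ^ m * b x)⁻¹ x) →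
      ∃ d₁ > 0, ∃ c, (∀ x, 0 < x → x < d₁ → V x = x ^ m * b x ∧ V x ≠ 0 ∧ HasDerivAt W (V x)⁻¹ x) ∧
        ∀ᶠ x in 𝓝[>] (0 : ℝ), 0 < x ∧ x < d₁ ∧ 0 < Pi x ∧ Pi x < d₁ ∧ W (Pi x) - W x = c := by
    intro W hW
    obtain ⟨d₁, hd₁, h1⟩ := mem_nhdsGT_iff_exists_Ioo_subset.1
      ((hbne.and hW).and (Ioo_mem_nhdsGT hd))
    have hd₁ : 0 < d₁ := hd₁
    have hall : ∀ x, 0 < x → x < d₁ → V x = x ^ m * b x ∧ V x ≠ 0 ∧ HasDerivAt W (V x)⁻¹ x := by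
      intro x h0 hx
      obtain ⟨⟨h2, h3⟩, h4⟩ := h1 ⟨h0, hx⟩
      have hVx := hV x h0 h4.2
      refine ⟨hVx, ?_, by rwa [hVx]⟩
      rw [hVx]
      exact mul_ne_zero (zpow_ne_zero _ h0.ne') h2
    have hmaps : ∀ᶠ x in 𝓝[>] (0 : ℝ), Pi x ∈ Ioo 0 d₁ :=
      hPi.eventually (Ioo_mem_nhdsGT hd₁)
    obtain ⟨δ, hδ, h2⟩ := mem_nhdsGT_iff_exists_Ioo_subset.1
      ((hmaps.and hPi').and (Ioo_mem_nhdsGT hd₁))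
    have hδ : 0 < δ := hδ
    obtain ⟨c, hc⟩ := exists_comp_sub_eq_const (W := W) (V := V) (Pi := Pi) (d := d₁)
      (δ := min δ d₁) (fun x h0 hx => (hall x h0 hx).2.1) (fun x h0 hx => (hall x h0 hx).2.2)
      (min_le_right _ _) (fun x h0 hx => (h2 ⟨h0, hx.trans_le (min_le_left _ _)⟩).1.1)
      (fun x h0 hx => (h2 ⟨h0, hx.trans_le (min_le_left _ _)⟩).1.2)
    refine ⟨d₁, hd₁, c, hall, ?_⟩
    filter_upwards [Ioo_mem_nhdsGT (lt_min hδ hd₁)] with x hx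
    have h3 := h2 ⟨hx.1, hx.2.trans_le (min_le_left _ _)⟩
    exact ⟨hx.1, h3.2.2, h3.1.1.1, h3.1.1.2, hc x hx.1 hx.2⟩
  have idcase : ∀ (W : ℝ → ℝ) (d₁ : ℝ),
      (∀ x, 0 < x → x < d₁ → V x = x ^ m * b x ∧ V x ≠ 0 ∧ HasDerivAt W (V x)⁻¹ x) →
      (∀ᶠ x in 𝓝[>] (0 : ℝ), 0 < x ∧ x < d₁ ∧ 0 < Pi x ∧ Pi x < d₁ ∧ W (Pi x) - W x = 0) →
      ∀ᶠ x in 𝓝[>] (0 : ℝ), Pi x = x := by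
    intro W d₁ hall hev
    filter_upwards [hev] with x hx
    exact eq_of_primitive_eq (fun x h0 hx => (hall x h0 hx).2.1) (fun x h0 hx => (hall x h0 hx).2.2)
      hx.2.2.1 hx.2.2.2.1 hx.1 hx.2.1 (sub_eq_zero.1 hx.2.2.2.2)
  rcases le_or_gt m 0 with hm | hm
  · left
    obtain ⟨k, hk⟩ := Int.eq_ofNat_of_zero_le (neg_nonneg.2 hm)
    -- For `m ≤ 0` the function `1 / V` is analytic at `0`, so `W` is continuous there; letting `x →
    -- 0` gives `c = 0`.
    obtain ⟨W, hWc, hW⟩ := exists_primitive (g := fun x => x ^ k * (b x)⁻¹)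
      ((analyticAt_id.pow k).mul hg)
    have hW' : ∀ᶠ x in 𝓝[>] (0 : ℝ), HasDerivAt W (x ^ m * b x)⁻¹ x := by
      filter_upwards [hW.filter_mono nhdsWithin_le_nhds] with x hx
      rwa [mul_inv, ← zpow_neg, hk, zpow_natCast]
    obtain ⟨d₁, hd₁, c, hall, hev⟩ := setup W hW'
    have hWt : Tendsto W (𝓝[>] 0) (𝓝 (W 0)) :=
      hWc.continuousAt.tendsto.mono_left nhdsWithin_le_nhds
    have hlim : Tendsto (fun x => W (Pi x) - W x) (𝓝[>] 0) (𝓝 (W 0 - W 0)) :=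
      (hWt.comp hPi).sub hWt
    have hc0 : c = 0 := by
      rw [sub_self] at hlim
      have : Tendsto (fun x => W (Pi x) - W x) (𝓝[>] 0) (𝓝 c) :=
        tendsto_const_nhds.congr' (by filter_upwards [hev] with x hx using hx.2.2.2.2.symm)
      exact tendsto_nhds_unique this hlim
    rw [hc0] at hev
    exact idcase W d₁ hall hev
  · obtain ⟨n, hn⟩ := Int.eq_ofNat_of_zero_le (Int.le_sub_one_of_lt hm)
    have hmn : m = n + 1 := by omega
    obtain ⟨A, κ, hA, hκ, hA0, hAd⟩ := exists_laurent_primitive n _ hg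
    set W := fun x => A x / x ^ n + κ * Real.log x with hWdef
    have hzp : ∀ x : ℝ, x ^ m = x ^ (n + 1) := fun x => by
      rw [hmn]; exact_mod_cast zpow_natCast x (n + 1)
    have hW' : ∀ᶠ x in 𝓝[>] (0 : ℝ), HasDerivAt W (x ^ m * b x)⁻¹ x := by
      filter_upwards [hAd] with x hx
      convert! hx using 1
      rw [hzp, mul_inv, div_eq_mul_inv, mul_comm]
    obtain ⟨d₁, hd₁, c, hall, hev⟩ := setup W hW'
    by_cases hc : c = 0
    · left
      rw [hc] at hev
      exact idcase W d₁ hall hev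
    right
    obtain ⟨ψ, hψ, hψ0, hψ1, hψ2, hψeq⟩ := exists_smooth_quotient (c := c) hA (inv_ne_zero hb0)
      hκ hA0
    have hψt : Tendsto ψ (𝓝[>] 0) (𝓝 (ψ 0)) :=
      hψ.continuousAt.tendsto.mono_left nhdsWithin_le_nhds
    have hxt : Tendsto (fun x : ℝ => x) (𝓝[>] 0) (𝓝 0) := tendsto_id.mono_left nhdsWithin_le_nhds
    -- `Pi x` and `x * ψ x` have the same image `W x + c` under the injective `W`.
    have hPieq : ∀ᶠ x in 𝓝[>] (0 : ℝ), Pi x = x * ψ x := by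
      have h1 : Tendsto (fun x => x * ψ x) (𝓝[>] 0) (𝓝 0) := by
        have := hxt.mul hψt
        rwa [zero_mul] at this
      filter_upwards [hev, hψeq.filter_mono nhdsWithin_le_nhds, hψt.eventually_const_lt hψ0,
        h1.eventually_lt_const hd₁] with x hx hxE hxψ hxd
      obtain ⟨hx0, hxd₁, hPi0, hPid, hxc⟩ := hx
      refine eq_of_primitive_eq (fun x h0 hx => (hall x h0 hx).2.1)
        (fun x h0 hx => (hall x h0 hx).2.2) hPi0 hPid (mul_pos hx0 hxψ) hxd ?_
      rw [sub_eq_iff_eq_add.1 hxc]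
      simp only [hWdef]
      rw [Real.log_mul hx0.ne' hxψ.ne', mul_pow]
      have hxn : x ^ n ≠ 0 := pow_ne_zero _ hx0.ne'
      have hψn : ψ x ^ n ≠ 0 := pow_ne_zero _ hxψ.ne'
      field_simp at hxE ⊢
      linear_combination -hxE
    refine ⟨n, ψ, hmn, hψ, hPieq, fun hn0 => ?_, fun hn0 => ?_⟩
    · rw [hψ2 hn0, Ne, Real.exp_eq_one_iff]
      exact div_ne_zero hc (inv_ne_zero hb0)
    · refine ⟨c * b 0, mul_ne_zero hc hb0, ?_⟩
      -- The mean value theorem for `W` gives `Π - x = c V(ξ)`, so the leading term is found without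
      -- differentiating `ψ`.
      have hmv : ∀ᶠ x in 𝓝[>] (0 : ℝ), ∃ ξ ∈ uIcc x (Pi x), Pi x - x = c * (ξ ^ (n + 1) * b ξ) := by
        filter_upwards [hev] with x hx
        obtain ⟨hx0, hxd₁, hPi0, hPid, hxc⟩ := hx
        have key : ∀ {u v : ℝ}, 0 < u → v < d₁ → u < v →
            ∃ ξ ∈ Icc u v, v - u = (W v - W u) * (ξ ^ (n + 1) * b ξ) := by
          intro u v hu hv huv
          have hpos : ∀ z ∈ Icc u v, 0 < z ∧ z < d₁ := fun z hz =>
            ⟨hu.trans_le hz.1, hz.2.trans_lt hv⟩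
          obtain ⟨ξ, hξ, hξ'⟩ := exists_hasDerivAt_eq_slope W (fun z => (V z)⁻¹) huv
            (fun z hz => (hall z (hpos z hz).1 (hpos z hz).2).2.2.continuousAt.continuousWithinAt)
            fun z hz => (hall z (hpos z (Ioo_subset_Icc_self hz)).1
              (hpos z (Ioo_subset_Icc_self hz)).2).2.2
          have hξ0 := hpos ξ (Ioo_subset_Icc_self hξ)
          obtain ⟨h1, h2, -⟩ := hall ξ hξ0.1 hξ0.2
          refine ⟨ξ, Ioo_subset_Icc_self hξ, ?_⟩
          rw [← hzp, ← h1]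
          have h3 : v - u ≠ 0 := (sub_pos.2 huv).ne'
          rw [eq_div_iff h3] at hξ'
          rw [← hξ']
          field_simp
        rcases lt_trichotomy x (Pi x) with h | h | h
        · obtain ⟨ξ, hξ, h1⟩ := key hx0 hPid h
          exact ⟨ξ, Icc_subset_uIcc hξ, by rw [h1, hxc]⟩
        · rw [← h, sub_self] at hxc
          exact absurd hxc.symm hc
        · obtain ⟨ξ, hξ, h1⟩ := key hPi0 hxd₁ h
          refine ⟨ξ, Icc_subset_uIcc' hξ, ?_⟩
          rw [← hxc]
          linear_combination -h1
      -- With `s = ξ / x`, which lies between `1` and `ψ x`, both `s → 1` and `b ξ → b 0`.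
      have hmv' : ∀ᶠ x in 𝓝[>] (0 : ℝ), ∃ s, s ∈ uIcc 1 (ψ x) ∧
          (Pi x - x) / x ^ (n + 1) = c * (s ^ (n + 1) * b (x * s)) := by
        filter_upwards [hmv, hPieq, self_mem_nhdsWithin] with x hx hxψ hx0
        have hx0 : 0 < x := hx0
        obtain ⟨ξ, hξ, h1⟩ := hx
        refine ⟨ξ / x, ?_, ?_⟩
        · rw [hxψ] at hξ
          have h2 : uIcc x (x * ψ x) = (fun y => x * y) '' uIcc 1 (ψ x) := by
            rw [image_const_mul_uIcc, mul_one]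
          rw [h2] at hξ
          obtain ⟨y, hy, rfl⟩ := hξ
          simpa [hx0.ne'] using hy
        · rw [h1, mul_div_cancel₀ _ hx0.ne', div_pow]
          field_simp
      obtain ⟨s, hs⟩ := hmv'.choice
      rw [hψ1 hn0] at hψt
      have hst : Tendsto s (𝓝[>] 0) (𝓝 1) := by
        have h1 : Tendsto (fun x => |ψ x - 1|) (𝓝[>] 0) (𝓝 0) := by
          have := (hψt.sub_const 1).abs
          simpa using this
        refine tendsto_iff_dist_tendsto_zero.2
          (squeeze_zero' (Eventually.of_forall fun x => dist_nonneg) ?_ h1)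
        filter_upwards [hs] with x hx
        rw [Real.dist_eq]
        exact abs_sub_left_of_mem_uIcc hx.1
      have hbt : Tendsto (fun x => b (x * s x)) (𝓝[>] 0) (𝓝 (b 0)) := by
        have := hxt.mul hst
        rw [zero_mul] at this
        exact hb.continuousAt.tendsto.comp this
      have hlim := ((hst.pow (n + 1)).mul hbt).const_mul c
      rw [one_pow, one_mul] at hlim
      refine hlim.congr' ?_
      filter_upwards [hs] with x hx using hx.2.symm

/-! ### Formal expansions and their coefficients -/

/-- Taylor expansion of a smooth function at `0`, to every order. -/
theorem isBigO_sub_taylor {ψ : ℝ → ℝ} (hψ : ContDiffAt ℝ ∞ ψ 0) (N : ℕ) :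
    (fun x => ψ x - ∑ i ∈ Finset.range N, iteratedDeriv i ψ 0 / i.factorial * x ^ i)
      =O[𝓝 0] fun x => x ^ N := by
  obtain ⟨u, hu, hψu⟩ := (hψ.of_le (m := N) (by exact_mod_cast le_top)).contDiffOn le_rfl (by simp)
  obtain ⟨ε, hε, hball⟩ := Metric.mem_nhds_iff.1 (by simpa using hu)
  have hcd : ContDiffOn ℝ N ψ (Metric.ball 0 ε) := hψu.mono hball
  have h0 : (0 : ℝ) ∈ Metric.ball (0 : ℝ) ε := Metric.mem_ball_self hε
  have h1 := taylor_isLittleO (convex_ball (0 : ℝ) ε) h0 hcd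
  rw [Metric.isOpen_ball.nhdsWithin_eq h0] at h1
  have h2 : ∀ x, taylorWithinEval ψ N (Metric.ball 0 ε) 0 x
      = ∑ i ∈ Finset.range N, iteratedDeriv i ψ 0 / i.factorial * x ^ i
        + iteratedDeriv N ψ 0 / N.factorial * x ^ N := by
    intro x
    rw [taylor_within_apply, ← Finset.sum_range_succ]
    refine Finset.sum_congr rfl fun i _ => ?_
    rw [iteratedDerivWithin_of_isOpen Metric.isOpen_ball h0, sub_zero, smul_eq_mul]
    ring
  simp only [sub_zero] at h1
  have h3 : (fun x : ℝ => iteratedDeriv N ψ 0 / N.factorial * x ^ N) =O[𝓝 0] fun x => x ^ N :=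
    isBigO_const_mul_self _ _ _
  refine (h1.isBigO.add h3).congr_left fun x => ?_
  rw [h2]
  ring

/-- A polynomial of degree at most `N` that is `o(x ^ N)` at `0⁺` vanishes. -/
theorem coeff_eq_zero_of_isLittleO (N : ℕ) : ∀ c : ℕ → ℝ,
    (fun x : ℝ => ∑ i ∈ Finset.range (N + 1), c i * x ^ i) =o[𝓝[>] 0] (fun x => x ^ N) →
    ∀ i ≤ N, c i = 0 := by
  have hself : ∀ (N : ℕ) (a : ℝ), (fun x : ℝ => a * x ^ N) =o[𝓝[>] 0] (fun x => x ^ N) → a = 0 := by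
    intro N a h
    have h1 := h.tendsto_div_nhds_zero
    have h2 : Tendsto (fun x : ℝ => a * x ^ N / x ^ N) (𝓝[>] 0) (𝓝 a) := by
      refine tendsto_const_nhds.congr' ?_
      filter_upwards [self_mem_nhdsWithin] with x hx
      have hx : 0 < x := hx
      field_simp
    exact tendsto_nhds_unique h2 h1
  induction N with
  | zero =>
    intro c h i hi
    obtain rfl : i = 0 := by omega
    exact hself 0 _ (by simpa using h)
  | succ N ih =>
    intro c h
    have hpow : (fun x : ℝ => x ^ (N + 1)) =o[𝓝[>] 0] (fun x => x ^ N) :=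
      (isLittleO_pow_pow (Nat.lt_succ_self N)).mono nhdsWithin_le_nhds
    have h1 : ∀ i ≤ N, c i = 0 := by
      refine ih c ?_
      have h2 := (h.trans hpow).sub (hpow.const_mul_left (c (N + 1)))
      refine h2.congr_left fun x => ?_
      rw [Finset.sum_range_succ _ (N + 1)]
      ring
    have h2 : c (N + 1) = 0 := by
      refine hself (N + 1) _ (h.congr_left fun x => ?_)
      rw [Finset.sum_range_succ, Finset.sum_eq_zero fun i hi => ?_, zero_add]
      rw [h1 i (by simpa [Nat.lt_succ_iff] using hi), zero_mul]
    intro i hi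
    rcases hi.eq_or_lt with rfl | h3
    · exact h2
    · exact h1 i (by omega)

theorem sum_Icc_one_eq (η : ℕ → ℝ) (N : ℕ) (x : ℝ) :
    ∑ i ∈ Finset.Icc 1 N, η i * x ^ i = x * ∑ i ∈ Finset.range N, η (i + 1) * x ^ i := by
  induction N with
  | zero => simp
  | succ N ih =>
    rw [Finset.sum_Icc_succ_top (by omega), ih, Finset.sum_range_succ]
    ring

/-- `x ↦ x * ψ x` has a formal expansion when `ψ` is smooth at `0`. -/
theorem hasFormalExpansion_of_smooth {Pi ψ : ℝ → ℝ} (hψ : ContDiffAt ℝ ∞ ψ 0)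
    (h : ∀ᶠ x in 𝓝[>] (0 : ℝ), Pi x = x * ψ x) :
    HasFormalExpansion Pi fun i => iteratedDeriv (i - 1) ψ 0 / (i - 1).factorial := by
  intro N
  have h1 := ((isBigO_refl (fun x : ℝ => x) (𝓝 0)).mul (isBigO_sub_taylor hψ N)).mono
    (nhdsWithin_le_nhds (s := Ioi 0))
  refine h1.congr' ?_ (Eventually.of_forall fun x => (pow_succ' x N).symm)
  filter_upwards [h] with x hx
  rw [hx, sum_Icc_one_eq]
  simp only [Nat.add_sub_cancel]
  ring

theorem hasFormalExpansion_id {Pi : ℝ → ℝ} (h : ∀ᶠ x in 𝓝[>] (0 : ℝ), Pi x = x) :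
    HasFormalExpansion Pi fun i => if i = 1 then 1 else 0 := by
  intro N
  -- For `N = 0` the sum is empty and the term `x` is itself the error.
  rcases Nat.eq_zero_or_pos N with rfl | hN
  · refine (isBigO_refl (fun x : ℝ => x) _).congr' ?_ (Eventually.of_forall fun x => by simp)
    filter_upwards [h] with x hx
    simp [hx]
  · refine (isBigO_zero _ _).congr' ?_ EventuallyEq.rfl
    filter_upwards [h] with x hx
    rw [hx, Finset.sum_eq_single_of_mem 1 (Finset.mem_Icc.2 ⟨le_rfl, hN⟩)]
    · simp
    · intro i _ hi
      simp [hi]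

/-- The leading term of `Π - id` determines the coefficients of the formal expansion of `Π`. -/
theorem exists_leading_form {Pi : ℝ → ℝ} {η : ℕ → ℝ} (hη : HasFormalExpansion Pi η) {m : ℕ}
    (hm : 1 < m) {α : ℝ} (hα : α ≠ 0)
    (h : Tendsto (fun x => (Pi x - x) / x ^ m) (𝓝[>] 0) (𝓝 α)) :
    η m = α ∧ ∃ k : ℝ → ℝ, k =O[𝓝[>] 0] (fun x : ℝ => x) ∧
      ∀ᶠ x in 𝓝[>] (0 : ℝ), Pi x = x + η m * x ^ m * (1 + k x) := by
  have hlo : (fun x => Pi x - x - α * x ^ m) =o[𝓝[>] 0] (fun x : ℝ => x ^ m) := by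
    have h1 : (fun x => (Pi x - x) / x ^ m - α) =o[𝓝[>] 0] (fun _ => (1 : ℝ)) := by
      rw [isLittleO_one_iff]
      simpa using h.sub_const α
    have h2 := h1.mul_isBigO (isBigO_refl (fun x : ℝ => x ^ m) (𝓝[>] 0))
    refine h2.congr' ?_ (Eventually.of_forall fun x => one_mul _)
    filter_upwards [self_mem_nhdsWithin] with x hx
    have hx : 0 < x := hx
    field_simp
  have hexp : (fun x => Pi x - ∑ i ∈ Finset.Icc 1 m, η i * x ^ i) =o[𝓝[>] 0]
      (fun x : ℝ => x ^ m) :=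
    (hη m).trans_isLittleO ((isLittleO_pow_pow (Nat.lt_succ_self m)).mono nhdsWithin_le_nhds)
  -- These are the coefficients of the truncated expansion minus `x + α x ^ m`, with the irrelevant
  -- `η 0` replaced by `0`. The polynomial is `o(x ^ m)`, so they all vanish.
  set c : ℕ → ℝ := fun i => (if i = 0 then 0 else η i) - (if i = 1 then 1 else 0)
    - (if i = m then α else 0) with hc
  have hsum : ∀ x : ℝ, ∑ i ∈ Finset.range (m + 1), c i * x ^ i
      = ∑ i ∈ Finset.Icc 1 m, η i * x ^ i - x - α * x ^ m := by
    intro x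
    simp only [hc, sub_mul, Finset.sum_sub_distrib]
    congr 2
    · rw [Finset.sum_range_succ', sum_Icc_one_eq, Finset.mul_sum]
      simp only [Nat.add_eq_zero_iff, one_ne_zero, and_false, if_false, if_true, zero_mul, add_zero]
      exact Finset.sum_congr rfl fun i _ => by ring
    · rw [Finset.sum_eq_single_of_mem 1 (Finset.mem_range.2 (by omega))]
      · simp
      · intro i _ hi
        simp [hi]
    · rw [Finset.sum_eq_single_of_mem m (Finset.mem_range.2 (by omega))]
      · simp
      · intro i _ hi
        simp [hi]
  have hc0 := coeff_eq_zero_of_isLittleO m c ((hlo.sub hexp).congr_left fun x => by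
    rw [hsum]; ring)
  have hηm : η m = α := by
    have := hc0 m le_rfl
    simp only [hc, if_neg (by omega : m ≠ 0), if_neg (by omega : m ≠ 1), if_true] at this
    linarith
  have hpoly : ∀ x : ℝ, ∑ i ∈ Finset.Icc 1 m, η i * x ^ i = x + α * x ^ m := by
    intro x
    have := hsum x
    rw [Finset.sum_eq_zero fun i hi => by
      rw [hc0 i (Nat.lt_succ_iff.1 (Finset.mem_range.1 hi)), zero_mul]] at this
    linarith
  -- The relative error is `O(x)` rather than merely `o(1)` because the remainder of the expansion
  -- at order `m` is `O(x ^ (m + 1))`.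
  refine ⟨hηm, fun x => (Pi x - x - α * x ^ m) / (α * x ^ m), ?_, ?_⟩
  · have h1 := hη m
    simp only [hpoly] at h1
    have h2 := h1.mul (isBigO_const_mul_self α⁻¹ (fun x : ℝ => (x ^ m)⁻¹) (𝓝[>] 0))
    refine h2.congr' ?_ ?_
    · filter_upwards with x
      rw [div_eq_mul_inv, mul_inv]
      ring
    · filter_upwards [self_mem_nhdsWithin] with x hx
      have hx : 0 < x := hx
      field_simp
      ring
  · filter_upwards [self_mem_nhdsWithin] with x hx
    have hx : 0 < x := hx
    rw [hηm]
    field_simp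
    ring

end Monodromic

namespace Monodromic

/-! ### Laurent inverse integrating factors and the Poincaré map -/

theorem exists_goodStrip {p q r : ℕ} {P Q : ℝ → ℝ → ℝ} (hp : 0 < p) (hq : 0 < q)
    (hP : AnalyticAt ℝ (fun z : ℝ × ℝ => P z.1 z.2) 0)
    (hQ : AnalyticAt ℝ (fun z : ℝ × ℝ => Q z.1 z.2) 0)
    (hΘ : ¬ HasZeroAngularSpeed p q r P Q) : ∃ e, GoodStrip p q r P Q e := by
  obtain ⟨ε, hε, han⟩ := Metric.eventually_nhds_iff_ball.1
    (hP.eventually_analyticAt.and hQ.eventually_analyticAt)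
  unfold HasZeroAngularSpeed at hΘ
  push Not at hΘ
  obtain ⟨ε', hε', hΘ⟩ := hΘ
  refine ⟨min 1 (min ε ε'), hp, hq, by positivity, min_le_left _ _, fun z hz => ?_, fun z hz => ?_,
    fun φ ρ h0 h1 => hΘ φ ρ h0 (h1.trans_le ((min_le_right _ _).trans (min_le_right _ _)))⟩
  · exact (han z (by simpa using hz.trans_le ((min_le_right _ _).trans (min_le_left _ _)))).1
  · exact (han z (by simpa using hz.trans_le ((min_le_right _ _).trans (min_le_left _ _)))).2

/-- A convergent Laurent series is a power of `ρ` times an analytic function. -/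
theorem exists_analytic_factor {c : ℕ → ℝ} {B : ℝ → ℝ} {m : ℤ} {δ : ℝ} (hδ : 0 < δ)
    (h : ∀ ρ, 0 < ρ → ρ < δ → HasSum (fun k : ℕ => c k * ρ ^ (m + k : ℤ)) (B ρ)) :
    ∃ g : ℝ → ℝ, AnalyticAt ℝ g 0 ∧ g 0 = c 0 ∧
      (∀ ρ, 0 < ρ → ρ < δ → B ρ = ρ ^ m * g ρ) ∧
      Tendsto (fun ρ => B ρ / ρ ^ m) (𝓝[>] 0) (𝓝 (c 0)) := by
  obtain ⟨g, hg, hg0, hgB⟩ := exists_analyticAt_of_hasSum (c := c) (B := fun ρ => B ρ / ρ ^ m) hδ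
    fun ρ h0 h1 => by
      have hne : ρ ^ m ≠ 0 := zpow_ne_zero _ h0.ne'
      refine ((h ρ h0 h1).div_const (ρ ^ m)).congr_fun fun k => ?_
      rw [zpow_add₀ h0.ne', zpow_natCast]
      field_simp
  refine ⟨g, hg, hg0, fun ρ h0 h1 => ?_, ?_⟩
  · rw [hgB ρ h0 h1, mul_div_cancel₀ _ (zpow_ne_zero _ h0.ne')]
  · rw [← hg0]
    refine (hg.continuousAt.tendsto.mono_left nhdsWithin_le_nhds).congr' ?_
    filter_upwards [Ioo_mem_nhdsGT hδ] with ρ hρ using hgB ρ hρ.1 hρ.2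

variable {p q r : ℕ} {P Q : ℝ → ℝ → ℝ} {e : ℝ}

theorem Omega_add_two_pi {φ : ℝ} :
    φ + 2 * Real.pi ∈ Omega p q r P Q ↔ φ ∈ Omega p q r P Q := by
  change Theta p q r P Q (φ + 2 * Real.pi) 0 = 0 ↔ Theta p q r P Q φ 0 = 0
  rw [Theta_add_two_pi]

/-- The leading coefficient of a Laurent inverse integrating factor does not vanish on the
transversal section. -/
theorem leading_coeff_ne_zero (h : GoodStrip p q r P Q e) (hr : IsLeadingDegree p q r P Q)
    {Pi : ℝ → ℝ} (hPi : IsPoincareMap p q r P Q Pi) {V : ℝ → ℝ → ℝ}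
    (hV : ContDiffOn ℝ 1 (fun z : ℝ × ℝ => V z.1 z.2) (strip e))
    (hpde : ∀ z ∈ strip e, deriv (fun φ => V φ z.2) z.1
      + dRho V z.1 z.2 * F p q r P Q z.1 z.2 = dRho (F p q r P Q) z.1 z.2 * V z.1 z.2)
    (hVper : ∀ φ ρ, V (φ + 2 * Real.pi) ρ = V φ ρ) {m : ℤ} {v : ℝ → ℝ}
    (hvper : ∀ φ, v (φ + 2 * Real.pi) = v φ)
    (hlim : ∀ φ ∉ Omega p q r P Q, Tendsto (fun ρ => V φ ρ / ρ ^ m) (𝓝[>] 0) (𝓝 (v φ)))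
    {φ₁ : ℝ} (hφ₁ : ∀ ψ ∈ uIcc 0 φ₁, ψ ∉ Omega p q r P Q) (hv : v φ₁ ≠ 0) : v 0 ≠ 0 := by
  intro hv0
  have hpi := Real.two_pi_pos
  have h0 : (0 : ℝ) ∉ Omega p q r P Q := hφ₁ 0 left_mem_uIcc
  have key : ∀ φ, 0 ≤ φ → φ ≤ 2 * Real.pi → (∀ ψ ∈ Icc 0 φ, ψ ∉ Omega p q r P Q) → v φ = 0 := by
    intro φ hφ0 hφ hΩ
    refine leading_eq_zero_of_arc h hr hPi hV hpde le_rfl hφ hΩ (right_mem_Icc.2 hφ0)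
      (left_mem_Icc.2 hφ0) (hlim φ (hΩ φ (right_mem_Icc.2 hφ0))) ?_
    have hlim0 := hlim 0 h0
    rwa [hv0] at hlim0
  -- Without characteristic directions the arc is the whole circle, and `φ₁` can be reduced modulo
  -- `2π`.
  have hfull : (∀ ψ ∈ Icc 0 (2 * Real.pi), ψ ∉ Omega p q r P Q) → False := by
    intro hΩ
    obtain ⟨y, hy, hvy⟩ := Function.Periodic.exists_mem_Ico₀ (f := v) hvper hpi φ₁
    exact hv (hvy.trans (key y hy.1 hy.2.le fun ψ hψ => hΩ ψ ⟨hψ.1, hψ.2.trans hy.2.le⟩))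
  rcases le_total 0 φ₁ with hpos | hneg
  · rw [uIcc_of_le hpos] at hφ₁
    rcases le_total φ₁ (2 * Real.pi) with hle | hge
    · exact hv (key φ₁ hpos hle hφ₁)
    · exact hfull fun ψ hψ => hφ₁ ψ ⟨hψ.1, hψ.2.trans hge⟩
  · rw [uIcc_of_ge hneg] at hφ₁
    -- An arc to the left of `0` is moved to end at `2π`, since the available solutions live over
    -- `[0, 2π]`.
    have hshift : ∀ ψ, φ₁ ≤ ψ - 2 * Real.pi → ψ ≤ 2 * Real.pi → ψ ∉ Omega p q r P Q := by
      intro ψ h1 h2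
      have := hφ₁ (ψ - 2 * Real.pi) ⟨h1, by linarith⟩
      rwa [← Omega_add_two_pi, sub_add_cancel] at this
    rcases le_total (-(2 * Real.pi)) φ₁ with hle | hge
    · have hmem1 : φ₁ + 2 * Real.pi ∈ Icc (φ₁ + 2 * Real.pi) (2 * Real.pi) :=
        ⟨le_rfl, by linarith⟩
      have hmem2 : 2 * Real.pi ∈ Icc (φ₁ + 2 * Real.pi) (2 * Real.pi) := ⟨by linarith, le_rfl⟩
      refine hv (leading_eq_zero_of_arc h hr hPi hV hpde (a := φ₁ + 2 * Real.pi) (by linarith)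
        le_rfl (fun ψ hψ => hshift ψ (by linarith [hψ.1]) hψ.2) hmem1 hmem2 (m := m) ?_ ?_)
      · simp only [hVper]
        exact hlim φ₁ (hφ₁ φ₁ (left_mem_Icc.2 hneg))
      · have h2 : ∀ ρ, V (2 * Real.pi) ρ = V 0 ρ := fun ρ => by
          have := hVper 0 ρ
          rwa [zero_add] at this
        simp only [h2]
        have hlim0 := hlim 0 h0
        rwa [hv0] at hlim0
    · exact hfull fun ψ hψ => hshift ψ (by linarith [hψ.1]) hψ.2

/-- The Poincaré map tends to `0` at `0⁺` and satisfies `V(0, Π) = V(0, ·) Π'`. -/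
theorem IsPoincareMap.hasDerivAt (h : GoodStrip p q r P Q e) {Pi : ℝ → ℝ}
    (hPi : IsPoincareMap p q r P Q Pi) {V : ℝ → ℝ → ℝ}
    (hV : ContDiffOn ℝ 1 (fun z : ℝ × ℝ => V z.1 z.2) (strip e))
    (hpde : ∀ z ∈ strip e, deriv (fun φ => V φ z.2) z.1
      + dRho V z.1 z.2 * F p q r P Q z.1 z.2 = dRho (F p q r P Q) z.1 z.2 * V z.1 z.2)
    (hVper : ∀ φ ρ, V (φ + 2 * Real.pi) ρ = V φ ρ) {m : ℤ} {g : ℝ → ℝ}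
    (hg : ContinuousAt g 0) (hg0 : g 0 ≠ 0) {δ : ℝ} (hδ : 0 < δ)
    (hVg : ∀ ρ, 0 < ρ → ρ < δ → V 0 ρ = ρ ^ m * g ρ) :
    Tendsto Pi (𝓝[>] 0) (𝓝[>] 0) ∧
      ∀ᶠ x in 𝓝[>] (0 : ℝ), HasDerivAt Pi (V 0 (Pi x) / V 0 x) x := by
  have h0I : (0 : ℝ) ∈ Icc 0 (2 * Real.pi) := left_mem_Icc.2 Real.two_pi_pos.le
  have h1I : 2 * Real.pi ∈ Icc 0 (2 * Real.pi) := right_mem_Icc.2 Real.two_pi_pos.le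
  have htend : Tendsto Pi (𝓝[>] 0) (𝓝[>] 0) := by
    rw [(nhdsGT_basis (0 : ℝ)).tendsto_iff (nhdsGT_basis (0 : ℝ))]
    intro ε hε
    obtain ⟨d, hd, hsol⟩ := hPi.exists_isSolOn hε
    refine ⟨d, hd, fun x hx => ?_⟩
    obtain ⟨Φ, hΦ, -, hΦ1⟩ := hsol x hx.1 hx.2
    rw [← hΦ1]
    exact ⟨(hΦ _ h1I).1, (hΦ _ h1I).2.1⟩
  refine ⟨htend, ?_⟩
  -- `g` keeps its sign near `0`, so the absolute value in `hasDerivAt_flow` can be dropped.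
  have hsign : ∀ᶠ x in 𝓝[>] (0 : ℝ), 0 < g x * g 0 := by
    have h1 : Tendsto (fun x => g x * g 0) (𝓝[>] 0) (𝓝 (g 0 * g 0)) :=
      (hg.tendsto.mono_left nhdsWithin_le_nhds).mul_const _
    exact h1.eventually_const_lt (mul_self_pos.2 hg0)
  obtain ⟨d, hd, hsol⟩ := hPi.exists_isSolOn h.e_pos
  choose! Φ hΦ using hsol
  have h2 : ∀ ρ, V (2 * Real.pi) ρ = V 0 ρ := fun ρ => by
    have := hVper 0 ρ
    rwa [zero_add] at this
  filter_upwards [hsign, htend.eventually hsign, Ioo_mem_nhdsGT hd, Ioo_mem_nhdsGT hδ,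
    htend.eventually (Ioo_mem_nhdsGT hδ)] with x hx1 hx2 hx3 hx4 hx5
  have hVx := hVg x hx4.1 hx4.2
  have hVPi := hVg _ hx5.1 hx5.2
  have hgx : g x ≠ 0 := left_ne_zero_of_mul hx1.ne'
  have hVx0 : V 0 x ≠ 0 := by
    rw [hVx]
    exact mul_ne_zero (zpow_ne_zero _ hx4.1.ne') hgx
  have hd := hasDerivAt_flow (contDiffOn_F h) hV hpde Real.two_pi_pos.le
    (fun x h0 h1 => ⟨(hΦ x h0 h1).1, (hΦ x h0 h1).2.1⟩) hx3.1 hx3.2 hVx0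
  rw [(hΦ x hx3.1 hx3.2).2.2, h2, abs_of_pos] at hd
  · refine hd.congr_of_eventuallyEq ?_
    filter_upwards [Ioo_mem_nhds hx3.1 hx3.2] with y hy using (hΦ y hy.1 hy.2).2.2.symm
  · rw [hVx, hVPi]
    have h5 : 0 < g (Pi x) / g x := by
      have : g (Pi x) / g x = g (Pi x) * g 0 / (g x * g 0) := by field_simp
      rw [this]
      exact div_pos hx2 hx1
    rw [mul_div_mul_comm]
    exact mul_pos (div_pos (zpow_pos hx5.1 m) (zpow_pos hx4.1 m)) h5

/-- The form of the Poincaré map in the presence of a Laurent inverse integrating factor. -/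
theorem IsPoincareMap.exists_formalExpansion (hp : 0 < p) (hq : 0 < q)
    (hP : AnalyticAt ℝ (fun z : ℝ × ℝ => P z.1 z.2) 0)
    (hQ : AnalyticAt ℝ (fun z : ℝ × ℝ => Q z.1 z.2) 0)
    (hΘ : ¬ HasZeroAngularSpeed p q r P Q) (hm : IsMonodromic P Q)
    (hr : IsLeadingDegree p q r P Q) (h0 : (0 : ℝ) ∉ Omega p q r P Q)
    {V : ℝ → ℝ → ℝ} {m : ℤ} (hV : IsLaurentInvIntFactor p q r P Q V m) {Pi : ℝ → ℝ}
    (hPi : IsPoincareMap p q r P Q Pi) :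
    ∃ η : ℕ → ℝ, HasFormalExpansion Pi η ∧
      (m ≤ 0 → IsCenter P Q) ∧
      (1 < m →
        (∃ h : ℝ → ℝ, h =O[𝓝[>] 0] (fun ρ : ℝ => ρ) ∧
          ∀ᶠ ρ in 𝓝[>] (0 : ℝ), Pi ρ = ρ + η m.toNat * ρ ^ m.toNat * (1 + h ρ)) ∧
        (η m.toNat = 0 → IsCenter P Q)) ∧
      (m = 1 → η 1 = 1 → IsCenter P Q) := by
  obtain ⟨⟨hVper, eV, heV, hVc, -, hVpde⟩, v, hvper, -, hvsum, φ₁, hφ₁, hvφ₁⟩ := hV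
  obtain ⟨e', he'⟩ := exists_goodStrip hp hq hP hQ hΘ
  have he := he'.mono (lt_min he'.e_pos heV) (min_le_left _ _)
  set e := min e' eV
  have hsub : strip e ⊆ region p q r P Q eV := fun z hz =>
    ⟨hz.1, hz.2.trans_le (min_le_right _ _), he.theta_ne _ _ hz.1 hz.2⟩
  have hVc' := hVc.mono hsub
  have hpde : ∀ z ∈ strip e, deriv (fun φ => V φ z.2) z.1
      + dRho V z.1 z.2 * F p q r P Q z.1 z.2 = dRho (F p q r P Q) z.1 z.2 * V z.1 z.2 :=
    fun z hz => hVpde z (hsub hz)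
  have hlim : ∀ φ ∉ Omega p q r P Q,
      Tendsto (fun ρ => V φ ρ / ρ ^ m) (𝓝[>] 0) (𝓝 (v m φ)) := by
    intro φ hφ
    obtain ⟨δ, hδ, hs⟩ := hvsum φ hφ
    obtain ⟨g, -, -, -, hg⟩ := exists_analytic_factor (c := fun k : ℕ => v (m + k) φ) hδ hs
    simpa using hg
  have hv0 := leading_coeff_ne_zero he hr hPi hVc' hpde hVper (hvper m) hlim hφ₁ hvφ₁
  obtain ⟨δ, hδ, hs⟩ := hvsum 0 h0
  obtain ⟨g, hg, hg0, hVg, -⟩ := exists_analytic_factor (c := fun k : ℕ => v (m + k) 0) hδ hs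
  have hg0 : g 0 ≠ 0 := by simpa [hg0] using hv0
  obtain ⟨htend, hder⟩ := hPi.hasDerivAt he hVc' hpde hVper hg.continuousAt hg0 hδ hVg
  rcases eq_id_or_exists_smooth_quotient hδ hg hg0 hVg htend hder with
    hid | ⟨n, ψ, hmn, hψ, hPiψ, hψ1, hlead⟩
  -- Here `η` is `1` at index `1` and `0` elsewhere, so `η_m = 0` for `m > 1` and the correction `h`
  -- can be taken to be `0`.
  · have hcenter := isCenter_of_poincareMap_eq_id he hm hPi hid
    refine ⟨_, hasFormalExpansion_id hid, fun _ => hcenter,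
      fun hm1 => ⟨⟨0, Asymptotics.isBigO_zero _ _, ?_⟩, fun _ => hcenter⟩, fun _ _ => hcenter⟩
    filter_upwards [hid] with ρ hρ
    rw [if_neg (by omega), hρ]
    simp
  · refine ⟨_, hasFormalExpansion_of_smooth hψ hPiψ, fun h => by omega, fun hm1 => ?_,
      fun hm1 hη => ?_⟩
    · obtain ⟨α, hα, hαt⟩ := hlead (by omega)
      obtain ⟨h1, h2⟩ := exists_leading_form (hasFormalExpansion_of_smooth hψ hPiψ)
        (m := n + 1) (by omega) hα hαt
      rw [show m.toNat = n + 1 by omega]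
      -- Away from the identity case `η_m = α ≠ 0`; likewise `η_1 = ψ 0 ≠ 1` when `m = 1`, so the
      -- hypotheses on coefficients are contradictory.
      exact ⟨h2, fun h3 => absurd (h1.symm.trans h3) hα⟩
    · refine absurd ?_ (hψ1 (by omega))
      simpa using hη

end Monodromic

/-! ### The theorem for the family -/

theorem theorem2 {d : ℕ} (Λ : Set (Fin d → ℝ)) (P Q : (Fin d → ℝ) → ℝ → ℝ → ℝ)
    (p q : ℕ) (r : (Fin d → ℝ) → ℕ) (m : ℤ) (V : (Fin d → ℝ) → ℝ → ℝ → ℝ)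
    (hP : ∀ l ∈ Λ, AnalyticAt ℝ
      (fun z : (Fin d → ℝ) × ℝ × ℝ => P z.1 z.2.1 z.2.2) (l, 0, 0))
    (hQ : ∀ l ∈ Λ, AnalyticAt ℝ
      (fun z : (Fin d → ℝ) × ℝ × ℝ => Q z.1 z.2.1 z.2.2) (l, 0, 0))
    (hmono : ∀ l ∈ Λ, Monodromic.IsMonodromic (P l) (Q l))
    (hW : ∀ l ∈ Λ, (p, q) ∈ Monodromic.newtonWeights (P l) (Q l))
    (hr : ∀ l ∈ Λ, Monodromic.IsLeadingDegree p q (r l) (P l) (Q l))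
    (h0 : ∀ l ∈ Λ, (0 : ℝ) ∉ Monodromic.Omega p q (r l) (P l) (Q l))
    (hV : ∀ l ∈ Λ \ Monodromic.criticalParams p q r P Q Λ,
      Monodromic.IsLaurentInvIntFactor p q (r l) (P l) (Q l) (V l) m) :
    ∀ l ∈ Λ \ Monodromic.criticalParams p q r P Q Λ,
      (∃ Pi : ℝ → ℝ, Monodromic.IsPoincareMap p q (r l) (P l) (Q l) Pi) ∧
      ∀ Pi : ℝ → ℝ, Monodromic.IsPoincareMap p q (r l) (P l) (Q l) Pi →
        ∃ η : ℕ → ℝ, Monodromic.HasFormalExpansion Pi η ∧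
          (m ≤ 0 → Monodromic.IsCenter (P l) (Q l)) ∧
          (1 < m →
            (∃ h : ℝ → ℝ, h =O[𝓝[>] 0] (fun ρ : ℝ => ρ) ∧
              ∀ᶠ ρ in 𝓝[>] (0 : ℝ), Pi ρ = ρ + η m.toNat * ρ ^ m.toNat * (1 + h ρ)) ∧
            (η m.toNat = 0 → Monodromic.IsCenter (P l) (Q l))) ∧
          (m = 1 → η 1 = 1 → Monodromic.IsCenter (P l) (Q l)) := by
  intro l hl
  obtain ⟨hp, hq, -⟩ := hW l hl.1
  have hΘ : ¬ Monodromic.HasZeroAngularSpeed p q (r l) (P l) (Q l) := fun h => hl.2 ⟨hl.1, h⟩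
  -- The argument treats one parameter at a time, so joint analyticity is restricted to the slice at
  -- `l`.
  have hemb : AnalyticAt ℝ (fun z : ℝ × ℝ => (l, z.1, z.2)) 0 :=
    analyticAt_const.prod (analyticAt_fst.prod analyticAt_snd)
  have hPl : AnalyticAt ℝ (fun z : ℝ × ℝ => P l z.1 z.2) 0 :=
    AnalyticAt.comp (g := fun z : (Fin d → ℝ) × ℝ × ℝ => P z.1 z.2.1 z.2.2)
      (f := fun z : ℝ × ℝ => (l, z.1, z.2)) (x := 0) (hP l hl.1) hemb
  have hQl : AnalyticAt ℝ (fun z : ℝ × ℝ => Q l z.1 z.2) 0 :=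
    AnalyticAt.comp (g := fun z : (Fin d → ℝ) × ℝ × ℝ => Q z.1 z.2.1 z.2.2)
      (f := fun z : ℝ × ℝ => (l, z.1, z.2)) (x := 0) (hQ l hl.1) hemb
  obtain ⟨e, he⟩ := Monodromic.exists_goodStrip hp hq hPl hQl hΘ
  refine ⟨Monodromic.exists_isPoincareMap he (hmono l hl.1), fun Pi hPi => ?_⟩
  exact hPi.exists_formalExpansion hp hq hPl hQl hΘ (hmono l hl.1) (hr l hl.1) (h0 l hl.1)
    (hV l hl)
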